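/- Let $0<\alpha<1$ and let $\tau_0,\epsilon_0,\mu_0,\epsilon_\infty>0$, $\epsilon_s>\epsilon_\infty$ be constants, let $\Omega=(a,b)$ with $a<b$, $T>0$, $k\ge 1$, and let $F_1(t),F_2(t),F_3(t)\in L^2(\Omega)$ be sources. Let $(H,E,P)$ be a solution of the one-dimensional Cole–Cole model $$\mu_0\partial_tH=\partial_xE+F_1,\qquad \epsilon_0\epsilon_\infty\partial_tE=\partial_xH-\partial_tP+F_2,\qquad \tau_0^\alpha\partial_t^\alpha P+P=\epsilon_0(\epsilon_s-\epsilon_\infty)E+F_3$$ in $L^2(\Omega)$ for almost every $t\in(0,T)$, where $\partial_t^\alpha P(t)=\frac1{\Gamma(1-\alpha)}\int_0^t(t-s)^{-\alpha}\partial_tP(s)\,ds$ is the Caputo derivative, with the periodic boundary conditions $E(a,t)=E(b,t)$, $H(a,t)=H(b,t)$ and the initial data $E(\cdot,0)=E_0$, $H(\cdot,0)=H_0$, $P(\cdot,0)=0$. Assume $E,H\in C^1([0,T];H^{k+1}(\Omega))$ and $P\in H^1(0,T;L^2(\Omega))$ with $\sup_{t\in[0,T]}\|P(t)\|_{H^{k+1}(\Omega)}<\infty$.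 For $M\ge1$ put $h=(b-a)/M$, $I_j=[x_{j-1/2},x_{j+1/2}]$ with $x_{j+1/2}=a+jh$, $j=1,\dots,M$, and let $V_h$ be the space of functions whose restriction to each $I_j$ is a polynomial of degree at most $k$. For $v\in V_h$ let $v^{\pm}$ be the one-sided limits at the mesh points (periodically continued), $[v]=v^+-v^-$, $\{v\}=\frac12(v^++v^-)$. Let $H_h,E_h,P_h$ and, for every $\lambda>0$, $\psi_h(\cdot;\lambda)$ be $V_h$-valued, absolutely continuous in $t\in[0,T]$, with $\int_0^\infty|\psi_h|\,d\lambda<\infty$ for a.e. $t$, and suppose that, with $\kappa=\frac{1}{\epsilon_0(\epsilon_s-\epsilon_\infty)}$, for all $j$ and all $v\in\mathbb P^k(I_j)$ (and all $\lambda>0$ in the last equation), for a.e. $t\in(0,T)$, $$\int_{I_j}\mu_0\partial_tH_h\,v+\int_{I_j}E_h\,\partial_xv-\widehat{E_h}v^-|_{x_{j+1/2}}+\widehat{E_h}v^+|_{x_{j-1/2}}=\int_{I_j}F_1v,$$ $$\int_{I_j}\epsilon_0\epsilon_\infty\partial_tE_h\,v+\int_{I_j}\partial_tP_h\,v+\int_{I_j}H_h\,\partial_xv-\widehat{H_h}v^-|_{x_{j+1/2}}+\widehat{H_h}v^+|_{x_{j-1/2}}=\int_{I_j}F_2v,$$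 $$\int_{I_j}\int_0^\infty\tau_0^\alpha\kappa\,\psi_h\,v\,d\lambda\,dx+\int_{I_j}\kappa P_h\,v-\int_{I_j}E_h\,v=\int_{I_j}\kappa F_3\,v,$$ $$\int_{I_j}\tau_0^\alpha\kappa\,\partial_t\psi_h\,v+\lambda\int_{I_j}\tau_0^\alpha\kappa\,\psi_h\,v-\frac{\sin(\pi\alpha)}{\pi}\lambda^{\alpha-1}\int_{I_j}\tau_0^\alpha\kappa\,\partial_tP_h\,v=0,$$ with the upwind fluxes $\widehat{E_h}=\{E_h\}+\frac12\sqrt{\mu_0/(\epsilon_0\epsilon_\infty)}\,[H_h]$ and $\widehat{H_h}=\{H_h\}+\frac12\sqrt{\epsilon_0\epsilon_\infty/\mu_0}\,[E_h]$. Let $\mathcal P$ be the $L^2$ projection onto $V_h$, and let $\mathcal P^{\pm}$ be the Gauss–Radau projections onto $V_h$: $\int_{I_j}(\mathcal P^\pm\varphi-\varphi)v\,dx=0$ for all $v\in\mathbb P^{k-1}(I_j)$ and all $j$, with $\mathcal P^+\varphi(x_{j-1/2}^+)=\varphi(x_{j-1/2})$ and $\mathcal P^-\varphi(x_{j+1/2}^-)=\varphi(x_{j+1/2})$.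 Suppose $\psi_h(0;\lambda)=0$ for all $\lambda>0$, $P_h(0)=\mathcal P P(0)$, $$E_h(0)=\tfrac12\mathcal P^+\Big(E_0+\sqrt{\tfrac{\mu_0}{\epsilon_0\epsilon_\infty}}H_0\Big)+\tfrac12\mathcal P^-\Big(E_0-\sqrt{\tfrac{\mu_0}{\epsilon_0\epsilon_\infty}}H_0\Big),\qquad H_h(0)=\tfrac12\mathcal P^+\Big(H_0+\sqrt{\tfrac{\epsilon_0\epsilon_\infty}{\mu_0}}E_0\Big)+\tfrac12\mathcal P^-\Big(H_0-\sqrt{\tfrac{\epsilon_0\epsilon_\infty}{\mu_0}}E_0\Big).$$ Then there is a constant $C>0$, independent of $M$ (that is, of $h$), of $t$, and of the discrete solution, but possibly depending on the coefficients, $\Omega$, $k$, $T$ and the exact solution, such that $$\|E(t)-E_h(t)\|^2+\|H(t)-H_h(t)\|^2+\|P(t)-P_h(t)\|^2\le C\,h^{2k+2}\qquad\text{for all }t\in[0,T],$$ where $\|\cdot\|$ is the norm of $L^2(\Omega)$. -/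

import Mathlib

open MeasureTheory Set
open scoped Polynomial ContDiff

noncomputable section

namespace ColeCole

/-- The constant coefficients of a Cole-Cole medium. -/
structure Medium where
  α : ℝ
  τ₀ : ℝ
  ε₀ : ℝ
  μ₀ : ℝ
  εs : ℝ
  εinf : ℝ
  α_pos : 0 < α
  α_lt_one : α < 1
  τ₀_pos : 0 < τ₀
  ε₀_pos : 0 < ε₀
  μ₀_pos : 0 < μ₀
  εinf_pos : 0 < εinf
  εinf_lt_εs : εinf < εs

/-! ### Function spaces on the interval `Ω = (a, b)` -/

/-- `L²(Ω)`. -/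
abbrev L2 (a b : ℝ) : Type := Lp ℝ 2 (volume.restrict (Ioo a b))

/-- `g` is the weak derivative of order `i` of `f` on `(a, b)`. -/
def IsWeakDeriv {a b : ℝ} (i : ℕ) (f g : L2 a b) : Prop :=
  ∀ φ : ℝ → ℝ, ContDiff ℝ ∞ φ → HasCompactSupport φ → tsupport φ ⊆ Ioo a b →
    ∫ x in Ioo a b, f x * iteratedDeriv i φ x = (-1) ^ i * ∫ x in Ioo a b, g x * φ x

theorem integrable_mul_test {a b : ℝ} (f : L2 a b) {φ : ℝ → ℝ} (hφ : Continuous φ)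
    (hc : HasCompactSupport φ) :
    Integrable (fun x => f x * φ x) (volume.restrict (Ioo a b)) := by
  have h : MemLp φ 2 (volume.restrict (Ioo a b)) := hφ.memLp_of_hasCompactSupport hc
  exact (Lp.memLp f).integrable_mul h

theorem test_iteratedDeriv {φ : ℝ → ℝ} (hφ : ContDiff ℝ ∞ φ) (hc : HasCompactSupport φ) (i : ℕ) :
    Continuous (iteratedDeriv i φ) ∧ HasCompactSupport (iteratedDeriv i φ) := by
  refine ⟨hφ.continuous_iteratedDeriv i (by exact_mod_cast le_top), ?_⟩
  induction i with
  | zero => simpa using hc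
  | succ n ih => rw [iteratedDeriv_succ]; exact ih.deriv

theorem IsWeakDeriv.add {a b : ℝ} {i : ℕ} {f g f₂ g₂ : L2 a b} (h : IsWeakDeriv i f g)
    (h₂ : IsWeakDeriv i f₂ g₂) : IsWeakDeriv i (f + f₂) (g + g₂) := by
  intro φ hφ hc hs
  obtain ⟨hd, hdc⟩ := test_iteratedDeriv hφ hc i
  have key : ∀ (u v : L2 a b) (χ : ℝ → ℝ), Continuous χ → HasCompactSupport χ →
      ∫ x in Ioo a b, (u + v : L2 a b) x * χ x
        = (∫ x in Ioo a b, u x * χ x) + ∫ x in Ioo a b, v x * χ x := by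
    intro u v χ hχ hχc
    rw [← integral_add (integrable_mul_test u hχ hχc) (integrable_mul_test v hχ hχc)]
    refine integral_congr_ae ?_
    filter_upwards [Lp.coeFn_add u v] with x hx
    rw [hx, Pi.add_apply, add_mul]
  rw [key _ _ _ hd hdc, key _ _ _ hφ.continuous hc, h φ hφ hc hs, h₂ φ hφ hc hs, mul_add]

theorem IsWeakDeriv.smul {a b : ℝ} {i : ℕ} {f g : L2 a b} (c : ℝ) (h : IsWeakDeriv i f g) :
    IsWeakDeriv i (c • f) (c • g) := by
  intro φ hφ hc hs
  have key : ∀ (u : L2 a b) (χ : ℝ → ℝ),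
      ∫ x in Ioo a b, (c • u : L2 a b) x * χ x = c * ∫ x in Ioo a b, u x * χ x := by
    intro u χ
    rw [← integral_const_mul]
    refine integral_congr_ae ?_
    filter_upwards [Lp.coeFn_smul c u] with x hx
    rw [hx, Pi.smul_apply, smul_eq_mul, mul_assoc]
  rw [key, key, h φ hφ hc hs]
  ring

/-- The Sobolev space `H^m(Ω)`: a function together with its weak derivatives of orders
`0, …, m`, all in `L²(Ω)`, with the norm `(∑ i ≤ m, ‖∂ₓⁱ u‖²)^(1/2)`. -/
def Sobolev (m : ℕ) (a b : ℝ) : Submodule ℝ (PiLp 2 (fun _ : Fin (m + 1) => L2 a b)) where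
  carrier := {w | ∀ i : Fin (m + 1), IsWeakDeriv (i : ℕ) (w 0) (w i)}
  add_mem' := fun h h₂ i => (h i).add (h₂ i)
  zero_mem' := fun i => by
    have h := IsWeakDeriv.smul (a := a) (b := b) (i := i) (f := 0) (g := 0) 0
    intro φ _ _ _
    have hz : ∀ χ : ℝ → ℝ, ∫ x in Ioo a b, (0 : L2 a b) x * χ x = 0 := by
      intro χ
      rw [← integral_zero ℝ ℝ (μ := volume.restrict (Ioo a b))]
      refine integral_congr_ae ?_
      filter_upwards [Lp.coeFn_zero ℝ 2 (volume.restrict (Ioo a b))] with x hx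
      rw [hx, Pi.zero_apply, zero_mul]
    simp only [PiLp.zero_apply, hz, mul_zero]
  smul_mem' := fun c _ h i => (h i).smul c

/-- The underlying `L²` function of an element of `H^m(Ω)`. -/
def fn {m : ℕ} {a b : ℝ} (u : Sobolev m a b) : L2 a b := u.1 0

/-- The weak derivative `∂ₓ u` of an element of `H^{m+1}(Ω)`. -/
def dx {m : ℕ} {a b : ℝ} (u : Sobolev (m + 1) a b) : L2 a b := u.1 1

/-- `f` is the representative of `u` that is continuous on `[a, b]`. -/
def IsContinuousRep {a b : ℝ} (u : L2 a b) (f : ℝ → ℝ) : Prop :=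
  ContinuousOn f (Icc a b) ∧ u =ᵐ[volume.restrict (Ioo a b)] f

/-- The periodic boundary condition `u(a) = u(b)`. -/
def IsPeriodic {a b : ℝ} (u : L2 a b) : Prop :=
  ∃ f : ℝ → ℝ, IsContinuousRep u f ∧ f a = f b

/-- `u ∈ H¹(0, T; L²(Ω))` with time derivative `u'`. -/
structure IsH1InTime {a b : ℝ} (T : ℝ) (u u' : ℝ → L2 a b) : Prop where
  memLp : MemLp u' 2 (volume.restrict (Ioc 0 T))
  eq_integral : ∀ t ∈ Icc 0 T, u t = u 0 + ∫ s in (0 : ℝ)..t, u' s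

/-- The time derivative of an `H^m(Ω)`-valued curve on `[0, T]`, as an element of `L²(Ω)`. -/
def dt {m : ℕ} {a b : ℝ} (T : ℝ) (u : ℝ → Sobolev m a b) (t : ℝ) : L2 a b :=
  fn (derivWithin u (Icc 0 T) t)

/-- The Caputo derivative of order `α`, written in terms of the time derivative `u'`. -/
def caputo {a b : ℝ} (α : ℝ) (u' : ℝ → L2 a b) (t : ℝ) : L2 a b :=
  (1 / Real.Gamma (1 - α)) • ∫ s in (0 : ℝ)..t, ((t - s) ^ (-α)) • u' s

/-! ### The Cole-Cole model -/

/-- `(H, E, P)` solves the one-dimensional Cole-Cole model on `Ω × (0, T]` with sources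
`F₁, F₂, F₃`, periodic boundary conditions and initial data `E₀`, `H₀`, `P₀ = 0`;
`P'` is the time derivative of `P`. -/
structure IsSolution (c : Medium) {k : ℕ} {a b : ℝ} (T : ℝ) (F₁ F₂ F₃ : ℝ → L2 a b)
    (E₀ H₀ : ℝ → ℝ) (H E P : ℝ → Sobolev (k + 1) a b) (P' : ℝ → L2 a b) : Prop where
  time_deriv_P : IsH1InTime T (fun t => fn (P t)) P'
  eq_H : ∀ᵐ t, t ∈ Ioo 0 T → c.μ₀ • dt T H t = dx (E t) + F₁ t
  eq_E : ∀ᵐ t, t ∈ Ioo 0 T → (c.ε₀ * c.εinf) • dt T E t = dx (H t) - P' t + F₂ t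
  eq_P : ∀ᵐ t, t ∈ Ioo 0 T →
    (c.τ₀ ^ c.α) • caputo c.α P' t + fn (P t) = (c.ε₀ * (c.εs - c.εinf)) • fn (E t) + F₃ t
  periodic_E : ∀ t ∈ Icc 0 T, IsPeriodic (fn (E t))
  periodic_H : ∀ t ∈ Icc 0 T, IsPeriodic (fn (H t))
  init_E : IsContinuousRep (fn (E 0)) E₀
  init_H : IsContinuousRep (fn (H 0)) H₀
  init_P : fn (P 0) = 0

/-! ### The discontinuous Galerkin scheme

The cells are `I_j = [node j, node (j+1)]`, `j = 0, …, M-1`; addition and subtraction of cell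
indices in `Fin M` is cyclic, which encodes periodicity. -/

/-- The mesh size. -/
def meshSize (a b : ℝ) (M : ℕ) : ℝ := (b - a) / M

/-- The mesh points `a = node 0 < ⋯ < node M = b`. -/
def node (a b : ℝ) (M i : ℕ) : ℝ := a + i * meshSize a b M

/-- The space `V_h`: one polynomial of degree at most `k` on each of the `M` cells. -/
abbrev DG (k M : ℕ) : Type := Fin M → Polynomial.degreeLE ℝ (k : WithBot ℕ)

/-- The value at `x` of the polynomial that `v` has on the cell `j`. -/
def DG.val {k M : ℕ} (v : DG k M) (j : Fin M) (x : ℝ) : ℝ := (v j : ℝ[X]).eval x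

/-- The integral over the cell `j`. -/
def cellIntegral (a b : ℝ) {M : ℕ} (j : Fin M) (f : ℝ → ℝ) : ℝ :=
  ∫ x in node a b M j..node a b M ((j : ℕ) + 1), f x

section Traces

variable (a b : ℝ) {k M : ℕ} [NeZero M] (v : DG k M) (j : Fin M)

/-- The limit from the left at the right end of the cell `j`. -/
def trMinus : ℝ := v.val j (node a b M ((j : ℕ) + 1))

/-- The limit from the right at the right end of the cell `j` (periodically continued). -/
def trPlus : ℝ := v.val (j + 1) (node a b M ((j + 1 : Fin M) : ℕ))

/-- The jump at the right end of the cell `j`. -/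
def jump : ℝ := trPlus a b v j - trMinus a b v j

/-- The average at the right end of the cell `j`. -/
def avg : ℝ := (trPlus a b v j + trMinus a b v j) / 2

end Traces

/-- The upwind flux `Ê_h` at the right end of the cell `j`. -/
def fluxE (c : Medium) (a b : ℝ) {k M : ℕ} [NeZero M] (Eh Hh : DG k M) (j : Fin M) : ℝ :=
  avg a b Eh j + 1 / 2 * √(c.μ₀ / (c.ε₀ * c.εinf)) * jump a b Hh j

/-- The upwind flux `Ĥ_h` at the right end of the cell `j`. -/
def fluxH (c : Medium) (a b : ℝ) {k M : ℕ} [NeZero M] (Eh Hh : DG k M) (j : Fin M) : ℝ :=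
  avg a b Hh j + 1 / 2 * √(c.ε₀ * c.εinf / c.μ₀) * jump a b Eh j

/-- A `V_h`-valued curve is absolutely continuous on `[0, T]`. -/
def IsAC {k M : ℕ} (T : ℝ) (u : ℝ → DG k M) : Prop :=
  ∀ (j : Fin M) (i : ℕ), AbsolutelyContinuousOnInterval (fun t => (u t j : ℝ[X]).coeff i) 0 T

/-- The time derivative of a `V_h`-valued curve, evaluated at `x` in the cell `j`. -/
def dtVal {k M : ℕ} (u : ℝ → DG k M) (t : ℝ) (j : Fin M) (x : ℝ) : ℝ :=
  deriv (fun s => (u s).val j x) t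

/-- `(H_h, E_h, P_h, ψ_h)` solves the semi-discrete DG scheme with the upwind flux and periodic
boundary conditions on `(0, T]`; `ψh l t` is the auxiliary variable at `λ = l` and time `t`. -/
structure IsDGSolution (c : Medium) {a b : ℝ} (T : ℝ) (F₁ F₂ F₃ : ℝ → L2 a b) {k M : ℕ}
    [NeZero M] (Hh Eh Ph : ℝ → DG k M) (ψh : ℝ → ℝ → DG k M) : Prop where
  ac_H : IsAC T Hh
  ac_E : IsAC T Eh
  ac_P : IsAC T Ph
  ac_ψ : ∀ l > 0, IsAC T (ψh l)
  /-- the integral over `λ ∈ (0, ∞)` in `eq_P` converges -/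
  integrable_ψ : ∀ᵐ t, t ∈ Ioo 0 T → ∀ (j : Fin M) (x : ℝ),
    IntegrableOn (fun l => (ψh l t).val j x) (Ioi 0)
  eq_H : ∀ᵐ t, t ∈ Ioo 0 T → ∀ (j : Fin M), ∀ v ∈ Polynomial.degreeLE ℝ (k : WithBot ℕ),
    cellIntegral a b j (fun x => c.μ₀ * dtVal Hh t j x * v.eval x)
      + cellIntegral a b j (fun x => (Eh t).val j x * v.derivative.eval x)
      - fluxE c a b (Eh t) (Hh t) j * v.eval (node a b M ((j : ℕ) + 1))
      + fluxE c a b (Eh t) (Hh t) (j - 1) * v.eval (node a b M j)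
    = cellIntegral a b j (fun x => F₁ t x * v.eval x)
  eq_E : ∀ᵐ t, t ∈ Ioo 0 T → ∀ (j : Fin M), ∀ v ∈ Polynomial.degreeLE ℝ (k : WithBot ℕ),
    cellIntegral a b j (fun x => c.ε₀ * c.εinf * dtVal Eh t j x * v.eval x)
      + cellIntegral a b j (fun x => dtVal Ph t j x * v.eval x)
      + cellIntegral a b j (fun x => (Hh t).val j x * v.derivative.eval x)
      - fluxH c a b (Eh t) (Hh t) j * v.eval (node a b M ((j : ℕ) + 1))
      + fluxH c a b (Eh t) (Hh t) (j - 1) * v.eval (node a b M j)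
    = cellIntegral a b j (fun x => F₂ t x * v.eval x)
  eq_P : ∀ᵐ t, t ∈ Ioo 0 T → ∀ (j : Fin M), ∀ v ∈ Polynomial.degreeLE ℝ (k : WithBot ℕ),
    cellIntegral a b j (fun x => ∫ l in Ioi 0,
        c.τ₀ ^ c.α / (c.ε₀ * (c.εs - c.εinf)) * (ψh l t).val j x * v.eval x)
      + cellIntegral a b j (fun x => (Ph t).val j x / (c.ε₀ * (c.εs - c.εinf)) * v.eval x)
      - cellIntegral a b j (fun x => (Eh t).val j x * v.eval x)
    = cellIntegral a b j (fun x => F₃ t x / (c.ε₀ * (c.εs - c.εinf)) * v.eval x)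
  eq_ψ : ∀ l > 0, ∀ᵐ t, t ∈ Ioo 0 T → ∀ (j : Fin M),
    ∀ v ∈ Polynomial.degreeLE ℝ (k : WithBot ℕ),
    cellIntegral a b j (fun x =>
        c.τ₀ ^ c.α / (c.ε₀ * (c.εs - c.εinf)) * dtVal (ψh l) t j x * v.eval x)
      + l * cellIntegral a b j (fun x =>
        c.τ₀ ^ c.α / (c.ε₀ * (c.εs - c.εinf)) * (ψh l t).val j x * v.eval x)
      - Real.sin (Real.pi * c.α) / Real.pi * l ^ (c.α - 1) * cellIntegral a b j (fun x =>
        c.τ₀ ^ c.α / (c.ε₀ * (c.εs - c.εinf)) * dtVal Ph t j x * v.eval x)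
    = 0

/-! ### Projections and initial data -/

/-- `w` is the `L²` projection `𝒫 φ`. -/
def IsL2Proj (a b : ℝ) {k M : ℕ} (φ : ℝ → ℝ) (w : DG k M) : Prop :=
  ∀ (j : Fin M), ∀ v ∈ Polynomial.degreeLE ℝ (k : WithBot ℕ),
    cellIntegral a b j (fun x => (w.val j x - φ x) * v.eval x) = 0

/-- `w` is the Gauss-Radau projection `𝒫⁺ φ` (exact at the left ends of the cells). -/
def IsRadauPlus (a b : ℝ) {k M : ℕ} (φ : ℝ → ℝ) (w : DG k M) : Prop :=
  ∀ j : Fin M,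
    (∀ v ∈ Polynomial.degreeLT ℝ k,
      cellIntegral a b j (fun x => (w.val j x - φ x) * v.eval x) = 0) ∧
    w.val j (node a b M j) = φ (node a b M j)

/-- `w` is the Gauss-Radau projection `𝒫⁻ φ` (exact at the right ends of the cells). -/
def IsRadauMinus (a b : ℝ) {k M : ℕ} (φ : ℝ → ℝ) (w : DG k M) : Prop :=
  ∀ j : Fin M,
    (∀ v ∈ Polynomial.degreeLT ℝ k,
      cellIntegral a b j (fun x => (w.val j x - φ x) * v.eval x) = 0) ∧
    w.val j (node a b M ((j : ℕ) + 1)) = φ (node a b M ((j : ℕ) + 1))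

/-- `w = ½ 𝒫⁺(E + √(μ₀/(ε₀ε∞)) H) + ½ 𝒫⁻(E - √(μ₀/(ε₀ε∞)) H)`. -/
def IsProjE (c : Medium) (a b : ℝ) {k M : ℕ} (E H : ℝ → ℝ) (w : DG k M) : Prop :=
  ∃ p q : DG k M,
    IsRadauPlus a b (fun x => E x + √(c.μ₀ / (c.ε₀ * c.εinf)) * H x) p ∧
    IsRadauMinus a b (fun x => E x - √(c.μ₀ / (c.ε₀ * c.εinf)) * H x) q ∧
    w = (1 / 2 : ℝ) • p + (1 / 2 : ℝ) • q

/-- `w = ½ 𝒫⁺(H + √(ε₀ε∞/μ₀) E) + ½ 𝒫⁻(H - √(ε₀ε∞/μ₀) E)`. -/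
def IsProjH (c : Medium) (a b : ℝ) {k M : ℕ} (E H : ℝ → ℝ) (w : DG k M) : Prop :=
  ∃ p q : DG k M,
    IsRadauPlus a b (fun x => H x + √(c.ε₀ * c.εinf / c.μ₀) * E x) p ∧
    IsRadauMinus a b (fun x => H x - √(c.ε₀ * c.εinf / c.μ₀) * E x) q ∧
    w = (1 / 2 : ℝ) • p + (1 / 2 : ℝ) • q

/-- The squared error `‖u - v‖²` in `L²(Ω)`, summed over the cells. -/
def errSq {a b : ℝ} {k M : ℕ} (u : L2 a b) (v : DG k M) : ℝ :=
  ∑ j : Fin M, cellIntegral a b j (fun x => (u x - v.val j x) ^ 2)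

end ColeCole

end

noncomputable section

namespace ColeCole

/-! ### Abel kernels -/

/-! The error is split at projections of the exact fields that suit the upwind flux. With `Z =
√(μ₀/(ε₀ε∞))` the fluxes satisfy `Ê + ZĤ = (E + ZH)⁺` and `Ê - ZĤ = (E - ZH)⁻`, so the scheme
upwinds the characteristic variables `E ± ZH` separately. Projecting `E + ZH` by `𝒫⁺` and `E - ZH`
by `𝒫⁻` makes the numerical fluxes of the projected fields equal to the exact traces, and the cell
terms see only moments of degree less than `k`. Hence the discretization of `∂ₓ` produces no
projection error (`weakForm_projE`, `weakForm_projH`), and the upwind form of the discrete error has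
a sign (`upwind_nonneg`). What remains in the energy balance is the projection error of the time
derivatives, of order `h^(k+1)`, and the coupling of the electric error with the time derivative of
the polarization error `p`.

The auxiliary variables are removed exactly: Duhamel's formula, the Laplace representation of
`t^(-α)` and Euler's reflection formula show that their integral over `λ` is the Caputo derivative
of `P_h` (`integral_auxiliary`). So each coordinate of the polarization error in an orthonormal
basis of `V_h` satisfies `θ D^α p + κ p = y + d`, where `y` is the electric error and `d` comes from
the projection error of `E`. Multiplying by `p'` turns the coupling into `θ D^α p · p'`, whose time
integral is nonnegative (`caputo_positive`), plus the derivative of `κ p²/2`, minus `d p'`. Nothing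
bounds `p'`, so the last term is integrated by parts in time.

For positivity, let `f = D^α p`. Abel inversion gives `p` as the convolution of `f` with
`t^(α-1)/Γ(α)`, and this kernel is a superposition of decaying exponentials, for each of which
positivity is elementary (`exp_conv_positive`).

Evaluating the energy at the time of its maximum bounds it without Gronwall's lemma
(`energy_estimate`), with a constant independent of the dimension of `V_h`. The order `h^(k+1)` is
that of Gauss-Radau interpolation (`radauOp_error`). -/

theorem integral_rpow_mul_rpow_sub {α t : ℝ} (h0 : 0 < α) (h1 : α < 1) (ht : 0 < t) :
    ∫ s in (0 : ℝ)..t, s ^ (-α) * (t - s) ^ (α - 1) = Real.Gamma (1 - α) * Real.Gamma α := by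
  -- This is the Beta integral with parameters `1 - α` and `α`; they add up to `1`, so the power of
  -- `t` disappears.
  have key := Complex.betaIntegral_scaled ((1 - α : ℝ) : ℂ) ((α : ℝ) : ℂ) ht
  have hG := Complex.Gamma_mul_Gamma_eq_betaIntegral (s := ((1 - α : ℝ) : ℂ))
    (t := ((α : ℝ) : ℂ)) (by rw [Complex.ofReal_re]; linarith) (by simpa using h0)
  have e1 : ((1 - α : ℝ) : ℂ) + ((α : ℝ) : ℂ) = 1 := by push_cast; ring
  rw [e1, Complex.Gamma_one, one_mul] at hG
  rw [e1, sub_self, Complex.cpow_zero, one_mul, ← hG, Complex.Gamma_ofReal, Complex.Gamma_ofReal]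
    at key
  apply Complex.ofReal_injective
  rw [← intervalIntegral.integral_ofReal, Complex.ofReal_mul, ← key]
  refine intervalIntegral.integral_congr fun s hs => ?_
  rw [uIcc_of_le ht.le] at hs
  simp only [Complex.ofReal_mul]
  rw [Complex.ofReal_cpow hs.1, Complex.ofReal_cpow (sub_nonneg.2 hs.2)]
  push_cast
  ring_nf

/-- The restriction of a kernel to `(0, T]`. -/
def cutoff (T : ℝ) (g : ℝ → ℝ) : ℝ → ℝ := (Ioc 0 T).indicator g

theorem cutoff_mul_cutoff_sub {T t : ℝ} (ht : t ≤ T) (u g : ℝ → ℝ) :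
    (fun s => cutoff T u s * cutoff T g (t - s))
      = (Ioo 0 t).indicator fun s => u s * g (t - s) := by
  funext s
  by_cases hs : s ∈ Ioo 0 t
  · have h1 : s ∈ Ioc 0 T := ⟨hs.1, hs.2.le.trans ht⟩
    have h2 : t - s ∈ Ioc 0 T := ⟨sub_pos.2 hs.2, by linarith [hs.1]⟩
    simp [cutoff, hs, h1, h2]
  · rw [indicator_of_notMem hs]
    by_cases h1 : s ∈ Ioc 0 T
    · have h2 : t - s ∉ Ioc 0 T := fun h => hs ⟨h1.1, by linarith [h.1]⟩
      simp [cutoff, h2]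
    · simp [cutoff, h1]

theorem integrable_cutoff {T : ℝ} (hT : 0 ≤ T) {u : ℝ → ℝ} (hu : IntervalIntegrable u volume 0 T) :
    Integrable (cutoff T u) := by
  rw [cutoff, integrable_indicator_iff measurableSet_Ioc]
  exact (intervalIntegrable_iff_integrableOn_Ioc_of_le hT).1 hu

/-- Cutting both kernels off to `(0, T]` turns Volterra integrals into convolutions on the whole
line, for which almost-everywhere existence and associativity are available. -/
theorem convolution_cutoff {T t : ℝ} (h0 : 0 ≤ t) (ht : t ≤ T) (u g : ℝ → ℝ) :
    (convolution (cutoff T u) (cutoff T g) (ContinuousLinearMap.mul ℝ ℝ)) t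
      = ∫ s in (0 : ℝ)..t, u s * g (t - s) := by
  rw [convolution_def]
  simp only [ContinuousLinearMap.mul_apply']
  rw [cutoff_mul_cutoff_sub ht, integral_indicator measurableSet_Ioo,
    intervalIntegral.integral_of_le h0, integral_Ioc_eq_integral_Ioo]

theorem convolutionExistsAt_cutoff {T t : ℝ} (h0 : 0 ≤ t) (ht : t ≤ T) {u g : ℝ → ℝ} :
    ConvolutionExistsAt (cutoff T u) (cutoff T g) t (ContinuousLinearMap.mul ℝ ℝ)
      ↔ IntervalIntegrable (fun s => u s * g (t - s)) volume 0 t := by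
  rw [ConvolutionExistsAt]
  simp only [ContinuousLinearMap.mul_apply']
  rw [cutoff_mul_cutoff_sub ht, integrable_indicator_iff measurableSet_Ioo,
    intervalIntegrable_iff_integrableOn_Ioo_of_le h0]

theorem ae_intervalIntegrable_conv {T : ℝ} (hT : 0 ≤ T) {u g : ℝ → ℝ}
    (hu : IntervalIntegrable u volume 0 T) (hg : IntervalIntegrable g volume 0 T) :
    ∀ᵐ t, t ∈ Ioo 0 T → IntervalIntegrable (fun s => u s * g (t - s)) volume 0 t := by
  have h := (integrable_cutoff hT hu).ae_convolution_exists (ContinuousLinearMap.mul ℝ ℝ)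
    (integrable_cutoff hT hg)
  filter_upwards [h] with t ht hm
  exact (convolutionExistsAt_cutoff hm.1.le hm.2.le).1 ht

theorem norm_cutoff_rpow {T r : ℝ} :
    (fun x => ‖cutoff T (fun x => x ^ r) x‖) = cutoff T (fun x => x ^ r) := by
  funext x
  rw [Real.norm_of_nonneg]
  exact indicator_nonneg (fun y hy => Real.rpow_nonneg hy.1.le _) x

theorem norm_cutoff {T : ℝ} (u : ℝ → ℝ) :
    (fun x => ‖cutoff T u x‖) = cutoff T (fun x => |u x|) := by
  funext x
  simp only [cutoff, norm_indicator_eq_indicator_norm, Real.norm_eq_abs]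

/-- Abel's inversion formula. -/
theorem abel_inversion {α T t : ℝ} (h0 : 0 < α) (h1 : α < 1) (hT : 0 < T) (ht : t ∈ Icc 0 T)
    {u : ℝ → ℝ} (hu : IntervalIntegrable u volume 0 T) {f : ℝ → ℝ}
    (hf : ∀ᵐ t, t ∈ Ioo 0 T → f t = ∫ s in (0 : ℝ)..t, u s * (t - s) ^ (-α)) :
    ∫ s in (0 : ℝ)..t, f s * (t - s) ^ (α - 1)
      = Real.Gamma (1 - α) * Real.Gamma α * ∫ s in (0 : ℝ)..t, u s := by
  have hg1 : IntervalIntegrable (fun x : ℝ => x ^ (-α)) volume 0 T :=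
    intervalIntegral.intervalIntegrable_rpow' (by linarith)
  have hg2 : IntervalIntegrable (fun x : ℝ => x ^ (α - 1)) volume 0 T :=
    intervalIntegral.intervalIntegrable_rpow' (by linarith)
  have hU := integrable_cutoff hT.le hu
  have hG1 := integrable_cutoff hT.le hg1
  have hG2 := integrable_cutoff hT.le hg2
  set L := ContinuousLinearMap.mul ℝ ℝ with hL
  -- The two Abel kernels convolve to a constant on `(0, T]`, so convolving `u` with both of them is
  -- a multiple of plain integration.
  have hconv : ∀ x, x ≤ T → convolution (cutoff T fun x => x ^ (-α)) (cutoff T fun x => x ^ (α - 1)) L volume x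
      = if 0 < x then Real.Gamma (1 - α) * Real.Gamma α else 0 := by
    intro x hx
    by_cases hx0 : 0 < x
    · rw [if_pos hx0, convolution_cutoff hx0.le hx, integral_rpow_mul_rpow_sub h0 h1 hx0]
    · rw [if_neg hx0, convolution_def]
      simp only [hL, ContinuousLinearMap.mul_apply']
      rw [cutoff_mul_cutoff_sub hx, Ioo_eq_empty hx0]
      simp
  have hprod : ∀ w : ℝ → ℝ, (fun s => L (cutoff T w s) (convolution (cutoff T fun x => x ^ (-α))
        (cutoff T fun x => x ^ (α - 1)) L volume (t - s)))
      = (Ioo 0 t).indicator fun s => w s * (Real.Gamma (1 - α) * Real.Gamma α) := by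
    intro w
    funext s
    simp only [hL, ContinuousLinearMap.mul_apply']
    by_cases hs : s ∈ Ioc 0 T
    · rw [← hL, hconv _ (by linarith [hs.1, ht.2])]
      by_cases hst : s < t
      · have hm : s ∈ Ioo 0 t := ⟨hs.1, hst⟩
        simp [cutoff, hs, hst, hm]
      · have hm : s ∉ Ioo 0 t := fun h => hst h.2
        simp [hst, hm]
    · have hm : s ∉ Ioo 0 t := fun h => hs ⟨h.1, h.2.le.trans ht.2⟩
      simp [cutoff, hs, hm]
  have hut : IntervalIntegrable u volume 0 t :=
    hu.mono_set (by rw [uIcc_of_le ht.1, uIcc_of_le hT.le]; exact Icc_subset_Icc_right ht.2)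
  have assoc := convolution_assoc (f := cutoff T u) (g := cutoff T fun x => x ^ (-α))
    (k := cutoff T fun x => x ^ (α - 1)) (x₀ := t) (μ := volume) (ν := volume) L L L L
    (fun x y z => by simp [hL, mul_assoc])
    hU.aestronglyMeasurable hG1.aestronglyMeasurable hG2.aestronglyMeasurable
    (hU.ae_convolution_exists L hG1) (hG1.norm.ae_convolution_exists _ hG2.norm)
    (by
      rw [norm_cutoff_rpow, norm_cutoff_rpow, norm_cutoff, ConvolutionExistsAt, ← hL,
        hprod fun x => |u x|, integrable_indicator_iff measurableSet_Ioo]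
      exact ((intervalIntegrable_iff_integrableOn_Ioo_of_le ht.1).1 hut.abs).mul_const _)
  have hrhs : convolution (cutoff T u) (convolution (cutoff T fun x => x ^ (-α))
      (cutoff T fun x => x ^ (α - 1)) L) L volume t
      = Real.Gamma (1 - α) * Real.Gamma α * ∫ s in (0 : ℝ)..t, u s := by
    rw [convolution_def, hprod u, integral_indicator measurableSet_Ioo,
      intervalIntegral.integral_of_le ht.1, integral_Ioc_eq_integral_Ioo, integral_mul_const,
      mul_comm]
  rw [← hrhs, ← assoc, convolution_def, intervalIntegral.integral_of_le ht.1,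
    integral_Ioc_eq_integral_Ioo, ← integral_indicator measurableSet_Ioo]
  refine integral_congr_ae ?_
  have hne : ∀ᵐ s : ℝ, s ≠ T := by simp [ae_iff, measure_singleton]
  filter_upwards [hf] with s hs
  simp only [hL, ContinuousLinearMap.mul_apply']
  by_cases hm : s ∈ Ioo 0 t
  · rw [indicator_of_mem hm, hs ⟨hm.1, hm.2.trans_le ht.2⟩,
      convolution_cutoff hm.1.le (hm.2.le.trans ht.2)]
    have : t - s ∈ Ioc 0 T := ⟨sub_pos.2 hm.2, by linarith [hm.1, ht.2]⟩
    simp [cutoff, this]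
  · rw [indicator_of_notMem hm]
    by_cases hst : s < t
    · have hs0 : s ≤ 0 := by by_contra h; exact hm ⟨not_le.1 h, hst⟩
      rw [convolution_def]
      simp only [ContinuousLinearMap.mul_apply']
      rw [cutoff_mul_cutoff_sub (hs0.trans hT.le), Ioo_eq_empty (not_lt.2 hs0)]
      simp
    · have : t - s ∉ Ioc 0 T := fun h => hst (sub_pos.1 h.1)
      simp [cutoff, this]

/-- The Laplace representation of the Abel kernel under the integral sign. -/
theorem integral_laplace_kernel {β t : ℝ} (hβ : 0 < β) (ht : 0 ≤ t) {u : ℝ → ℝ}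
    (hu : IntervalIntegrable u volume 0 t)
    (hk : IntervalIntegrable (fun s => u s * (t - s) ^ (-β)) volume 0 t) :
    IntegrableOn (fun l => l ^ (β - 1) * ∫ s in (0 : ℝ)..t, Real.exp (-(l * (t - s))) * u s) (Ioi 0)
    ∧ ∫ l in Ioi 0, l ^ (β - 1) * ∫ s in (0 : ℝ)..t, Real.exp (-(l * (t - s))) * u s
      = Real.Gamma β * ∫ s in (0 : ℝ)..t, u s * (t - s) ^ (-β) := by
  rw [intervalIntegrable_iff_integrableOn_Ioo_of_le ht] at hu hk
  have hmeas : AEStronglyMeasurable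
      (fun p : ℝ × ℝ => p.1 ^ (β - 1) * (Real.exp (-(p.1 * (t - p.2))) * u p.2))
      ((volume.restrict (Ioi 0)).prod (volume.restrict (Ioo 0 t))) := by
    refine AEStronglyMeasurable.mul ?_ (AEStronglyMeasurable.mul ?_ ?_)
    · exact (Measurable.pow_const measurable_fst _).aestronglyMeasurable
    · exact (by fun_prop : Continuous fun p : ℝ × ℝ =>
        Real.exp (-(p.1 * (t - p.2)))).aestronglyMeasurable
    · exact hu.aestronglyMeasurable.comp_snd
  have hin : ∀ s ∈ Ioo 0 t, IntegrableOn
      (fun l => l ^ (β - 1) * Real.exp (-(l * (t - s)))) (Ioi 0) ∧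
      ∫ l in Ioi 0, l ^ (β - 1) * Real.exp (-(l * (t - s))) = (t - s) ^ (-β) * Real.Gamma β := by
    intro s hs
    have hts : 0 < t - s := sub_pos.2 hs.2
    have e := Real.integral_rpow_mul_exp_neg_mul_Ioi hβ hts
    have e' : (1 / (t - s)) ^ β = (t - s) ^ (-β) := by
      rw [one_div, Real.inv_rpow hts.le, Real.rpow_neg hts.le]
    simp only [mul_comm (t - s)] at e
    refine ⟨?_, by rw [e, e']⟩
    -- Integrability follows from the value of the integral: a divergent integral would be assigned
    -- the value `0`, while this one is positive.
    by_contra h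
    rw [integral_undef h] at e
    have : 0 < (1 / (t - s)) ^ β * Real.Gamma β :=
      mul_pos (Real.rpow_pos_of_pos (by positivity) _) (Real.Gamma_pos_of_pos hβ)
    linarith
  have hint : Integrable (fun p : ℝ × ℝ => p.1 ^ (β - 1) * (Real.exp (-(p.1 * (t - p.2))) * u p.2))
      ((volume.restrict (Ioi 0)).prod (volume.restrict (Ioo 0 t))) := by
    rw [integrable_prod_iff' hmeas]
    constructor
    · filter_upwards [ae_restrict_mem measurableSet_Ioo] with s hs
      have := (hin s hs).1.mul_const (u s)
      simpa only [mul_assoc] using this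
    · have h := (hk.norm).mul_const (Real.Gamma β)
      refine h.congr ?_
      filter_upwards [ae_restrict_mem measurableSet_Ioo] with s hs
      have : ∀ l ∈ Ioi (0 : ℝ), ‖l ^ (β - 1) * (Real.exp (-(l * (t - s))) * u s)‖
          = (l ^ (β - 1) * Real.exp (-(l * (t - s)))) * |u s| := by
        intro l hl
        rw [norm_mul, norm_mul, Real.norm_of_nonneg (Real.rpow_nonneg (le_of_lt hl) _),
          Real.norm_of_nonneg (Real.exp_pos _).le, Real.norm_eq_abs, mul_assoc]
      rw [setIntegral_congr_fun measurableSet_Ioi this, integral_mul_const, (hin s hs).2, norm_mul,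
        Real.norm_of_nonneg (Real.rpow_nonneg (sub_pos.2 hs.2).le _), Real.norm_eq_abs]
      ring
  have hinner : ∀ l, ∫ s in Ioo 0 t, l ^ (β - 1) * (Real.exp (-(l * (t - s))) * u s)
      = l ^ (β - 1) * ∫ s in (0 : ℝ)..t, Real.exp (-(l * (t - s))) * u s := by
    intro l
    rw [integral_const_mul, intervalIntegral.integral_of_le ht, integral_Ioc_eq_integral_Ioo]
  constructor
  · have := hint.integral_prod_left
    simp only [hinner] at this
    exact this
  · have := integral_integral_swap (f := fun l s => l ^ (β - 1) * (Real.exp (-(l * (t - s))) * u s)) hint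
    simp only [hinner] at this
    rw [this, intervalIntegral.integral_of_le ht, integral_Ioc_eq_integral_Ioo,
      ← integral_const_mul]
    refine setIntegral_congr_fun measurableSet_Ioo fun s hs => ?_
    simp only [← mul_assoc]
    rw [integral_mul_const, (hin s hs).2]
    ring

/-! ### Positivity of the Caputo derivative -/

theorem _root_.AbsolutelyContinuousOnInterval.restrict_right {f : ℝ → ℝ} {T t : ℝ}
    (hf : AbsolutelyContinuousOnInterval f 0 T) (ht : t ∈ Icc 0 T) :
    AbsolutelyContinuousOnInterval f 0 t :=
  hf.mono (by
    rw [uIcc_of_le ht.1, uIcc_of_le (ht.1.trans ht.2)]; exact Icc_subset_Icc_right ht.2)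

theorem exp_absolutelyContinuous (l a b : ℝ) :
    AbsolutelyContinuousOnInterval (fun s => Real.exp (l * s)) a b :=
  (ContDiff.contDiffOn (by fun_prop)).absolutelyContinuousOnInterval

theorem deriv_exp_mul (l s : ℝ) : deriv (fun s => Real.exp (l * s)) s = l * Real.exp (l * s) := by
  have h : HasDerivAt (fun s => Real.exp (l * s)) (Real.exp (l * s) * (l * 1)) s :=
    ((hasDerivAt_id s).const_mul l).exp
  rw [h.deriv]; ring

theorem integral_exp_neg_mul_sub (l t : ℝ) (u : ℝ → ℝ) :
    ∫ s in (0 : ℝ)..t, Real.exp (-(l * (t - s))) * u s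
      = Real.exp (-(l * t)) * ∫ s in (0 : ℝ)..t, Real.exp (l * s) * u s := by
  rw [← intervalIntegral.integral_const_mul]
  congr 1; funext s
  rw [← mul_assoc, ← Real.exp_add]
  ring_nf

/-- Duhamel's formula for `ψ' + l ψ = κ u`, `ψ(0) = 0`. -/
theorem duhamel {T l κ : ℝ} {ψ u : ℝ → ℝ} (hψ : AbsolutelyContinuousOnInterval ψ 0 T)
    (h0 : ψ 0 = 0) (hode : ∀ᵐ t, t ∈ Ioo 0 T → deriv ψ t + l * ψ t = κ * u t) {t : ℝ}
    (ht : t ∈ Icc 0 T) :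
    ψ t = κ * ∫ s in (0 : ℝ)..t, Real.exp (-(l * (t - s))) * u s := by
  have hψt := hψ.restrict_right ht
  have hE := exp_absolutelyContinuous l 0 t
  have key := hE.integral_deriv_mul_eq_sub hψt
  rw [h0, mul_zero, sub_zero] at key
  rw [integral_exp_neg_mul_sub, mul_left_comm, ← intervalIntegral.integral_const_mul]
  have hcongr : ∫ s in (0 : ℝ)..t, κ * (Real.exp (l * s) * u s) = Real.exp (l * t) * ψ t := by
    rw [← key]
    refine intervalIntegral.integral_congr_ae ?_
    have hne : ∀ᵐ s : ℝ, s ≠ T := by simp [ae_iff, measure_singleton]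
    filter_upwards [hode, hne] with s hs hsT hm
    rw [uIoc_of_le ht.1] at hm
    have := hs ⟨hm.1, lt_of_le_of_ne (hm.2.trans ht.2) hsT⟩
    rw [deriv_exp_mul, mul_left_comm, ← this]; ring
  rw [hcongr, ← mul_assoc, ← Real.exp_add, neg_add_cancel, Real.exp_zero, one_mul]

/-- Integrating the auxiliary variables over `(0, ∞)` gives the Caputo derivative. -/
theorem integral_auxiliary {α T : ℝ} (h0 : 0 < α) (h1 : α < 1) (hT : 0 < T) {u : ℝ → ℝ}
    (hu : IntervalIntegrable u volume 0 T) {ψ : ℝ → ℝ → ℝ}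
    (hψ : ∀ l > 0, AbsolutelyContinuousOnInterval (ψ l) 0 T) (hz : ∀ l > 0, ψ l 0 = 0)
    (hode : ∀ l > 0, ∀ᵐ t, t ∈ Ioo 0 T → deriv (ψ l) t + l * ψ l t
      = Real.sin (Real.pi * α) / Real.pi * l ^ (α - 1) * u t) :
    ∀ᵐ t, t ∈ Ioo 0 T → IntegrableOn (fun l => ψ l t) (Ioi 0) ∧
      ∫ l in Ioi 0, ψ l t = 1 / Real.Gamma (1 - α) * ∫ s in (0 : ℝ)..t, u s * (t - s) ^ (-α) := by
  have hg1 : IntervalIntegrable (fun x : ℝ => x ^ (-α)) volume 0 T :=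
    intervalIntegral.intervalIntegrable_rpow' (by linarith)
  filter_upwards [ae_intervalIntegrable_conv hT.le hu hg1] with t hk ht
  have hut : IntervalIntegrable u volume 0 t :=
    hu.mono_set (by rw [uIcc_of_le ht.1.le, uIcc_of_le hT.le]; exact Icc_subset_Icc_right ht.2.le)
  obtain ⟨ha, hb⟩ := integral_laplace_kernel h0 ht.1.le hut (hk ht)
  have heq : ∀ l ∈ Ioi (0 : ℝ), ψ l t = Real.sin (Real.pi * α) / Real.pi *
      (l ^ (α - 1) * ∫ s in (0 : ℝ)..t, Real.exp (-(l * (t - s))) * u s) := by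
    intro l hl
    rw [duhamel (hψ l hl) (hz l hl) (hode l hl) (Ioo_subset_Icc_self ht), mul_assoc]
  constructor
  · exact (IntegrableOn.congr_fun (ha.const_mul _) (fun l hl => (heq l hl).symm) measurableSet_Ioi)
  · rw [setIntegral_congr_fun measurableSet_Ioi heq, integral_const_mul, hb]
    have hG := Real.Gamma_mul_Gamma_one_sub α
    have hG1 : Real.Gamma (1 - α) ≠ 0 := (Real.Gamma_pos_of_pos (by linarith)).ne'
    have hs : Real.sin (Real.pi * α) ≠ 0 :=
      (Real.sin_pos_of_pos_of_lt_pi (by positivity) (by nlinarith [Real.pi_pos])).ne'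
    -- Euler's reflection formula is the reason for the factor `sin(πα)/π` in the auxiliary
    -- equations.
    have : Real.sin (Real.pi * α) / Real.pi * Real.Gamma α = 1 / Real.Gamma (1 - α) := by
      have hp := Real.pi_pos.ne'
      rw [eq_div_iff hG1, mul_assoc, hG]
      field_simp
    rw [← mul_assoc, this]

/-! ### Convolution with a decaying exponential -/

section Exponential

variable {f : ℝ → ℝ}

theorem hasDerivAt_exp_conv (hf : Continuous f) (l t : ℝ) :
    HasDerivAt (fun t => ∫ s in (0 : ℝ)..t, Real.exp (-(l * (t - s))) * f s)
      (f t - l * ∫ s in (0 : ℝ)..t, Real.exp (-(l * (t - s))) * f s) t := by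
  simp only [integral_exp_neg_mul_sub]
  have h1 : HasDerivAt (fun t => Real.exp (-(l * t))) (Real.exp (-(l * t)) * (-(l * 1))) t :=
    (((hasDerivAt_id t).const_mul l).neg).exp
  have hc : Continuous fun s => Real.exp (l * s) * f s := by fun_prop
  have h2 := hc.integral_hasStrictDerivAt 0 t
  have h := h1.mul h2.hasDerivAt
  convert! h using 1
  have : Real.exp (-(l * t)) * (Real.exp (l * t) * f t) = f t := by
    rw [← mul_assoc, ← Real.exp_add, neg_add_cancel, Real.exp_zero, one_mul]
  rw [this]; ring

/-- Joint continuity in the rate and the time supplies the measurability needed for Fubini's theorem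
in `abel_positive`. -/
theorem continuous_exp_conv (hf : Continuous f) :
    Continuous fun p : ℝ × ℝ => ∫ s in (0 : ℝ)..p.2, Real.exp (-(p.1 * (p.2 - s))) * f s := by
  refine intervalIntegral.continuous_parametric_intervalIntegral_of_continuous
    (f := fun (p : ℝ × ℝ) s => Real.exp (-(p.1 * (p.2 - s))) * f s) ?_ continuous_snd
  change Continuous fun q : (ℝ × ℝ) × ℝ => Real.exp (-(q.1.1 * (q.1.2 - q.2))) * f q.2
  fun_prop

theorem exp_conv_absolutelyContinuous (hf : Continuous f) (l a b : ℝ) :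
    AbsolutelyContinuousOnInterval
      (fun t => ∫ s in (0 : ℝ)..t, Real.exp (-(l * (t - s))) * f s) a b := by
  refine ContDiffOn.absolutelyContinuousOnInterval (ContDiff.contDiffOn ?_)
  rw [contDiff_one_iff_deriv]
  refine ⟨fun t => (hasDerivAt_exp_conv hf l t).differentiableAt, ?_⟩
  have : deriv (fun t => ∫ s in (0 : ℝ)..t, Real.exp (-(l * (t - s))) * f s)
      = fun t => f t - l * ∫ s in (0 : ℝ)..t, Real.exp (-(l * (t - s))) * f s :=
    funext fun t => (hasDerivAt_exp_conv hf l t).deriv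
  rw [this]
  have h := (continuous_exp_conv hf).comp (by fun_prop : Continuous fun t : ℝ => (l, t))
  exact hf.sub (continuous_const.mul h)

/-- With `e` the convolution, `e' = f - l e` and `e 0 = 0`. Integration by parts turns the
expression into `∫ f e' = ∫ e'² + l ∫ e e' = ∫ e'² + l e(t)²/2`. -/
theorem exp_conv_positive (hf : Continuous f) {l t : ℝ} (hl : 0 ≤ l) (ht : 0 ≤ t)
    (hac : AbsolutelyContinuousOnInterval f 0 t) :
    0 ≤ f t * (∫ s in (0 : ℝ)..t, Real.exp (-(l * (t - s))) * f s)
      - ∫ r in (0 : ℝ)..t, deriv f r * ∫ s in (0 : ℝ)..r, Real.exp (-(l * (r - s))) * f s := by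
  set e : ℝ → ℝ := fun t => ∫ s in (0 : ℝ)..t, Real.exp (-(l * (t - s))) * f s with he
  have hd : ∀ t, HasDerivAt e (f t - l * e t) t := hasDerivAt_exp_conv hf l
  have hea : AbsolutelyContinuousOnInterval e 0 t := exp_conv_absolutelyContinuous hf l 0 t
  have hec : Continuous e := continuous_iff_continuousAt.2 fun t => (hd t).continuousAt
  have he0 : e 0 = 0 := by simp [he]
  have h1 := hac.integral_mul_deriv_eq_deriv_mul hea
  have h2 := hea.integral_mul_deriv_eq_deriv_mul hea
  have hde : deriv e = fun t => f t - l * e t := funext fun t => (hd t).deriv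
  have hdc : Continuous (deriv e) := by rw [hde]; fun_prop
  rw [he0] at h1 h2
  change 0 ≤ f t * e t - ∫ r in (0 : ℝ)..t, deriv f r * e r
  have h3 : ∫ r in (0 : ℝ)..t, f r * deriv e r
      = (∫ r in (0 : ℝ)..t, deriv e r * deriv e r) + l * ∫ r in (0 : ℝ)..t, e r * deriv e r := by
    rw [← intervalIntegral.integral_const_mul, ← intervalIntegral.integral_add
      (Continuous.intervalIntegrable (by fun_prop) _ _)
      (Continuous.intervalIntegrable (by fun_prop) _ _)]
    congr 1; funext r
    rw [hde]; ring
  have h4 : ∫ r in (0 : ℝ)..t, deriv e r * e r = ∫ r in (0 : ℝ)..t, e r * deriv e r := by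
    congr 1; funext r; ring
  have h5 : 0 ≤ ∫ r in (0 : ℝ)..t, deriv e r * deriv e r :=
    intervalIntegral.integral_nonneg ht fun r _ => mul_self_nonneg _
  have h6 : 0 ≤ ∫ r in (0 : ℝ)..t, e r * deriv e r := by nlinarith [mul_self_nonneg (e t)]
  nlinarith [mul_nonneg hl h6]

end Exponential

/-- After reflection both sides integrate `exp(-l s)`, over `(0, r)` and `(0, t)`. This bounds
exponential convolutions uniformly in time; the factor `1` matches `integral_laplace_kernel` for the
constant function. -/
theorem integral_exp_neg_mono {l r t : ℝ} (h0 : 0 ≤ r) (hr : r ≤ t) :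
    ∫ s in (0 : ℝ)..r, Real.exp (-(l * (r - s)))
      ≤ ∫ s in (0 : ℝ)..t, Real.exp (-(l * (t - s))) * 1 := by
  simp only [mul_one]
  rw [intervalIntegral.integral_comp_sub_left (fun s => Real.exp (-(l * s))) r,
    intervalIntegral.integral_comp_sub_left (fun s => Real.exp (-(l * s))) t]
  simp only [sub_self, sub_zero]
  refine intervalIntegral.integral_mono_interval le_rfl h0 hr
    (Filter.Eventually.of_forall fun s => (Real.exp_pos _).le)
    (Continuous.intervalIntegrable (by fun_prop) _ _)

/-- `∫ f (g * f)' ≥ 0` for the Abel kernel `g`, in a form integrated by parts. -/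
theorem abel_positive {α t : ℝ} (h0 : 0 < α) (h1 : α < 1) (ht : 0 ≤ t) {f : ℝ → ℝ}
    (hf : Continuous f) (hac : AbsolutelyContinuousOnInterval f 0 t) :
    0 ≤ f t * (∫ s in (0 : ℝ)..t, f s * (t - s) ^ (α - 1))
      - ∫ r in (0 : ℝ)..t, deriv f r * ∫ s in (0 : ℝ)..r, f s * (r - s) ^ (α - 1) := by
  have hkernel : ∀ r : ℝ, 0 ≤ r → ∀ g : ℝ → ℝ, Continuous g →
      IntervalIntegrable (fun s => g s * (r - s) ^ (-(1 - α))) volume 0 r := by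
    intro r hr g hg
    refine IntervalIntegrable.continuousOn_mul ?_ hg.continuousOn
    have hp : IntervalIntegrable (fun s : ℝ => s ^ (-(1 - α))) volume 0 r :=
      intervalIntegral.intervalIntegrable_rpow' (by linarith)
    have := hp.comp_sub_left r
    simpa using this.symm
  have hlap := fun r (hr : 0 ≤ r) => integral_laplace_kernel (β := 1 - α) (by linarith) hr
    (hf.intervalIntegrable 0 r) (hkernel r hr f hf)
  -- For the constant function `1` the Laplace lemma provides an integrable function of `l`;
  -- multiplied by a bound of `f` and by `|f'|` it dominates the double integral.
  have hw := (integral_laplace_kernel (β := 1 - α) (by linarith) ht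
    (continuous_const.intervalIntegrable (μ := volume) (0 : ℝ) t) (hkernel t ht _ continuous_const) :
      IntegrableOn (fun l => l ^ (1 - α - 1) *
        ∫ s in (0 : ℝ)..t, Real.exp (-(l * (t - s))) * 1) (Ioi 0) ∧ _).1
  obtain ⟨B, hB⟩ := (isCompact_Icc (a := (0 : ℝ)) (b := t)).exists_bound_of_continuousOn
    hf.continuousOn
  set e : ℝ → ℝ → ℝ := fun l r => ∫ s in (0 : ℝ)..r, Real.exp (-(l * (r - s))) * f s with he
  have hB0 : 0 ≤ B := (norm_nonneg _).trans (hB 0 ⟨le_rfl, ht⟩)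
  have hebound : ∀ l, ∀ r ∈ Ioo 0 t,
      |e l r| ≤ B * ∫ s in (0 : ℝ)..t, Real.exp (-(l * (t - s))) * 1 := by
    intro l r hr
    have h := intervalIntegral.norm_integral_le_of_norm_le (a := 0) (b := r) (μ := volume) hr.1.le
      (f := fun s => Real.exp (-(l * (r - s))) * f s)
      (g := fun s => B * Real.exp (-(l * (r - s))))
      (Filter.Eventually.of_forall fun s hs => by
        rw [norm_mul, Real.norm_of_nonneg (Real.exp_pos _).le, mul_comm]
        exact mul_le_mul_of_nonneg_right (hB s ⟨hs.1.le, hs.2.trans hr.2.le⟩) (Real.exp_pos _).le)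
      (Continuous.intervalIntegrable (by fun_prop) _ _)
    rw [intervalIntegral.integral_const_mul] at h
    exact h.trans (mul_le_mul_of_nonneg_left (integral_exp_neg_mono hr.1.le hr.2.le) hB0)
  have hdf : IntegrableOn (deriv f) (Ioo 0 t) :=
    (intervalIntegrable_iff_integrableOn_Ioo_of_le ht).1 hac.intervalIntegrable_deriv
  have hint : Integrable (fun p : ℝ × ℝ => p.1 ^ (1 - α - 1) * (deriv f p.2 * e p.1 p.2))
      ((volume.restrict (Ioi 0)).prod (volume.restrict (Ioo 0 t))) := by
    have hprod := (hw.mul_prod hdf.norm).const_mul B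
    refine hprod.mono' ?_ ?_
    · refine AEStronglyMeasurable.mul (Measurable.pow_const measurable_fst _).aestronglyMeasurable
        (AEStronglyMeasurable.mul hdf.aestronglyMeasurable.comp_snd
          (continuous_exp_conv hf).aestronglyMeasurable)
    · rw [Measure.prod_restrict]
      filter_upwards [ae_restrict_mem (measurableSet_Ioi.prod measurableSet_Ioo)] with p hp
      have hp1 : (0 : ℝ) ≤ p.1 ^ (1 - α - 1) := Real.rpow_nonneg (le_of_lt hp.1) _
      rw [norm_mul, norm_mul, Real.norm_of_nonneg hp1, Real.norm_eq_abs (e p.1 p.2)]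
      calc p.1 ^ (1 - α - 1) * (‖deriv f p.2‖ * |e p.1 p.2|)
          ≤ p.1 ^ (1 - α - 1) * (‖deriv f p.2‖ *
            (B * ∫ s in (0 : ℝ)..t, Real.exp (-(p.1 * (t - s))) * 1)) :=
          mul_le_mul_of_nonneg_left (mul_le_mul_of_nonneg_left (hebound _ _ hp.2)
            (norm_nonneg _)) hp1
        _ = _ := by ring
  have hswap := integral_integral_swap
    (f := fun l r => l ^ (1 - α - 1) * (deriv f r * e l r)) hint
  have hint1 := hint.integral_prod_left
  have hleft : ∀ l, ∫ r in Ioo 0 t, l ^ (1 - α - 1) * (deriv f r * e l r)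
      = l ^ (1 - α - 1) * ∫ r in (0 : ℝ)..t, deriv f r * e l r := by
    intro l
    rw [integral_const_mul, intervalIntegral.integral_of_le ht, integral_Ioc_eq_integral_Ioo]
  have hG : 0 < Real.Gamma (1 - α) := Real.Gamma_pos_of_pos (by linarith)
  have hright : ∫ r in Ioo 0 t, ∫ l in Ioi 0, l ^ (1 - α - 1) * (deriv f r * e l r)
      = Real.Gamma (1 - α) *
        ∫ r in (0 : ℝ)..t, deriv f r * ∫ s in (0 : ℝ)..r, f s * (r - s) ^ (α - 1) := by
    rw [intervalIntegral.integral_of_le ht, integral_Ioc_eq_integral_Ioo, ← integral_const_mul]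
    refine setIntegral_congr_fun measurableSet_Ioo fun r hr => ?_
    have h := (hlap r hr.1.le).2
    simp only [neg_sub] at h
    simp only [mul_left_comm _ (deriv f r)]
    rw [integral_const_mul, h]
  simp only [hleft] at hswap hint1
  rw [hright] at hswap
  have htop := (hlap t ht)
  simp only [neg_sub] at htop
  -- The kernel `s^(α-1)` is a superposition of `exp(-l s)` with the positive weight
  -- `l^(-α)/Γ(1-α)`, so positivity is inherited from each rate `l`.
  have hpos : 0 ≤ ∫ l in Ioi 0, (f t * (l ^ (1 - α - 1) * e l t)
      - l ^ (1 - α - 1) * ∫ r in (0 : ℝ)..t, deriv f r * e l r) := by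
    refine setIntegral_nonneg measurableSet_Ioi fun l hl => ?_
    have h := exp_conv_positive hf (le_of_lt hl) ht hac
    have := mul_nonneg (Real.rpow_nonneg (le_of_lt hl) (1 - α - 1)) h
    calc (0 : ℝ) ≤ _ := this
      _ = _ := by simp only [he]; ring
  rw [integral_sub (htop.1.const_mul _) hint1, integral_const_mul, htop.2, hswap] at hpos
  have : 0 ≤ Real.Gamma (1 - α) * (f t * (∫ s in (0 : ℝ)..t, f s * (t - s) ^ (α - 1))
      - ∫ r in (0 : ℝ)..t, deriv f r * ∫ s in (0 : ℝ)..r, f s * (r - s) ^ (α - 1)) := by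
    linarith
  exact nonneg_of_mul_nonneg_right this hG

/-- The Caputo derivative is a positive operator. -/
theorem caputo_positive {α T : ℝ} (h0 : 0 < α) (h1 : α < 1) (hT : 0 < T) {y f : ℝ → ℝ}
    (hy : AbsolutelyContinuousOnInterval y 0 T) (hy0 : y 0 = 0)
    (hf : AbsolutelyContinuousOnInterval f 0 T)
    (hcap : ∀ᵐ t, t ∈ Ioo 0 T →
      f t = 1 / Real.Gamma (1 - α) * ∫ s in (0 : ℝ)..t, deriv y s * (t - s) ^ (-α))
    {t : ℝ} (ht : t ∈ Icc 0 T) :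
    0 ≤ ∫ s in (0 : ℝ)..t, f s * deriv y s := by
  have hG : 0 < Real.Gamma (1 - α) := Real.Gamma_pos_of_pos (by linarith)
  have hG' : 0 < Real.Gamma α := Real.Gamma_pos_of_pos h0
  have hfc : ContinuousOn f (Icc 0 T) := by simpa [uIcc_of_le hT.le] using hf.continuousOn
  -- Positivity was shown for functions continuous on the whole line, so `f` is extended by its end
  -- values.
  set F : ℝ → ℝ := IccExtend hT.le ((Icc 0 T).domRestrict f) with hF
  have hFc : Continuous F := (continuousOn_iff_continuous_domRestrict.1 hfc).Icc_extend'
  have hFf : ∀ s ∈ Icc 0 T, F s = f s := fun s hs => by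
    rw [hF, IccExtend_of_mem _ _ hs]; rfl
  have hsub : Icc 0 t ⊆ Icc 0 T := Icc_subset_Icc_right ht.2
  have hFac : AbsolutelyContinuousOnInterval F 0 T := by
    rw [absolutelyContinuousOnInterval_iff] at hf ⊢
    intro ε hε
    obtain ⟨δ, hδ, h⟩ := hf ε hε
    refine ⟨δ, hδ, fun E hE hlen => ?_⟩
    have := h E hE hlen
    convert! this using 2 with i hi
    have hm := hE.1 i hi
    rw [uIcc_of_le hT.le] at hm
    rw [hFf _ hm.1, hFf _ hm.2]
  -- Abel inversion recovers `y` as a fractional integral of `f`. It moves the derivative from `y`,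
  -- whose derivative is merely integrable, onto the absolutely continuous `f`.
  have hyval : ∀ r ∈ Icc 0 T, ∫ s in (0 : ℝ)..r, F s * (r - s) ^ (α - 1)
      = Real.Gamma α * y r := by
    intro r hr
    have h := abel_inversion (f := fun s => Real.Gamma (1 - α) * f s) h0 h1 hT hr
      hy.intervalIntegrable_deriv
      (by
        filter_upwards [hcap] with s hs hm
        rw [hs hm, ← mul_assoc, mul_one_div_cancel hG.ne', one_mul])
    rw [(hy.restrict_right hr).integral_deriv_eq_sub, hy0, sub_zero] at h
    simp only [mul_assoc] at h
    rw [intervalIntegral.integral_const_mul] at h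
    rw [← mul_left_cancel₀ hG.ne' h]
    refine intervalIntegral.integral_congr fun s hs => ?_
    rw [uIcc_of_le hr.1] at hs
    simp only [hFf s ⟨hs.1, hs.2.trans hr.2⟩]
  have h := abel_positive h0 h1 ht.1 hFc (hFac.restrict_right ht)
  have hyt := hy.restrict_right ht
  rw [hyval t ht] at h
  have hcongr : ∫ r in (0 : ℝ)..t, deriv F r * ∫ s in (0 : ℝ)..r, F s * (r - s) ^ (α - 1)
      = Real.Gamma α * ∫ r in (0 : ℝ)..t, deriv F r * y r := by
    rw [← intervalIntegral.integral_const_mul]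
    refine intervalIntegral.integral_congr fun s hs => ?_
    rw [uIcc_of_le ht.1] at hs
    simp only [hyval s (hsub hs)]
    ring
  rw [hcongr] at h
  have hparts := (hFac.restrict_right ht).integral_mul_deriv_eq_deriv_mul hyt
  rw [hy0, mul_zero, sub_zero] at hparts
  have hfin : ∫ s in (0 : ℝ)..t, f s * deriv y s = ∫ s in (0 : ℝ)..t, F s * deriv y s := by
    refine intervalIntegral.integral_congr fun s hs => ?_
    rw [uIcc_of_le ht.1] at hs
    simp only [hFf s (hsub hs)]
  rw [hfin, hparts]
  have : 0 ≤ Real.Gamma α * (F t * y t - ∫ r in (0 : ℝ)..t, deriv F r * y r) := by linarith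
  exact nonneg_of_mul_nonneg_right this hG'

/-! ### The energy estimate in coordinates -/

theorem sum_mul_le_of_sum_sq_le {n : ℕ} {u v : Fin n → ℝ} {A B : ℝ} (hA : 0 ≤ A) (hB : 0 ≤ B)
    (hu : ∑ i, u i ^ 2 ≤ A ^ 2) (hv : ∑ i, v i ^ 2 ≤ B ^ 2) : ∑ i, u i * v i ≤ A * B := by
  refine (Real.sum_mul_le_sqrt_mul_sqrt _ u v).trans ?_
  exact mul_le_mul (Real.sqrt_le_iff.2 ⟨hA, hu⟩) (Real.sqrt_le_iff.2 ⟨hB, hv⟩)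
    (Real.sqrt_nonneg _) hA

theorem _root_.AbsolutelyContinuousOnInterval.integral_mul_deriv_self {f : ℝ → ℝ} {a b : ℝ}
    (hf : AbsolutelyContinuousOnInterval f a b) :
    ∫ s in a..b, f s * deriv f s = (f b ^ 2 - f a ^ 2) / 2 := by
  have h := hf.integral_mul_deriv_eq_deriv_mul hf
  have h4 : ∫ r in a..b, deriv f r * f r = ∫ r in a..b, f r * deriv f r := by
    congr 1; funext r; ring
  rw [h4] at h
  linarith

theorem _root_.AbsolutelyContinuousOnInterval.intervalIntegrable_mul_deriv {f g : ℝ → ℝ} {a b : ℝ}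
    (hf : AbsolutelyContinuousOnInterval f a b) (hg : AbsolutelyContinuousOnInterval g a b) :
    IntervalIntegrable (fun s => f s * deriv g s) volume a b :=
  hg.intervalIntegrable_deriv.continuousOn_mul hf.continuousOn

/-- The coupling `∫ y p'` is bounded below by the polarization equation tested with `p'`. The Caputo
term is nonnegative and dropped, and `∫ d p'` is integrated by parts because only `p`, `d` and `d'`
are bounded. In the constant, `2T` comes from the right side of the energy inequality, `T` from `∫
d' p` and `1` from `d(t) p(t)`. -/
theorem energy_at_time {α T μ ε κ θ : ℝ} (h0 : 0 < α) (h1 : α < 1) (hT : 0 < T) (hθ : 0 < θ)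
    {n : ℕ} {x y p d : Fin n → ℝ → ℝ} {δ m : ℝ} (hδ : 0 ≤ δ) (hm : 0 ≤ m)
    (hx : ∀ i, AbsolutelyContinuousOnInterval (x i) 0 T)
    (hy : ∀ i, AbsolutelyContinuousOnInterval (y i) 0 T)
    (hp : ∀ i, AbsolutelyContinuousOnInterval (p i) 0 T)
    (hd : ∀ i, AbsolutelyContinuousOnInterval (d i) 0 T)
    (hx0 : ∀ i, x i 0 = 0) (hy0 : ∀ i, y i 0 = 0) (hp0 : ∀ i, p i 0 = 0)
    (henergy : ∀ᵐ t, t ∈ Ioo 0 T →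
      ∑ i, (μ * (x i t * deriv (x i) t) + ε * (y i t * deriv (y i) t) + y i t * deriv (p i) t)
        ≤ δ * (√(∑ i, x i t ^ 2) + √(∑ i, y i t ^ 2)))
    (hcap : ∀ᵐ t, t ∈ Ioo 0 T → ∀ i,
      θ * (1 / Real.Gamma (1 - α) * ∫ s in (0 : ℝ)..t, deriv (p i) s * (t - s) ^ (-α)) + κ * p i t
        = y i t + d i t)
    (hdb : ∀ t ∈ Icc 0 T, ∑ i, d i t ^ 2 ≤ δ ^ 2)
    (hdb' : ∀ᵐ t, t ∈ Ioo 0 T → ∑ i, deriv (d i) t ^ 2 ≤ δ ^ 2)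
    (hN : ∀ t ∈ Icc 0 T, ∑ i, (x i t ^ 2 + y i t ^ 2 + p i t ^ 2) ≤ m ^ 2)
    {t : ℝ} (ht : t ∈ Icc 0 T) :
    ∑ i, (μ / 2 * x i t ^ 2 + ε / 2 * y i t ^ 2 + κ / 2 * p i t ^ 2) ≤ (3 * T + 1) * (m * δ) := by
  have hne : ∀ᵐ s : ℝ, s ≠ T := by simp [ae_iff, measure_singleton]
  have hxt := fun i => (hx i).restrict_right ht
  have hyt := fun i => (hy i).restrict_right ht
  have hpt := fun i => (hp i).restrict_right ht
  have hdt := fun i => (hd i).restrict_right ht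
  have hmem : ∀ s ∈ Ioc 0 t, s ≠ T → s ∈ Ioo 0 T := fun s hs hsT =>
    ⟨hs.1, lt_of_le_of_ne (hs.2.trans ht.2) hsT⟩
  have hNx : ∀ s ∈ Icc 0 T, ∑ i, x i s ^ 2 ≤ m ^ 2 := fun s hs =>
    (Finset.sum_le_sum fun i _ => by nlinarith [sq_nonneg (y i s), sq_nonneg (p i s)]).trans
      (hN s hs)
  have hNy : ∀ s ∈ Icc 0 T, ∑ i, y i s ^ 2 ≤ m ^ 2 := fun s hs =>
    (Finset.sum_le_sum fun i _ => by nlinarith [sq_nonneg (x i s), sq_nonneg (p i s)]).trans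
      (hN s hs)
  have hNp : ∀ s ∈ Icc 0 T, ∑ i, p i s ^ 2 ≤ m ^ 2 := fun s hs =>
    (Finset.sum_le_sum fun i _ => by nlinarith [sq_nonneg (x i s), sq_nonneg (y i s)]).trans
      (hN s hs)
  -- the integrated energy inequality
  have hE : ∑ i, (μ / 2 * x i t ^ 2 + ε / 2 * y i t ^ 2
      + ∫ s in (0 : ℝ)..t, y i s * deriv (p i) s) ≤ δ * (2 * m) * T := by
    have hii : ∀ i, IntervalIntegrable (fun s => μ * (x i s * deriv (x i) s)
        + ε * (y i s * deriv (y i) s) + y i s * deriv (p i) s) volume 0 t := fun i =>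
      ((((hxt i).intervalIntegrable_mul_deriv (hxt i)).const_mul μ).add
        (((hyt i).intervalIntegrable_mul_deriv (hyt i)).const_mul ε)).add
        ((hyt i).intervalIntegrable_mul_deriv (hpt i))
    have hval : ∀ i, ∫ s in (0 : ℝ)..t, (μ * (x i s * deriv (x i) s)
        + ε * (y i s * deriv (y i) s) + y i s * deriv (p i) s)
        = μ / 2 * x i t ^ 2 + ε / 2 * y i t ^ 2 + ∫ s in (0 : ℝ)..t, y i s * deriv (p i) s := by
      intro i
      rw [intervalIntegral.integral_add _ ((hyt i).intervalIntegrable_mul_deriv (hpt i)),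
        intervalIntegral.integral_add, intervalIntegral.integral_const_mul,
        intervalIntegral.integral_const_mul, (hxt i).integral_mul_deriv_self,
        (hyt i).integral_mul_deriv_self, hx0, hy0]
      · ring
      · exact ((hxt i).intervalIntegrable_mul_deriv (hxt i)).const_mul μ
      · exact ((hyt i).intervalIntegrable_mul_deriv (hyt i)).const_mul ε
      · exact (((hxt i).intervalIntegrable_mul_deriv (hxt i)).const_mul μ).add
          (((hyt i).intervalIntegrable_mul_deriv (hyt i)).const_mul ε)
    simp only [← hval]
    rw [← intervalIntegral.integral_finsetSum fun i _ => hii i]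
    calc _ ≤ ∫ s in (0 : ℝ)..t, δ * (2 * m) := by
          refine intervalIntegral.integral_mono_ae_restrict ht.1
            (by simpa only [Finset.sum_fn] using IntervalIntegrable.sum Finset.univ fun i _ => hii i) intervalIntegrable_const ?_
          rw [Filter.EventuallyLE, ae_restrict_iff' measurableSet_Icc]
          have hne0 : ∀ᵐ s : ℝ, s ≠ 0 := by simp [ae_iff, measure_singleton]
          filter_upwards [henergy, hne, hne0] with s hs hsT hs0 hsm
          have hsI : s ∈ Icc 0 T := ⟨hsm.1, hsm.2.trans ht.2⟩
          refine (hs (hmem s ⟨lt_of_le_of_ne hsm.1 (Ne.symm hs0), hsm.2⟩ hsT)).trans ?_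
          refine mul_le_mul_of_nonneg_left ?_ hδ
          have a1 : √(∑ i, x i s ^ 2) ≤ m := Real.sqrt_le_iff.2 ⟨hm, hNx s hsI⟩
          have a2 : √(∑ i, y i s ^ 2) ≤ m := Real.sqrt_le_iff.2 ⟨hm, hNy s hsI⟩
          linarith
      _ ≤ δ * (2 * m) * T := by
          rw [intervalIntegral.integral_const, smul_eq_mul, sub_zero, mul_comm]
          exact mul_le_mul_of_nonneg_left ht.2 (by positivity)
  -- the polarization equation
  have hP : ∀ i, κ / 2 * p i t ^ 2 - d i t * p i t + ∫ s in (0 : ℝ)..t, deriv (d i) s * p i s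
      ≤ ∫ s in (0 : ℝ)..t, y i s * deriv (p i) s := by
    intro i
    -- The polarization equation itself exhibits the Caputo derivative of `p i` as an absolutely
    -- continuous function up to a null set, as `caputo_positive` requires.
    have hfac : AbsolutelyContinuousOnInterval
        (fun s => (1 / θ) * (y i s + d i s - κ * p i s)) 0 T :=
      (((hy i).fun_add (hd i)).fun_sub ((hp i).const_mul κ)).const_mul (1 / θ)
    have hpos := caputo_positive h0 h1 hT (hp i) (hp0 i) hfac (by
      filter_upwards [hcap] with s hs hsm
      rw [← hs hsm i]
      field_simp
      ring) ht
    have h1 := (hpt i).integral_mul_deriv_self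
    have h2 := (hdt i).integral_mul_deriv_eq_deriv_mul (hpt i)
    rw [hp0, mul_zero, sub_zero] at h2
    rw [hp0] at h1
    have hsplit : ∫ s in (0 : ℝ)..t, (1 / θ) * (y i s + d i s - κ * p i s) * deriv (p i) s
        = (1 / θ) * ((∫ s in (0 : ℝ)..t, y i s * deriv (p i) s)
          + (∫ s in (0 : ℝ)..t, d i s * deriv (p i) s)
          - κ * ∫ s in (0 : ℝ)..t, p i s * deriv (p i) s) := by
      rw [← intervalIntegral.integral_const_mul κ, ← intervalIntegral.integral_add
        ((hyt i).intervalIntegrable_mul_deriv (hpt i)) ((hdt i).intervalIntegrable_mul_deriv (hpt i)),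
        ← intervalIntegral.integral_sub (((hyt i).intervalIntegrable_mul_deriv (hpt i)).add
          ((hdt i).intervalIntegrable_mul_deriv (hpt i)))
          (((hpt i).intervalIntegrable_mul_deriv (hpt i)).const_mul κ),
        ← intervalIntegral.integral_const_mul]
      congr 1; funext s; ring
    rw [hsplit] at hpos
    have := nonneg_of_mul_nonneg_right hpos (by positivity : (0 : ℝ) < 1 / θ)
    rw [h2, h1] at this
    nlinarith
  have hsumP := Finset.sum_le_sum fun i (_ : i ∈ Finset.univ) => hP i
  rw [Finset.sum_add_distrib, Finset.sum_sub_distrib] at hsumP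
  have hdp : ∑ i, d i t * p i t ≤ δ * m :=
    sum_mul_le_of_sum_sq_le hδ hm (hdb t ht) (hNp t ht)
  have hdp' : -(δ * m * T) ≤ ∑ i, ∫ s in (0 : ℝ)..t, deriv (d i) s * p i s := by
    have hii : ∀ i, IntervalIntegrable (fun s => deriv (d i) s * p i s) volume 0 t := fun i =>
      (hdt i).intervalIntegrable_deriv.mul_continuousOn (hpt i).continuousOn
    rw [← intervalIntegral.integral_finsetSum fun i _ => hii i]
    have hlow : ∫ s in (0 : ℝ)..t, (-(δ * m)) ≤ ∫ s in (0 : ℝ)..t, ∑ i, deriv (d i) s * p i s := by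
      refine intervalIntegral.integral_mono_ae_restrict ht.1
        intervalIntegrable_const (by simpa only [Finset.sum_fn] using IntervalIntegrable.sum Finset.univ fun i _ => hii i) ?_
      rw [Filter.EventuallyLE, ae_restrict_iff' measurableSet_Icc]
      have hne0 : ∀ᵐ s : ℝ, s ≠ 0 := by simp [ae_iff, measure_singleton]
      filter_upwards [hdb', hne, hne0] with s hs hsT hs0 hsm
      have hsI : s ∈ Icc 0 T := ⟨hsm.1, hsm.2.trans ht.2⟩
      have h := hs (hmem s ⟨lt_of_le_of_ne hsm.1 (Ne.symm hs0), hsm.2⟩ hsT)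
      have := sum_mul_le_of_sum_sq_le (u := fun i => -deriv (d i) s) (v := fun i => p i s) hδ hm
        (by simpa using h) (hNp s hsI)
      simp only [neg_mul, Finset.sum_neg_distrib] at this
      linarith
    refine le_trans ?_ hlow
    rw [intervalIntegral.integral_const, smul_eq_mul, sub_zero]
    have : δ * m * t ≤ δ * m * T := mul_le_mul_of_nonneg_left ht.2 (by positivity)
    linarith
  rw [Finset.sum_add_distrib] at hE ⊢
  nlinarith

/-- Let `N` be the maximum over `[0, T]` of the sum of squares, attained at `t₀`. Using `m = √N` in
`energy_at_time` at `t₀` gives `c N ≤ (3T + 1) √N δ`, and dividing by `√N` finishes. `K` is chosen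
before `n`, so it does not depend on the mesh. -/
theorem energy_estimate {α T μ ε κ θ : ℝ} (h0 : 0 < α) (h1 : α < 1) (hT : 0 < T) (hμ : 0 < μ)
    (hε : 0 < ε) (hκ : 0 < κ) (hθ : 0 < θ) :
    ∃ K : ℝ, 0 < K ∧ ∀ (n : ℕ) (x y p d : Fin n → ℝ → ℝ) (δ : ℝ), 0 ≤ δ →
    (∀ i, AbsolutelyContinuousOnInterval (x i) 0 T) →
    (∀ i, AbsolutelyContinuousOnInterval (y i) 0 T) →
    (∀ i, AbsolutelyContinuousOnInterval (p i) 0 T) →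
    (∀ i, AbsolutelyContinuousOnInterval (d i) 0 T) →
    (∀ i, x i 0 = 0) → (∀ i, y i 0 = 0) → (∀ i, p i 0 = 0) →
    (∀ᵐ t, t ∈ Ioo 0 T →
      ∑ i, (μ * (x i t * deriv (x i) t) + ε * (y i t * deriv (y i) t) + y i t * deriv (p i) t)
        ≤ δ * (√(∑ i, x i t ^ 2) + √(∑ i, y i t ^ 2))) →
    (∀ᵐ t, t ∈ Ioo 0 T → ∀ i,
      θ * (1 / Real.Gamma (1 - α) * ∫ s in (0 : ℝ)..t, deriv (p i) s * (t - s) ^ (-α)) + κ * p i t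
        = y i t + d i t) →
    (∀ t ∈ Icc 0 T, ∑ i, d i t ^ 2 ≤ δ ^ 2) →
    (∀ᵐ t, t ∈ Ioo 0 T → ∑ i, deriv (d i) t ^ 2 ≤ δ ^ 2) →
    ∀ t ∈ Icc 0 T, ∑ i, (x i t ^ 2 + y i t ^ 2 + p i t ^ 2) ≤ K * δ ^ 2 := by
  set c := min μ (min ε κ) / 2 with hc
  have hcpos : 0 < c := by positivity
  refine ⟨((3 * T + 1) / c) ^ 2, by positivity, ?_⟩
  intro n x y p d δ hδ hx hy hp hd hx0 hy0 hp0 henergy hcap hdb hdb' t ht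
  have hcont : ContinuousOn (fun t => ∑ i, (x i t ^ 2 + y i t ^ 2 + p i t ^ 2)) (Icc 0 T) := by
    refine continuousOn_finsetSum _ fun i _ => ?_
    have e := uIcc_of_le hT.le
    have a1 := (hx i).continuousOn
    have a2 := (hy i).continuousOn
    have a3 := (hp i).continuousOn
    rw [e] at a1 a2 a3
    exact ((a1.pow 2).add (a2.pow 2)).add (a3.pow 2)
  obtain ⟨t₀, ht₀, hmax⟩ := isCompact_Icc.exists_isMaxOn ⟨0, le_rfl, hT.le⟩ hcont
  set N := ∑ i, (x i t₀ ^ 2 + y i t₀ ^ 2 + p i t₀ ^ 2) with hN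
  have hN0 : 0 ≤ N := Finset.sum_nonneg fun i _ => by positivity
  have hmN : √N ^ 2 = N := Real.sq_sqrt hN0
  have h := energy_at_time h0 h1 hT hθ hδ (Real.sqrt_nonneg N) hx hy hp hd hx0 hy0 hp0 henergy hcap
    hdb hdb' (fun s hs => (hmax hs).trans hmN.ge) ht₀
  have hlow : c * N ≤ ∑ i, (μ / 2 * x i t₀ ^ 2 + ε / 2 * y i t₀ ^ 2 + κ / 2 * p i t₀ ^ 2) := by
    rw [hN, Finset.mul_sum]
    refine Finset.sum_le_sum fun i _ => ?_
    have c1 : c ≤ μ / 2 := by rw [hc]; linarith [min_le_left μ (min ε κ)]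
    have c2 : c ≤ ε / 2 := by
      rw [hc]; linarith [(min_le_right μ (min ε κ)).trans (min_le_left ε κ)]
    have c3 : c ≤ κ / 2 := by
      rw [hc]; linarith [(min_le_right μ (min ε κ)).trans (min_le_right ε κ)]
    nlinarith [mul_le_mul_of_nonneg_right c1 (sq_nonneg (x i t₀)),
      mul_le_mul_of_nonneg_right c2 (sq_nonneg (y i t₀)),
      mul_le_mul_of_nonneg_right c3 (sq_nonneg (p i t₀))]
  have hm : √N ≤ (3 * T + 1) / c * δ := by
    rcases (Real.sqrt_nonneg N).eq_or_lt with h00 | h00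
    · rw [← h00]; positivity
    · have h2 : c * √N * √N ≤ (3 * T + 1) * δ * √N := by nlinarith
      have h3 := le_of_mul_le_mul_right h2 h00
      rw [div_mul_eq_mul_div, le_div_iff₀ hcpos]
      linarith
  calc _ ≤ N := hmax ht
    _ = √N ^ 2 := hmN.symm
    _ ≤ ((3 * T + 1) / c * δ) ^ 2 := by gcongr
    _ = _ := by ring

/-! ### Gauss-Radau interpolation on one cell -/

section Radau

variable {p q z : ℝ} {k : ℕ}

theorem eq_zero_of_eval_zero_on (hpq : p < q) {w : ℝ[X]} (h : ∀ x ∈ Ioo p q, w.eval x = 0) :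
    w = 0 :=
  Polynomial.eq_zero_of_infinite_isRoot _ ((Ioo_infinite hpq).mono fun x hx => h x hx)

theorem exists_eval_ne_zero (hpq : p < q) {w : ℝ[X]} (hw : w ≠ 0) :
    ∃ x ∈ Ioo p q, w.eval x ≠ 0 := by
  by_contra! h
  exact hw (eq_zero_of_eval_zero_on hpq h)

/-- Testing on `[p, q]` against the polynomial `v`. -/
def polyPairing (p q : ℝ) (v : ℝ[X]) : ℝ[X] →ₗ[ℝ] ℝ where
  toFun w := ∫ x in p..q, w.eval x * v.eval x
  map_add' w w' := by
    simp only [Polynomial.eval_add, add_mul]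
    exact intervalIntegral.integral_add (Continuous.intervalIntegrable (by fun_prop) _ _)
      (Continuous.intervalIntegrable (by fun_prop) _ _)
  map_smul' c w := by
    simp only [Polynomial.eval_smul, smul_eq_mul, mul_assoc, RingHom.id_apply]
    exact intervalIntegral.integral_const_mul _ _

theorem integral_mul_eq_zero_of_monomials {g : ℝ → ℝ} (hg : ContinuousOn g (uIcc p q)) {v : ℝ[X]}
    (h : ∀ i : Fin k, ∫ x in p..q, g x * (Polynomial.X ^ (i : ℕ) : ℝ[X]).eval x = 0)
    (hv : v ∈ Polynomial.degreeLT ℝ k) : ∫ x in p..q, g x * v.eval x = 0 := by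
  rw [Polynomial.degreeLT_eq_span_X_pow] at hv
  induction hv using Submodule.span_induction with
  | mem x hx =>
    simp only [Finset.coe_image, mem_image, Finset.coe_range, mem_Iio] at hx
    obtain ⟨i, hi, rfl⟩ := hx
    exact h ⟨i, hi⟩
  | zero => simp
  | add x y _ _ hx hy =>
    have hi : ∀ w : ℝ[X], IntervalIntegrable (fun x => g x * w.eval x) volume p q := fun w =>
      (hg.mul w.continuous.continuousOn).intervalIntegrable
    simp only [Polynomial.eval_add, mul_add]
    rw [intervalIntegral.integral_add (hi x) (hi y), hx, hy, add_zero]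
  | smul c x _ hx =>
    simp only [Polynomial.eval_smul, smul_eq_mul, mul_left_comm _ c]
    rw [intervalIntegral.integral_const_mul, hx, mul_zero]

/-- A polynomial of degree at most `k` that vanishes at an end point and is orthogonal to the
polynomials of degree less than `k` is zero. -/
theorem radau_unique (hpq : p < q) (hz : z = p ∨ z = q) {w : ℝ[X]}
    (hw : w ∈ Polynomial.degreeLE ℝ (k : WithBot ℕ))
    (hm : ∀ v ∈ Polynomial.degreeLT ℝ k, ∫ x in p..q, w.eval x * v.eval x = 0)
    (hwz : w.eval z = 0) : w = 0 := by
  -- Write `w = (X - z) Q` with `Q` of degree less than `k` and test with `Q`: since `z` is an end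
  -- point, `(x - z) Q²` has one sign, so its integral vanishes only if `Q = 0`.
  obtain ⟨Q, hQ⟩ := Polynomial.dvd_iff_isRoot.2 hwz
  by_contra hne
  have hQ0 : Q ≠ 0 := by rintro rfl; exact hne (by rw [hQ, mul_zero])
  have hQdeg : Q ∈ Polynomial.degreeLT ℝ k := by
    rw [Polynomial.mem_degreeLT]
    rw [Polynomial.mem_degreeLE] at hw
    have h1 := Polynomial.natDegree_le_iff_degree_le.2 hw
    rw [hQ, Polynomial.natDegree_mul (Polynomial.X_sub_C_ne_zero z) hQ0,
      Polynomial.natDegree_X_sub_C] at h1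
    rw [← Polynomial.natDegree_lt_iff_degree_lt hQ0]
    omega
  have h0 := hm Q hQdeg
  obtain ⟨x₀, hx₀, hQx⟩ := exists_eval_ne_zero hpq hQ0
  have hcont : ∀ σ : ℝ, ContinuousOn (fun x => σ * (x - z) * Q.eval x ^ 2) (Icc p q) := fun σ =>
    Continuous.continuousOn (by fun_prop)
  have hsq : 0 < Q.eval x₀ ^ 2 := by positivity
  have hrw : ∀ σ : ℝ, ∫ x in p..q, σ * (x - z) * Q.eval x ^ 2 = 0 := by
    intro σ
    have : ∫ x in p..q, σ * (x - z) * Q.eval x ^ 2 = σ * ∫ x in p..q, w.eval x * Q.eval x := by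
      rw [← intervalIntegral.integral_const_mul, hQ]
      congr 1; funext x
      simp only [Polynomial.eval_mul, Polynomial.eval_sub, Polynomial.eval_X, Polynomial.eval_C]
      ring
    rw [this, h0, mul_zero]
  rcases hz with rfl | rfl
  · have := intervalIntegral.integral_pos hpq (hcont 1)
      (fun x hx => by
        have : 0 ≤ x - z := by linarith [hx.1]
        positivity)
      ⟨x₀, Ioo_subset_Icc_self hx₀, by
        have : 0 < x₀ - z := by linarith [hx₀.1]
        positivity⟩
    rw [hrw] at this
    exact lt_irrefl _ this
  · have := intervalIntegral.integral_pos hpq (hcont (-1))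
      (fun x hx => by
        have : 0 ≤ -1 * (x - z) := by linarith [hx.2]
        positivity)
      ⟨x₀, Ioo_subset_Icc_self hx₀, by
        have : 0 < -1 * (x₀ - z) := by linarith [hx₀.2]
        positivity⟩
    rw [hrw] at this
    exact lt_irrefl _ this

/-- The moments of degree less than `k` and the value at `z`. -/
def radauData (p q z : ℝ) (k : ℕ) :
    Polynomial.degreeLE ℝ (k : WithBot ℕ) →ₗ[ℝ] (Fin k → ℝ) × ℝ :=
  ((LinearMap.pi fun i : Fin k => polyPairing p q (Polynomial.X ^ (i : ℕ))).prod
    (Polynomial.leval z)).comp (Submodule.subtype _)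

theorem radauData_injective (hpq : p < q) (hz : z = p ∨ z = q) :
    Function.Injective (radauData p q z k) := by
  rw [← LinearMap.ker_eq_bot, LinearMap.ker_eq_bot']
  intro w hw
  have h1 : ∀ i : Fin k, polyPairing p q (Polynomial.X ^ (i : ℕ)) (w : ℝ[X]) = 0 := fun i =>
    congrFun (congrArg Prod.fst hw) i
  have h2 : (w : ℝ[X]).eval z = 0 := congrArg Prod.snd hw
  exact Subtype.ext (radau_unique hpq hz w.2
    (fun v hv => integral_mul_eq_zero_of_monomials (w : ℝ[X]).continuous.continuousOn h1 hv) h2)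

/-- Polynomials of degree at most `k` as coefficient vectors. -/
def degreeLECoeff (k : ℕ) : Polynomial.degreeLE ℝ (k : WithBot ℕ) ≃ₗ[ℝ] (Fin (k + 1) → ℝ) :=
  (LinearEquiv.ofEq _ _ Polynomial.degreeLT_succ_eq_degreeLE.symm).trans
    (Polynomial.degreeLTEquiv ℝ (k + 1))

instance (k : ℕ) : Module.Finite ℝ (Polynomial.degreeLE ℝ (k : WithBot ℕ)) :=
  Module.Finite.equiv (degreeLECoeff k).symm

theorem radauData_bijective (hpq : p < q) (hz : z = p ∨ z = q) :
    Function.Bijective (radauData p q z k) := by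
  refine ⟨radauData_injective hpq hz, ?_⟩
  have hfin : Module.finrank ℝ (Polynomial.degreeLE ℝ (k : WithBot ℕ))
      = Module.finrank ℝ ((Fin k → ℝ) × ℝ) := by
    rw [(degreeLECoeff k).finrank_eq]; simp
  exact (LinearMap.injective_iff_surjective_of_finrank_eq_finrank hfin).1
    (radauData_injective hpq hz)

/-- Gauss-Radau interpolation is determined by its data. -/
def radauEquiv (hpq : p < q) (hz : z = p ∨ z = q) (k : ℕ) :
    Polynomial.degreeLE ℝ (k : WithBot ℕ) ≃ₗ[ℝ] (Fin k → ℝ) × ℝ :=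
  LinearEquiv.ofBijective (radauData p q z k) (radauData_bijective hpq hz)

theorem eval_eq_sum_degreeLE (w : Polynomial.degreeLE ℝ (k : WithBot ℕ)) (x : ℝ) :
    (w : ℝ[X]).eval x = ∑ i : Fin (k + 1), (w : ℝ[X]).coeff i * x ^ (i : ℕ) := by
  have hd : (w : ℝ[X]).natDegree < k + 1 :=
    Nat.lt_succ_of_le (Polynomial.natDegree_le_iff_degree_le.2 (Polynomial.mem_degreeLE.1 w.2))
  rw [Polynomial.eval_eq_sum_range' hd,
    Fin.sum_univ_eq_sum_range (fun i => (w : ℝ[X]).coeff i * x ^ i)]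

/-- On the reference cell the inverse of the data map is linear between finite-dimensional spaces,
hence bounded; powers of `x` are at most `1` there. Adding `1` keeps the constant positive. -/
theorem radau_bound_reference (k : ℕ) (hz : z = 0 ∨ z = 1) :
    ∃ C : ℝ, 0 < C ∧ ∀ w : Polynomial.degreeLE ℝ (k : WithBot ℕ), ∀ x ∈ Icc (0 : ℝ) 1,
      |(w : ℝ[X]).eval x| ≤ C * ‖radauData 0 1 z k w‖ := by
  set D := radauEquiv zero_lt_one hz k with hD
  set L : Fin (k + 1) → ((Fin k → ℝ) × ℝ) →L[ℝ] ℝ := fun i => LinearMap.toContinuousLinearMap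
    ((Polynomial.lcoeff ℝ (i : ℕ)).comp ((Submodule.subtype _).comp D.symm.toLinearMap)) with hL
  refine ⟨(∑ i, ‖L i‖) + 1, by positivity, fun w x hx => ?_⟩
  have hc : ∀ i : Fin (k + 1), (w : ℝ[X]).coeff i = L i (radauData 0 1 z k w) := by
    intro i
    have : D.symm (radauData 0 1 z k w) = w := D.symm_apply_apply w
    simp [hL, this]
  rw [eval_eq_sum_degreeLE]
  calc |∑ i : Fin (k + 1), (w : ℝ[X]).coeff i * x ^ (i : ℕ)|
      ≤ ∑ i : Fin (k + 1), |(w : ℝ[X]).coeff i * x ^ (i : ℕ)| := Finset.abs_sum_le_sum_abs _ _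
    _ ≤ ∑ i : Fin (k + 1), ‖L i‖ * ‖radauData 0 1 z k w‖ := by
        refine Finset.sum_le_sum fun i _ => ?_
        rw [abs_mul, hc i]
        have h1 := (L i).le_opNorm (radauData 0 1 z k w)
        have h2 : |x ^ (i : ℕ)| ≤ 1 := by
          rw [abs_of_nonneg (pow_nonneg hx.1 _)]
          exact pow_le_one₀ hx.1 hx.2
        calc _ ≤ (‖L i‖ * ‖radauData 0 1 z k w‖) * 1 := by gcongr; exact h1
          _ = _ := mul_one _
    _ = (∑ i, ‖L i‖) * ‖radauData 0 1 z k w‖ := by rw [Finset.sum_mul]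
    _ ≤ _ := by gcongr; linarith

/-- The Gauss-Radau projection is bounded in the maximum norm, uniformly in the cell. -/
theorem radau_stability (k : ℕ) :
    ∃ C : ℝ, 0 < C ∧ ∀ (p q z : ℝ), p < q → (z = p ∨ z = q) → ∀ w ∈
      Polynomial.degreeLE ℝ (k : WithBot ℕ), ∀ (R : ℝ → ℝ) (B : ℝ), ContinuousOn R (Icc p q) →
      (∀ x ∈ Icc p q, |R x| ≤ B) →
      (∀ v ∈ Polynomial.degreeLT ℝ k, ∫ x in p..q, (w.eval x - R x) * v.eval x = 0) →
      w.eval z = R z → ∀ x ∈ Icc p q, |w.eval x| ≤ C * B := by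
  obtain ⟨C₀, hC₀, h₀⟩ := radau_bound_reference k (z := 0) (Or.inl rfl)
  obtain ⟨C₁, hC₁, h₁⟩ := radau_bound_reference k (z := 1) (Or.inr rfl)
  refine ⟨max C₀ C₁, lt_max_of_lt_left hC₀, ?_⟩
  intro p q z hpq hz w hw R B hR hB hm hwz x hx
  have hh : 0 < q - p := sub_pos.2 hpq
  have hB0 : 0 ≤ B := (abs_nonneg _).trans (hB x hx)
  -- The affine map of `[0, 1]` onto `[p, q]`. It keeps the degree and carries `z` to an end point,
  -- so the constants of the two reference cases serve for all cells.
  set A : ℝ[X] := Polynomial.C p + Polynomial.C (q - p) * Polynomial.X with hA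
  have hAd : A.natDegree ≤ 1 := by rw [hA]; compute_degree
  have hŵ : w.comp A ∈ Polynomial.degreeLE ℝ (k : WithBot ℕ) := by
    rw [Polynomial.mem_degreeLE, ← Polynomial.natDegree_le_iff_degree_le] at hw ⊢
    refine Polynomial.natDegree_comp_le.trans ?_
    calc _ ≤ k * 1 := Nat.mul_le_mul hw hAd
      _ = k := mul_one k
  have hev : ∀ y, (w.comp A).eval y = w.eval (p + (q - p) * y) := by
    intro y; simp [hA]
  set Z : ℝ := (z - p) / (q - p) with hZ
  have hZ01 : Z = 0 ∨ Z = 1 := by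
    rcases hz with rfl | rfl
    · left; simp [hZ]
    · right; rw [hZ, div_self hh.ne']
  have hpZ : p + (q - p) * Z = z := by rw [hZ]; field_simp; ring
  have hzm : z ∈ Icc p q := by rcases hz with rfl | rfl <;> simp [hpq.le]
  have hdata : ‖radauData 0 1 Z k ⟨w.comp A, hŵ⟩‖ ≤ B := by
    rw [Prod.norm_def, max_le_iff]
    constructor
    · refine (pi_norm_le_iff_of_nonneg hB0).2 fun i => ?_
      change ‖∫ y in (0 : ℝ)..1, (w.comp A).eval y * (Polynomial.X ^ (i : ℕ)).eval y‖ ≤ B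
      -- The reference monomial `y^i` transported to `[p, q]`; testing with it shows that the
      -- reference moments of `w` are those of `R`, hence at most `B`.
      set v : ℝ[X] := (Polynomial.C (1 / (q - p)) * (Polynomial.X - Polynomial.C p)) ^ (i : ℕ)
        with hv
      have hvm : v ∈ Polynomial.degreeLT ℝ k := by
        rw [Polynomial.mem_degreeLT]
        refine lt_of_le_of_lt (Polynomial.degree_le_of_natDegree_le (n := (i : ℕ)) ?_)
          (by exact_mod_cast i.2)
        refine Polynomial.natDegree_pow_le.trans ?_
        have : (Polynomial.C (1 / (q - p)) * (Polynomial.X - Polynomial.C p)).natDegree ≤ 1 := by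
          compute_degree
        calc _ ≤ (i : ℕ) * 1 := Nat.mul_le_mul_left _ this
          _ = _ := mul_one _
      have hveval : ∀ y, v.eval (p + (q - p) * y) = y ^ (i : ℕ) := by
        intro y
        simp only [hv, Polynomial.eval_pow, Polynomial.eval_mul, Polynomial.eval_C,
          Polynomial.eval_sub, Polynomial.eval_X]
        congr 1; field_simp; ring
      have hwv : ∫ x in p..q, w.eval x * v.eval x = ∫ x in p..q, R x * v.eval x := by
        have h := hm v hvm
        simp only [sub_mul] at h
        have hRi : ContinuousOn (fun x => R x * v.eval x) (uIcc p q) := by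
          rw [uIcc_of_le hpq.le]; exact hR.mul (Continuous.continuousOn (by fun_prop))
        rw [intervalIntegral.integral_sub (Continuous.intervalIntegrable (by fun_prop) _ _)
          hRi.intervalIntegrable] at h
        linarith
      have hcv := intervalIntegral.integral_comp_add_mul (a := 0) (b := 1)
        (fun x => w.eval x * v.eval x) hh.ne' p
      simp only [mul_zero, add_zero, mul_one, add_sub_cancel, smul_eq_mul] at hcv
      have hcR := intervalIntegral.integral_comp_add_mul (a := 0) (b := 1)
        (fun x => R x * v.eval x) hh.ne' p
      simp only [mul_zero, add_zero, mul_one, add_sub_cancel, smul_eq_mul] at hcR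
      have : ∫ y in (0 : ℝ)..1, (w.comp A).eval y * (Polynomial.X ^ (i : ℕ)).eval y
          = ∫ y in (0 : ℝ)..1, R (p + (q - p) * y) * v.eval (p + (q - p) * y) := by
        rw [hcR, ← hwv, ← hcv]
        congr 1; funext y
        rw [hev, hveval, Polynomial.eval_pow, Polynomial.eval_X]
      rw [this]
      have hb := intervalIntegral.norm_integral_le_of_norm_le_const (a := 0) (b := 1) (C := B)
        (f := fun y => R (p + (q - p) * y) * v.eval (p + (q - p) * y)) (fun y hy => by
          rw [uIoc_of_le zero_le_one] at hy
          rw [hveval, norm_mul]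
          have hy1 : ‖y ^ (i : ℕ)‖ ≤ 1 := by
            rw [Real.norm_of_nonneg (pow_nonneg hy.1.le _)]
            exact pow_le_one₀ hy.1.le hy.2
          calc _ ≤ B * 1 := by
                refine mul_le_mul (hB _ ⟨?_, ?_⟩) hy1 (norm_nonneg _) hB0
                · nlinarith [hy.1]
                · nlinarith [hy.2]
            _ = B := mul_one B)
      simpa using hb
    · change ‖(w.comp A).eval Z‖ ≤ B
      rw [hev, hpZ, hwz]
      exact hB z hzm
  have hxx : w.eval x = (w.comp A).eval ((x - p) / (q - p)) := by
    rw [hev]; congr 1; field_simp; ring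
  have hxm : (x - p) / (q - p) ∈ Icc (0 : ℝ) 1 :=
    ⟨div_nonneg (by linarith [hx.1]) hh.le, (div_le_one hh).2 (by linarith [hx.2])⟩
  rw [hxx]
  have hfin : ∀ C, 0 < C → C ≤ max C₀ C₁ →
      |(w.comp A).eval ((x - p) / (q - p))| ≤ C * ‖radauData 0 1 Z k ⟨w.comp A, hŵ⟩‖ →
      |(w.comp A).eval ((x - p) / (q - p))| ≤ max C₀ C₁ * B := fun C hC hle h =>
    h.trans (mul_le_mul hle hdata (norm_nonneg _) (hC.le.trans hle))
  rcases hZ01 with h | h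
  · refine hfin C₀ hC₀ (le_max_left _ _) ?_
    rw [h]; exact h₀ ⟨_, hŵ⟩ _ hxm
  · refine hfin C₁ hC₁ (le_max_right _ _) ?_
    rw [h]; exact h₁ ⟨_, hŵ⟩ _ hxm

end Radau

/-! ### Local polynomial approximation -/

theorem exists_antiderivative {k : ℕ} {w : ℝ[X]}
    (hw : w ∈ Polynomial.degreeLE ℝ (k : WithBot ℕ)) :
    ∃ Q ∈ Polynomial.degreeLE ℝ ((k + 1 : ℕ) : WithBot ℕ), Q.derivative = w := by
  refine ⟨∑ i ∈ Finset.range (k + 1), Polynomial.monomial (i + 1) (w.coeff i / ((i : ℝ) + 1)),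
    Submodule.sum_mem _ fun i hi => ?_, ?_⟩
  · rw [Polynomial.mem_degreeLE]
    refine (Polynomial.degree_monomial_le _ _).trans ?_
    have := Finset.mem_range.1 hi
    exact_mod_cast this
  · have hd : w.natDegree < k + 1 :=
      Nat.lt_succ_of_le (Polynomial.natDegree_le_iff_degree_le.2 (Polynomial.mem_degreeLE.1 hw))
    rw [Polynomial.derivative_sum, w.as_sum_range' (k + 1) hd]
    refine Finset.sum_congr rfl fun i hi => ?_
    rw [Polynomial.derivative_monomial]
    have hi0 : (i : ℝ) + 1 ≠ 0 := by positivity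
    simp only [Nat.add_sub_cancel, Nat.cast_add, Nat.cast_one, Polynomial.finsetSum_coeff,
      Polynomial.coeff_monomial, Finset.sum_ite_eq', hi, if_true]
    rw [div_mul_cancel₀ _ hi0]

/-- `F i` plays the role of the derivative of order `i`. By induction an approximant of `F 1` is
integrated and its constant fixed by the value at `p`, which gains one factor `q - p`. Taking the
whole chain as data lets the induction shift it by one. -/
theorem exists_poly_approx {p q : ℝ} (hpq : p ≤ q) (k : ℕ) :
    ∀ F : ℕ → ℝ → ℝ, (∀ i ≤ k, IntervalIntegrable (F (i + 1)) volume p q) →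
      (∀ i ≤ k, ∀ x ∈ Icc p q, F i x = F i p + ∫ s in p..x, F (i + 1) s) →
      ∃ w ∈ Polynomial.degreeLE ℝ (k : WithBot ℕ), ∀ x ∈ Icc p q,
        |F 0 x - w.eval x| ≤ (q - p) ^ k * ∫ s in p..q, |F (k + 1) s| := by
  induction k with
  | zero =>
    intro F hi hF
    refine ⟨Polynomial.C (F 0 p), ?_, fun x hx => ?_⟩
    · rw [Polynomial.mem_degreeLE]; exact Polynomial.degree_C_le
    · rw [Polynomial.eval_C, hF 0 le_rfl x hx, add_sub_cancel_left, pow_zero, one_mul]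
      refine (intervalIntegral.abs_integral_le_integral_abs hx.1).trans ?_
      exact intervalIntegral.integral_mono_interval le_rfl hx.1 hx.2
        (Filter.Eventually.of_forall fun s => abs_nonneg _) (hi 0 le_rfl).abs
  | succ k ih =>
    intro F hi hF
    obtain ⟨w, hw, hb⟩ := ih (fun i => F (i + 1)) (fun i h => hi (i + 1) (by omega))
      (fun i h => hF (i + 1) (by omega))
    obtain ⟨Q, hQ, hQd⟩ := exists_antiderivative hw
    refine ⟨Polynomial.C (F 0 p - Q.eval p) + Q, Submodule.add_mem _ ?_ hQ, fun x hx => ?_⟩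
    · rw [Polynomial.mem_degreeLE]
      exact Polynomial.degree_C_le.trans (by exact_mod_cast Nat.zero_le _)
    · have hQi : ∫ s in p..x, w.eval s = Q.eval x - Q.eval p := by
        refine intervalIntegral.integral_eq_sub_of_hasDerivAt (f := fun y => Q.eval y) (fun s _ => ?_)
          (w.continuous.intervalIntegrable _ _)
        rw [← hQd]; exact Q.hasDerivAt s
      have hsub : uIcc p x ⊆ uIcc p q := by
        rw [uIcc_of_le hx.1, uIcc_of_le hpq]; exact Icc_subset_Icc_right hx.2
      have hF1 : IntervalIntegrable (F 1) volume p x := (hi 0 (by omega)).mono_set hsub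
      have : F 0 x - (Polynomial.C (F 0 p - Q.eval p) + Q).eval x
          = ∫ s in p..x, (F 1 s - w.eval s) := by
        rw [intervalIntegral.integral_sub hF1 (w.continuous.intervalIntegrable _ _),
          hQi, hF 0 (by omega) x hx]
        simp only [Polynomial.eval_add, Polynomial.eval_C]
        ring
      rw [this]
      set A := (q - p) ^ k * ∫ s in p..q, |F (k + 1 + 1) s| with hA
      have hA0 : 0 ≤ A := mul_nonneg (pow_nonneg (sub_nonneg.2 hpq) _)
        (intervalIntegral.integral_nonneg hpq fun _ _ => abs_nonneg _)
      have h := intervalIntegral.norm_integral_le_of_norm_le_const (a := p) (b := x) (C := A)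
        (f := fun s => F 1 s - w.eval s) (fun s hs => by
          rw [uIoc_of_le hx.1] at hs
          exact hb s ⟨hs.1.le, hs.2.trans hx.2⟩)
      rw [Real.norm_eq_abs, abs_of_nonneg (sub_nonneg.2 hx.1)] at h
      calc _ ≤ A * (x - p) := h
        _ ≤ A * (q - p) := mul_le_mul_of_nonneg_left (by linarith [hx.2]) hA0
        _ = _ := by rw [hA]; ring

/-! ### Functions with a weak derivative -/

section Weak

variable {a b : ℝ}

theorem exists_Icc_of_compact_subset_Ioo (hab : a < b) {K : Set ℝ} (hK : IsCompact K)
    (hs : K ⊆ Ioo a b) : ∃ a' b', a < a' ∧ b' < b ∧ K ⊆ Icc a' b' := by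
  rcases K.eq_empty_or_nonempty with rfl | hne
  · exact ⟨(a + b) / 2, (a + b) / 2, by linarith, by linarith, empty_subset _⟩
  · exact ⟨sInf K, sSup K, (hs (hK.sInf_mem hne)).1, (hs (hK.sSup_mem hne)).2,
      fun x hx => ⟨csInf_le hK.bddBelow hx, le_csSup hK.bddAbove hx⟩⟩

theorem intervalIntegral_eq_Ioo (hab : a ≤ b) (f : ℝ → ℝ) :
    ∫ x in a..b, f x = ∫ x in Ioo a b, f x := by
  rw [intervalIntegral.integral_of_le hab, integral_Ioc_eq_integral_Ioo]

/-- A smooth function with zero integral and compact support in `(a, b)` is the derivative of such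
a function. -/
theorem exists_test_primitive (hab : a < b) {θ : ℝ → ℝ} (hθ : ContDiff ℝ ∞ θ)
    (hc : HasCompactSupport θ) (hs : tsupport θ ⊆ Ioo a b) (h0 : ∫ x in Ioo a b, θ x = 0) :
    ∃ φ : ℝ → ℝ, ContDiff ℝ ∞ φ ∧ HasCompactSupport φ ∧ tsupport φ ⊆ Ioo a b ∧ deriv φ = θ := by
  obtain ⟨a', b', ha', hb', hK⟩ := exists_Icc_of_compact_subset_Ioo hab hc.isCompact hs
  set φ : ℝ → ℝ := fun x => ∫ s in a..x, θ s with hφ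
  have hd : ∀ x, HasDerivAt φ (θ x) x := fun x =>
    (hθ.continuous.integral_hasStrictDerivAt a x).hasDerivAt
  have hdφ : deriv φ = θ := funext fun x => (hd x).deriv
  have hzero : ∀ x, x ∉ Icc a' b' → θ x = 0 := fun x hx =>
    image_eq_zero_of_notMem_tsupport fun h => hx (hK h)
  have hsupp : Function.support φ ⊆ Icc a' b' := by
    intro x hx
    by_contra hn
    refine hx ?_
    change ∫ s in a..x, θ s = 0
    by_cases h1 : x < a'
    · rw [intervalIntegral.integral_congr (g := fun _ => (0 : ℝ))]
      · simp
      · intro s hs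
        refine hzero s fun h => ?_
        have : s ≤ max a x := hs.2
        have := h.1
        rcases le_max_iff.1 hs.2 with h | h <;> linarith
    -- To the right of the support the primitive equals the total integral of `θ`, which is zero.
    · have h2 : b' < x := by
        by_contra h; exact hn ⟨not_lt.1 h1, not_lt.1 h⟩
      have e1 : ∫ s in a..b, θ s = 0 := by rw [intervalIntegral_eq_Ioo hab.le, h0]
      have e2 : ∫ s in x..b, θ s = 0 := by
        rw [intervalIntegral.integral_congr (g := fun _ => (0 : ℝ))]
        · simp
        · intro s hs
          refine hzero s fun h => ?_
          have := h.2
          rcases min_le_iff.1 hs.1 with h | h <;> linarith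
      have := intervalIntegral.integral_add_adjacent_intervals (μ := volume)
        (hθ.continuous.intervalIntegrable a x) (hθ.continuous.intervalIntegrable x b)
      linarith
  have hts : tsupport φ ⊆ Icc a' b' := closure_minimal hsupp isClosed_Icc
  refine ⟨φ, ?_, HasCompactSupport.of_support_subset_isCompact isCompact_Icc hsupp,
    hts.trans (Icc_subset_Ioo ha' hb'), hdφ⟩
  rw [contDiff_infty_iff_deriv]
  exact ⟨fun x => (hd x).differentiableAt, by rw [hdφ]; exact hθ⟩

/-- The lemma of du Bois-Reymond. -/
theorem exists_const_of_weak_deriv_zero (hab : a < b) {w : ℝ → ℝ} (hw : IntegrableOn w (Ioo a b))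
    (h : ∀ φ : ℝ → ℝ, ContDiff ℝ ∞ φ → HasCompactSupport φ → tsupport φ ⊆ Ioo a b →
      ∫ x in Ioo a b, w x * deriv φ x = 0) :
    ∃ c : ℝ, ∀ᵐ x, x ∈ Ioo a b → w x = c := by
  have hmul : ∀ χ : ℝ → ℝ, Continuous χ → HasCompactSupport χ →
      IntegrableOn (fun x => w x * χ x) (Ioo a b) := by
    intro χ hχ hc
    obtain ⟨B, hB⟩ := hc.exists_bound_of_continuous hχ
    exact hw.mul_bdd hχ.aestronglyMeasurable (Filter.Eventually.of_forall hB)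
  -- A bump of integral one inside `(a, b)`; subtracting its multiple by `∫ χ` from a test function
  -- `χ` leaves integral zero, hence the derivative of a test function. The constant is the pairing
  -- of `w` with this bump.
  set ρ : ContDiffBump ((a + b) / 2) := ⟨(b - a) / 8, (b - a) / 4, by linarith, by linarith⟩ with hρ
  have hρs : tsupport (ρ.normed volume) ⊆ Ioo a b := by
    rw [ρ.tsupport_normed_eq, Real.closedBall_eq_Icc]
    change Icc ((a + b) / 2 - (b - a) / 4) ((a + b) / 2 + (b - a) / 4) ⊆ _
    exact Icc_subset_Ioo (by linarith) (by linarith)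
  have hρ1 : ∫ x in Ioo a b, ρ.normed volume x = 1 := by
    rw [setIntegral_eq_integral_of_forall_compl_eq_zero, ρ.integral_normed]
    exact fun x hx => image_eq_zero_of_notMem_tsupport fun h => hx (hρs h)
  set c := ∫ x in Ioo a b, w x * ρ.normed volume x with hcdef
  refine ⟨c, ?_⟩
  have key := isOpen_Ioo.ae_eq_zero_of_integral_contDiff_smul_eq_zero (μ := volume) (U := Ioo a b)
    (f := fun x => w x - c)
    ((hw.sub (integrableOn_const (by simp))).locallyIntegrableOn) (fun χ hχ hχc hχs => ?_)
  · filter_upwards [key] with x hx hm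
    linarith [hx hm]
  · set m := ∫ x in Ioo a b, χ x with hm
    set θ : ℝ → ℝ := fun x => χ x - m * ρ.normed volume x with hθ
    have hρc : HasCompactSupport (fun x => m * ρ.normed volume x) :=
      ρ.hasCompactSupport_normed.mul_left
    have hχi : IntegrableOn χ (Ioo a b) :=
      (hχ.continuous.integrable_of_hasCompactSupport hχc).integrableOn
    have hρi : IntegrableOn (ρ.normed volume) (Ioo a b) := ρ.integrable_normed.integrableOn
    have hθs : tsupport θ ⊆ Ioo a b := by
      refine (tsupport_sub χ fun x => m * ρ.normed volume x).trans (union_subset hχs ?_)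
      exact (tsupport_mul_subset_right).trans hρs
    obtain ⟨φ, h1, h2, h3, h4⟩ := exists_test_primitive hab (θ := θ)
      (hχ.sub (contDiff_const.mul ρ.contDiff_normed)) (hχc.sub hρc) hθs (by
        rw [hθ, integral_sub hχi (hρi.const_mul m), integral_const_mul, hρ1, mul_one, sub_self])
    have h5 := h φ h1 h2 h3
    rw [h4] at h5
    have h6 : ∫ x in Ioo a b, w x * θ x = (∫ x in Ioo a b, w x * χ x) - m * c := by
      rw [hcdef, ← integral_const_mul, ← integral_sub (hmul χ hχ.continuous hχc)
        ((hmul _ ρ.continuous_normed ρ.hasCompactSupport_normed).const_mul m)]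
      congr 1; funext x; simp only [hθ]; ring
    have h7 : ∫ x, χ x • (w x - c) = ∫ x in Ioo a b, χ x • (w x - c) := by
      symm
      refine setIntegral_eq_integral_of_forall_compl_eq_zero fun x hx => ?_
      rw [image_eq_zero_of_notMem_tsupport fun h => hx (hχs h), zero_smul]
    rw [h7]
    have h8 : ∫ x in Ioo a b, χ x • (w x - c) = (∫ x in Ioo a b, w x * χ x) - m * c := by
      rw [hm, ← integral_mul_const, ← integral_sub (hmul χ hχ.continuous hχc) (hχi.mul_const c)]
      congr 1; funext x; simp only [smul_eq_mul]; ring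
    rw [h8, ← h6, h5]

/-- Integration by parts shows that `f` minus the primitive of `g` has zero weak derivative; the
lemma of du Bois-Reymond then applies. -/
theorem exists_primitive_of_weak_deriv (hab : a < b) {f g : ℝ → ℝ} (hf : IntegrableOn f (Ioo a b))
    (hg : IntegrableOn g (Ioo a b))
    (h : ∀ φ : ℝ → ℝ, ContDiff ℝ ∞ φ → HasCompactSupport φ → tsupport φ ⊆ Ioo a b →
      ∫ x in Ioo a b, f x * deriv φ x = -∫ x in Ioo a b, g x * φ x) :
    ∃ c : ℝ, ∀ᵐ x, x ∈ Ioo a b → f x = c + ∫ s in a..x, g s := by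
  have hgi : IntervalIntegrable g volume a b :=
    (intervalIntegrable_iff_integrableOn_Ioo_of_le hab.le).2 hg
  have hGac := hgi.absolutelyContinuousOnInterval_intervalIntegral (c := a) left_mem_uIcc
  have hGc : ContinuousOn (fun x => ∫ s in a..x, g s) (Icc a b) := by
    simpa [uIcc_of_le hab.le] using hGac.continuousOn
  have hGi : IntegrableOn (fun x => ∫ s in a..x, g s) (Ioo a b) :=
    hGc.integrableOn_Icc.mono_set Ioo_subset_Icc_self
  obtain ⟨c, hc⟩ := exists_const_of_weak_deriv_zero hab (hf.sub hGi) (fun φ hφ hφc hφs => by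
    have hφ' := test_iteratedDeriv hφ hφc 1
    rw [iteratedDeriv_one] at hφ'
    obtain ⟨B, hB⟩ := hφ'.2.exists_bound_of_continuous hφ'.1
    have i1 : IntegrableOn (fun x => f x * deriv φ x) (Ioo a b) :=
      hf.mul_bdd hφ'.1.aestronglyMeasurable (Filter.Eventually.of_forall hB)
    have i2 : IntegrableOn (fun x => (∫ s in a..x, g s) * deriv φ x) (Ioo a b) :=
      hGi.mul_bdd hφ'.1.aestronglyMeasurable (Filter.Eventually.of_forall hB)
    simp only [Pi.sub_apply, sub_mul]
    rw [integral_sub i1 i2, h φ hφ hφc hφs]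
    have hφac : AbsolutelyContinuousOnInterval φ a b :=
      ((hφ.of_le (by exact_mod_cast le_top)).contDiffOn).absolutelyContinuousOnInterval
    have hparts := hGac.integral_mul_deriv_eq_deriv_mul hφac
    have ha0 : φ a = 0 := image_eq_zero_of_notMem_tsupport fun hm => lt_irrefl _ (hφs hm).1
    have hb0 : φ b = 0 := image_eq_zero_of_notMem_tsupport fun hm => lt_irrefl _ (hφs hm).2
    rw [ha0, hb0, mul_zero, mul_zero, sub_zero, zero_sub, intervalIntegral_eq_Ioo hab.le,
      intervalIntegral_eq_Ioo hab.le] at hparts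
    have hcongr : ∫ x in Ioo a b, deriv (fun x => ∫ s in a..x, g s) x * φ x
        = ∫ x in Ioo a b, g x * φ x := by
      refine setIntegral_congr_ae measurableSet_Ioo ?_
      filter_upwards [hgi.ae_hasDerivAt_integral] with x hx hm
      rw [(hx (by rw [uIcc_of_le hab.le]; exact Ioo_subset_Icc_self hm) a left_mem_uIcc).deriv]
    rw [hparts, hcongr]; ring)
  refine ⟨c, ?_⟩
  filter_upwards [hc] with x hx hm
  have := hx hm
  simp only [Pi.sub_apply] at this
  linarith

theorem L2.integrableOn (u : L2 a b) : IntegrableOn u (Ioo a b) :=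
  (Lp.memLp u).integrable (by norm_num)

theorem L2.intervalIntegrable (hab : a ≤ b) (u : L2 a b) : IntervalIntegrable u volume a b :=
  (intervalIntegrable_iff_integrableOn_Ioo_of_le hab).2 u.integrableOn

theorem L2.intervalIntegrable_sub (u : L2 a b) {p q : ℝ} (hp : p ∈ Icc a b)
    (hq : q ∈ Icc a b) : IntervalIntegrable u volume p q :=
  (u.intervalIntegrable (hp.1.trans hp.2)).mono_set
    (by rw [uIcc_of_le (hp.1.trans hp.2)]; exact uIcc_subset_Icc hp hq)

theorem L2.integrableOn_sq (u : L2 a b) : IntegrableOn (fun x => u x ^ 2) (Ioo a b) :=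
  (Lp.memLp u).integrable_sq

/-- The integral of `u φ` over `(a, b)`, as a functional of `u`. -/
def pairing {φ : ℝ → ℝ} (hφ : MemLp φ 2 (volume.restrict (Ioo a b))) : L2 a b →L[ℝ] ℝ :=
  innerSL ℝ (hφ.toLp φ)

theorem pairing_apply {φ : ℝ → ℝ} (hφ : MemLp φ 2 (volume.restrict (Ioo a b))) (u : L2 a b) :
    pairing hφ u = ∫ x in Ioo a b, u x * φ x := by
  rw [pairing, innerSL_apply_apply, L2.inner_def]
  refine integral_congr_ae ?_
  filter_upwards [hφ.coeFn_toLp] with x hx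
  rw [hx]; rfl

theorem memLp_of_continuous {φ : ℝ → ℝ} (hφ : Continuous φ) :
    MemLp φ 2 (volume.restrict (Ioo a b)) := by
  obtain ⟨B, hB⟩ := (isCompact_Icc (a := a) (b := b)).exists_bound_of_continuousOn hφ.continuousOn
  refine MemLp.of_bound hφ.aestronglyMeasurable B ?_
  filter_upwards [ae_restrict_mem measurableSet_Ioo] with x hx
  exact hB x (Ioo_subset_Icc_self hx)

theorem memLp_indicator {φ : ℝ → ℝ} (hφ : Continuous φ) {s : Set ℝ} (hs : MeasurableSet s) :
    MemLp (s.indicator φ) 2 (volume.restrict (Ioo a b)) :=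
  (memLp_of_continuous hφ).indicator hs

theorem pairing_indicator {φ : ℝ → ℝ} (hφ : Continuous φ) {p q : ℝ} (hpq : p ≤ q)
    (hap : a ≤ p) (hqb : q ≤ b) (u : L2 a b) :
    pairing (memLp_indicator hφ (measurableSet_Ioo (a := p) (b := q))) u
      = ∫ x in p..q, u x * φ x := by
  have : (fun x => u x * (Ioo p q).indicator φ x) = (Ioo p q).indicator fun x => u x * φ x := by
    funext x
    by_cases h : x ∈ Ioo p q <;> simp [h]
  rw [pairing_apply, this, setIntegral_indicator measurableSet_Ioo,
    inter_eq_self_of_subset_right (Ioo_subset_Ioo hap hqb), intervalIntegral_eq_Ioo hpq]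

end Weak

/-! ### Continuous representatives -/

section Trace

variable {a b : ℝ} {m : ℕ}

/-- The weak derivative of order `i` as a continuous linear map. -/
def sobolevProj (i : Fin (m + 1)) : Sobolev m a b →L[ℝ] L2 a b :=
  (PiLp.proj 2 (fun _ : Fin (m + 1) => L2 a b) i).comp (Sobolev m a b).subtypeL

@[simp] theorem sobolevProj_apply (i : Fin (m + 1)) (u : Sobolev m a b) :
    sobolevProj i u = u.1 i := rfl

theorem norm_sobolev_apply_le (u : Sobolev m a b) (i : Fin (m + 1)) : ‖u.1 i‖ ≤ ‖u‖ :=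
  PiLp.norm_apply_le u.1 i

/-- Each component is defined as a weak derivative of component `0`. Testing order `i + 1` with `φ`
and order `i` with `φ'` shows that consecutive components are first weak derivatives of each other.
-/
theorem exists_primitive_sobolev (hab : a < b) (u : Sobolev m a b) {i : ℕ} (hi : i + 1 < m + 1) :
    ∃ c : ℝ, ∀ᵐ x, x ∈ Ioo a b →
      u.1 ⟨i, by omega⟩ x = c + ∫ s in a..x, u.1 ⟨i + 1, hi⟩ s := by
  refine exists_primitive_of_weak_deriv hab (L2.integrableOn _) (L2.integrableOn _) ?_
  intro φ hφ hφc hφs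
  have h1 := u.2 ⟨i + 1, hi⟩ φ hφ hφc hφs
  have hd : ContDiff ℝ ∞ (deriv φ) := (contDiff_infty_iff_deriv.1 hφ).2
  have h2 := u.2 ⟨i, by omega⟩ (deriv φ) hd hφc.deriv (tsupport_deriv_subset.trans hφs)
  simp only [iteratedDeriv_succ'] at h1
  rw [h1] at h2
  have hpow : ((-1 : ℝ) ^ i) * (-1) ^ i = 1 := by rw [← mul_pow]; simp
  have := congrArg (fun r => (-1 : ℝ) ^ i * r) h2
  simp only [pow_succ, ← mul_assoc, hpow, one_mul] at this
  linarith

/-- The value at `x ∈ [a, b]` of the continuous representative. -/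
def traceCLM (x : ℝ) : Sobolev (m + 1) a b →L[ℝ] ℝ :=
  -- Integrating `u(x) = u(a) + ∫ₐˣ u'` over `(a, b)` gives `∫ u = (b - a) u(a) + ∫ (b - s) u'(s)
  -- ds`, so the first summand is `u(a)`; the last one adds `∫ₐˣ u'`. Written through pairings, the
  -- trace is visibly linear and continuous.
  (1 / (b - a)) • ((pairing (memLp_of_continuous continuous_const : MemLp (fun _ => (1 : ℝ)) 2
      (volume.restrict (Ioo a b)))).comp (sobolevProj 0)
    - (pairing (memLp_of_continuous (by fun_prop : Continuous fun s => b - s))).comp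
      (sobolevProj 1))
  + (pairing (memLp_indicator (φ := fun _ => (1 : ℝ)) continuous_const
      (measurableSet_Ioo (a := a) (b := x)))).comp (sobolevProj 1)

theorem traceCLM_eq (u : Sobolev (m + 1) a b) {x : ℝ} (hx : x ∈ Icc a b) :
    traceCLM x u = traceCLM a u + ∫ s in a..x, dx u s := by
  have h1 := pairing_indicator (a := a) (b := b) (φ := fun _ => (1 : ℝ)) continuous_const hx.1
    le_rfl hx.2 (dx u)
  have h2 := pairing_indicator (a := a) (b := b) (φ := fun _ => (1 : ℝ)) continuous_const
    (le_refl a) le_rfl (hx.1.trans hx.2) (dx u)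
  simp only [mul_one, intervalIntegral.integral_same] at h1 h2
  simp only [traceCLM, add_apply, ContinuousLinearMap.comp_apply,
    sobolevProj_apply]
  change _ + pairing _ (dx u) = _ + pairing _ (dx u) + _
  rw [h1, h2, add_zero]

theorem traceCLM_sub (u : Sobolev (m + 1) a b) {x y : ℝ} (hx : x ∈ Icc a b) (hy : y ∈ Icc a b) :
    traceCLM y u = traceCLM x u + ∫ s in x..y, dx u s := by
  have hl : a ∈ Icc a b := ⟨le_rfl, hx.1.trans hx.2⟩
  have := intervalIntegral.integral_add_adjacent_intervals
    ((dx u).intervalIntegrable_sub hl hx) ((dx u).intervalIntegrable_sub hx hy)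
  rw [traceCLM_eq u hx, traceCLM_eq u hy, ← this]
  ring

theorem trace_absolutelyContinuous (hab : a ≤ b) (u : Sobolev (m + 1) a b) :
    AbsolutelyContinuousOnInterval (fun x => ∫ s in a..x, dx u s) a b :=
  ((dx u).intervalIntegrable hab).absolutelyContinuousOnInterval_intervalIntegral left_mem_uIcc

theorem continuousOn_trace (hab : a ≤ b) (u : Sobolev (m + 1) a b) :
    ContinuousOn (fun x => traceCLM x u) (Icc a b) := by
  have h := (trace_absolutelyContinuous hab u).continuousOn
  rw [uIcc_of_le hab] at h
  exact (continuousOn_const.add h).congr fun x hx => traceCLM_eq u hx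

theorem isContinuousRep_trace (hab : a < b) (u : Sobolev (m + 1) a b) :
    IsContinuousRep (fn u) (fun x => traceCLM x u) := by
  refine ⟨continuousOn_trace hab.le u, ?_⟩
  obtain ⟨c, hc⟩ := exists_primitive_sobolev hab u (i := 0) (by omega)
  have hc' : ∀ᵐ x, x ∈ Ioo a b → fn u x = c + ∫ s in a..x, dx u s := hc
  have hac := trace_absolutelyContinuous hab.le u
  have hG : IntegrableOn (fun x => ∫ s in a..x, dx u s) (Ioo a b) := by
    have h := hac.continuousOn
    rw [uIcc_of_le hab.le] at h
    exact h.integrableOn_Icc.mono_set Ioo_subset_Icc_self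
  have hmean : ∫ x in Ioo a b, fn u x = c * (b - a) + ∫ x in a..b, ∫ s in a..x, dx u s := by
    rw [setIntegral_congr_ae measurableSet_Ioo hc', integral_add (integrable_const c) hG,
      intervalIntegral_eq_Ioo hab.le]
    simp [hab.le, mul_comm]
  -- The antiderivative `s - b` of `1` vanishes at `b`, and the primitive of `dx u` vanishes at `a`,
  -- so no boundary term survives the integration by parts.
  have hsb : AbsolutelyContinuousOnInterval (fun s : ℝ => s - b) a b :=
    (ContDiff.contDiffOn (by fun_prop)).absolutelyContinuousOnInterval
  have hparts := hac.integral_mul_deriv_eq_deriv_mul hsb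
  have hds : deriv (fun s : ℝ => s - b) = fun _ => 1 := by
    funext s; simp
  have hcongr : ∫ x in a..b, deriv (fun x => ∫ s in a..x, dx u s) x * (x - b)
      = -∫ x in Ioo a b, dx u x * (b - x) := by
    rw [intervalIntegral_eq_Ioo hab.le, ← integral_neg]
    refine setIntegral_congr_ae measurableSet_Ioo ?_
    filter_upwards [((dx u).intervalIntegrable hab.le).ae_hasDerivAt_integral] with x hx hm
    rw [(hx (by rw [uIcc_of_le hab.le]; exact Ioo_subset_Icc_self hm) a left_mem_uIcc).deriv]
    ring
  rw [hds, hcongr] at hparts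
  simp only [mul_one, sub_self, mul_zero, intervalIntegral.integral_same, zero_mul, sub_neg_eq_add,
    zero_add] at hparts
  have htr : traceCLM a u = c := by
    have h2 := pairing_indicator (a := a) (b := b) (φ := fun _ => (1 : ℝ)) continuous_const
      (le_refl a) le_rfl hab.le (dx u)
    rw [intervalIntegral.integral_same] at h2
    simp only [traceCLM, add_apply, ContinuousLinearMap.comp_apply,
      sobolevProj_apply, smul_apply, sub_apply,
      pairing_apply, mul_one]
    change (1 / (b - a)) • ((∫ x in Ioo a b, fn u x) - ∫ x in Ioo a b, dx u x * (b - x)) +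
      ∫ x in Ioo a b, dx u x * _ = c
    rw [← pairing_apply (memLp_indicator (φ := fun _ => (1 : ℝ)) continuous_const
      (measurableSet_Ioo (a := a) (b := a))), h2, hmean, hparts, smul_eq_mul]
    have : b - a ≠ 0 := by linarith
    field_simp
    ring
  rw [Filter.EventuallyEq, ae_restrict_iff' measurableSet_Ioo]
  filter_upwards [hc'] with x hx hm
  rw [hx hm, traceCLM_eq u (Ioo_subset_Icc_self hm), htr]

theorem IsContinuousRep.eqOn (hab : a < b) {u : L2 a b} {f g : ℝ → ℝ} (hf : IsContinuousRep u f)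
    (hg : IsContinuousRep u g) : EqOn f g (Icc a b) := by
  refine Measure.eqOn_Icc_of_ae_eq volume hab.ne ?_ hf.1 hg.1
  rw [← restrict_Ioo_eq_restrict_Icc]
  exact hf.2.symm.trans hg.2

theorem trace_periodic (hab : a < b) (u : Sobolev (m + 1) a b) (h : IsPeriodic (fn u)) :
    traceCLM a u = traceCLM b u := by
  obtain ⟨f, hf, hfab⟩ := h
  have he := (isContinuousRep_trace hab u).eqOn hab hf
  have h1 : traceCLM a u = f a := he (left_mem_Icc.2 hab.le)
  have h2 : traceCLM b u = f b := he (right_mem_Icc.2 hab.le)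
  rw [h1, h2, hfab]

end Trace

/-! ### Approximation of Sobolev functions on a cell -/

section Approximation

variable {a b : ℝ} {k : ℕ}

/-- Cauchy-Schwarz, obtained by integrating the square of `|g|` minus its mean. -/
theorem sq_integral_abs_le {p q : ℝ} (hpq : p < q) {g : ℝ → ℝ}
    (hg : IntervalIntegrable g volume p q)
    (hg2 : IntervalIntegrable (fun x => g x ^ 2) volume p q) :
    (∫ x in p..q, |g x|) ^ 2 ≤ (q - p) * ∫ x in p..q, g x ^ 2 := by
  have hh : 0 < q - p := sub_pos.2 hpq
  set A := ∫ x in p..q, |g x| with hA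
  have h : 0 ≤ ∫ x in p..q, (|g x| - A / (q - p)) ^ 2 :=
    intervalIntegral.integral_nonneg hpq.le fun x _ => sq_nonneg _
  have e : ∫ x in p..q, (|g x| - A / (q - p)) ^ 2
      = (∫ x in p..q, g x ^ 2) - 2 * (A / (q - p)) * A + (q - p) * (A / (q - p)) ^ 2 := by
    have : (fun x => (|g x| - A / (q - p)) ^ 2)
        = fun x => g x ^ 2 - 2 * (A / (q - p)) * |g x| + (A / (q - p)) ^ 2 := by
      funext x
      have := sq_abs (g x)
      nlinarith
    rw [this, intervalIntegral.integral_add (hg2.sub (hg.abs.const_mul _))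
      intervalIntegrable_const, intervalIntegral.integral_sub hg2 (hg.abs.const_mul _),
      intervalIntegral.integral_const_mul, intervalIntegral.integral_const, smul_eq_mul]
  rw [e] at h
  have h2 : (∫ x in p..q, g x ^ 2) - 2 * (A / (q - p)) * A + (q - p) * (A / (q - p)) ^ 2
      = (∫ x in p..q, g x ^ 2) - A ^ 2 / (q - p) := by
    field_simp; ring
  rw [h2, sub_nonneg, div_le_iff₀ hh] at h
  linarith

/-- The weak derivative of highest order. -/
def topDeriv (u : Sobolev (k + 1) a b) : L2 a b := u.1 (Fin.last (k + 1))

theorem sobolev_poly_approx (hab : a < b) (u : Sobolev (k + 1) a b) {p q : ℝ} (hp : p ∈ Icc a b)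
    (hq : q ∈ Icc a b) (hpq : p ≤ q) :
    ∃ w ∈ Polynomial.degreeLE ℝ (k : WithBot ℕ), ∀ x ∈ Icc p q,
      |traceCLM x u - w.eval x| ≤ (q - p) ^ k * ∫ s in p..q, |topDeriv u s| := by
  have hprim : ∀ i : ℕ, ∃ c : ℝ, ∀ hi : i + 1 < k + 1 + 1, ∀ᵐ x, x ∈ Ioo a b →
      u.1 ⟨i, by omega⟩ x = c + ∫ s in a..x, u.1 ⟨i + 1, hi⟩ s := by
    intro i
    by_cases hi : i + 1 < k + 1 + 1
    · obtain ⟨c, hc⟩ := exists_primitive_sobolev hab u hi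
      exact ⟨c, fun _ => hc⟩
    · exact ⟨0, fun h => absurd h hi⟩
  choose c hc using hprim
  -- The chain for `exists_poly_approx`: the trace at order `0`, continuous primitives at the
  -- intermediate orders, and the weak derivative itself at order `k + 1`, beyond which no primitive
  -- is available.
  set F : ℕ → ℝ → ℝ := fun i x => if i = 0 then traceCLM x u else
    if h : i + 1 < k + 1 + 1 then c i + ∫ s in a..x, u.1 ⟨i + 1, h⟩ s else topDeriv u x with hF
  have hsub : Ioo p q ⊆ Ioo a b := Ioo_subset_Ioo hp.1 hq.2
  have hsubI : Icc p q ⊆ Icc a b := Icc_subset_Icc hp.1 hq.2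
  -- `F (i + 1)` agrees with the weak derivative of order `i + 1`
  have hFae : ∀ i, ∀ hi : i + 1 < k + 1 + 1, ∀ᵐ x, x ∈ Ioo a b →
      F (i + 1) x = u.1 ⟨i + 1, hi⟩ x := by
    intro i hi
    by_cases h : i + 1 + 1 < k + 1 + 1
    · filter_upwards [hc (i + 1) h] with x hx hm
      rw [hx hm]
      simp only [hF, Nat.add_eq_zero_iff, one_ne_zero, and_false, if_false, dif_pos h]
    · refine Filter.Eventually.of_forall fun x _ => ?_
      have hik : i = k := by omega
      subst hik
      simp only [hF, Nat.add_eq_zero_iff, one_ne_zero, and_false, if_false, dif_neg h]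
      rfl
  have hFcongr : ∀ i, ∀ hi : i + 1 < k + 1 + 1, ∀ x ∈ Icc p q,
      ∫ s in p..x, F (i + 1) s = ∫ s in p..x, u.1 ⟨i + 1, hi⟩ s := by
    intro i hi x hx
    rw [intervalIntegral_eq_Ioo hx.1, intervalIntegral_eq_Ioo hx.1]
    refine setIntegral_congr_ae measurableSet_Ioo ?_
    filter_upwards [hFae i hi] with y hy hm
    exact hy (hsub ⟨hm.1, hm.2.trans_le hx.2⟩)
  have key := exists_poly_approx hpq k F (fun i hi => by
      have hi' : i + 1 < k + 1 + 1 := by omega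
      refine ((u.1 ⟨i + 1, hi'⟩).intervalIntegrable_sub hp hq).congr_ae ?_
      rw [uIoc_of_le hpq, ← restrict_Ioo_eq_restrict_Ioc, Filter.EventuallyEq,
        ae_restrict_iff' measurableSet_Ioo]
      filter_upwards [hFae i hi'] with y hy hm
      exact (hy (hsub hm)).symm) (fun i hi x hx => by
      have hi' : i + 1 < k + 1 + 1 := by omega
      rw [hFcongr i hi' x hx]
      by_cases h0 : i = 0
      · subst h0
        simp only [hF, if_true]
        exact traceCLM_sub u hp (hsubI hx)
      · simp only [hF, if_neg h0, dif_pos hi']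
        have hl : a ∈ Icc a b := left_mem_Icc.2 hab.le
        have := intervalIntegral.integral_add_adjacent_intervals
          ((u.1 ⟨i + 1, hi'⟩).intervalIntegrable_sub hl hp)
          ((u.1 ⟨i + 1, hi'⟩).intervalIntegrable_sub hp (hsubI hx))
        linarith)
  obtain ⟨w, hw, hb⟩ := key
  refine ⟨w, hw, fun x hx => ?_⟩
  have h := hb x hx
  have h0 : F 0 x = traceCLM x u := by simp [hF]
  have htop : F (k + 1) = topDeriv u := by
    funext y
    simp [hF]
  rwa [h0, htop] at h

/-- The error of the Gauss-Radau projection on one cell. -/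
theorem radau_error (k : ℕ) : ∃ C : ℝ, 0 < C ∧ ∀ (a b : ℝ) (_ : a < b) (u : Sobolev (k + 1) a b)
    (p q z : ℝ), p ∈ Icc a b → q ∈ Icc a b → p < q → (z = p ∨ z = q) →
    ∀ w ∈ Polynomial.degreeLE ℝ (k : WithBot ℕ),
    (∀ v ∈ Polynomial.degreeLT ℝ k, ∫ x in p..q, (w.eval x - traceCLM x u) * v.eval x = 0) →
    w.eval z = traceCLM z u →
    ∫ x in p..q, (traceCLM x u - w.eval x) ^ 2
      ≤ C * (q - p) ^ (2 * k + 2) * ∫ x in p..q, topDeriv u x ^ 2 := by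
  obtain ⟨C, hC, hstab⟩ := radau_stability k
  refine ⟨(1 + C) ^ 2, by positivity, ?_⟩
  intro a b hab u p q z hp hq hpq hz w hw hm hwz
  have hsubI : Icc p q ⊆ Icc a b := Icc_subset_Icc hp.1 hq.2
  obtain ⟨r, hr, hb⟩ := sobolev_poly_approx hab u hp hq hpq.le
  set B := (q - p) ^ k * ∫ s in p..q, |topDeriv u s| with hB
  have hcont : ContinuousOn (fun x => traceCLM x u) (Icc p q) :=
    (continuousOn_trace hab.le u).mono hsubI
  -- Gauss-Radau interpolation reproduces polynomials of degree at most `k`, so `w - r` interpolates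
  -- the remainder of the local approximation `r`, and stability bounds it by `C * B`.
  have hs := hstab p q z hpq hz (w - r) (Submodule.sub_mem _ hw hr)
    (fun x => traceCLM x u - r.eval x) B (hcont.sub r.continuous.continuousOn) hb
    (fun v hv => by
      rw [← hm v hv]
      congr 1; funext x
      rw [Polynomial.eval_sub]; ring) (by rw [Polynomial.eval_sub, hwz])
  have hpt : ∀ x ∈ Icc p q, (traceCLM x u - w.eval x) ^ 2 ≤ ((1 + C) * B) ^ 2 := by
    intro x hx
    have h1 := hb x hx
    have h2 := hs x hx
    rw [Polynomial.eval_sub] at h2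
    have h3 : |traceCLM x u - w.eval x| ≤ (1 + C) * B := by
      calc |traceCLM x u - w.eval x|
          = |(traceCLM x u - r.eval x) - (w.eval x - r.eval x)| := by ring_nf
        _ ≤ |traceCLM x u - r.eval x| + |w.eval x - r.eval x| := abs_sub _ _
        _ ≤ (1 + C) * B := by linarith
    rw [← sq_abs]
    gcongr
  have hsub : Ioo p q ⊆ Ioo a b := Ioo_subset_Ioo hp.1 hq.2
  have hi1 := (topDeriv u).intervalIntegrable_sub hp hq
  have hi2 : IntervalIntegrable (fun x => topDeriv u x ^ 2) volume p q :=
    (intervalIntegrable_iff_integrableOn_Ioo_of_le hpq.le).2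
      ((topDeriv u).integrableOn_sq.mono_set hsub)
  have hcs := sq_integral_abs_le hpq hi1 hi2
  have hli : ContinuousOn (fun x => (traceCLM x u - w.eval x) ^ 2) (uIcc p q) := by
    rw [uIcc_of_le hpq.le]
    exact (hcont.sub w.continuous.continuousOn).pow 2
  have hint : ∫ x in p..q, (traceCLM x u - w.eval x) ^ 2 ≤ ∫ _ in p..q, ((1 + C) * B) ^ 2 :=
    intervalIntegral.integral_mono_on hpq.le hli.intervalIntegrable intervalIntegrable_const hpt
  rw [intervalIntegral.integral_const, smul_eq_mul] at hint
  refine hint.trans ?_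
  have hh : 0 < q - p := sub_pos.2 hpq
  -- The cell length times `B²` gives the power `2k + 1`; Cauchy-Schwarz for the `L¹` norm of the
  -- top derivative supplies the last factor `q - p`.
  calc (q - p) * ((1 + C) * B) ^ 2
      = (1 + C) ^ 2 * (q - p) ^ (2 * k + 1) * (∫ s in p..q, |topDeriv u s|) ^ 2 := by
        rw [hB]; ring
    _ ≤ (1 + C) ^ 2 * (q - p) ^ (2 * k + 1) * ((q - p) * ∫ s in p..q, topDeriv u s ^ 2) := by
        gcongr
    _ = _ := by ring

end Approximation

/-! ### The mesh -/

section Mesh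

variable {a b : ℝ} {k M : ℕ}

theorem meshSize_pos [NeZero M] (hab : a < b) : 0 < meshSize a b M :=
  div_pos (sub_pos.2 hab) (by exact_mod_cast NeZero.pos M)

@[simp] theorem node_zero : node a b M 0 = a := by simp [node]

theorem node_last [NeZero M] : node a b M M = b := by
  have : (M : ℝ) ≠ 0 := by exact_mod_cast NeZero.ne M
  rw [node, meshSize, mul_div_cancel₀ _ this]; ring

theorem node_succ (i : ℕ) : node a b M (i + 1) = node a b M i + meshSize a b M := by
  simp only [node]; push_cast; ring

theorem node_lt [NeZero M] (hab : a < b) (i : ℕ) : node a b M i < node a b M (i + 1) := by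
  rw [node_succ]; linarith [meshSize_pos (M := M) hab]

theorem node_mono [NeZero M] (hab : a < b) : Monotone (node a b M) :=
  monotone_nat_of_le_succ fun i => (node_lt hab i).le

theorem node_mem [NeZero M] (hab : a < b) {i : ℕ} (hi : i ≤ M) : node a b M i ∈ Icc a b := by
  constructor
  · have := node_mono (M := M) hab (Nat.zero_le i)
    rwa [node_zero] at this
  · have := node_mono (M := M) hab hi
    rwa [node_last] at this

theorem node_left_mem [NeZero M] (hab : a < b) (j : Fin M) : node a b M j ∈ Icc a b :=
  node_mem hab j.2.le

theorem node_right_mem [NeZero M] (hab : a < b) (j : Fin M) : node a b M ((j : ℕ) + 1) ∈ Icc a b :=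
  node_mem hab j.2

/-- The interior of the cell `j`. -/
abbrev cell (a b : ℝ) {M : ℕ} (j : Fin M) : Set ℝ := Ioo (node a b M j) (node a b M ((j : ℕ) + 1))

theorem cell_subset [NeZero M] (hab : a < b) (j : Fin M) : cell a b j ⊆ Ioo a b :=
  Ioo_subset_Ioo (node_left_mem hab j).1 (node_right_mem hab j).2

theorem cellIntegral_eq [NeZero M] (hab : a < b) (j : Fin M) (f : ℝ → ℝ) :
    cellIntegral a b j f = ∫ x in cell a b j, f x :=
  intervalIntegral_eq_Ioo (node_lt hab _).le f

theorem cellIntegral_congr_ae [NeZero M] (hab : a < b) (j : Fin M) {f g : ℝ → ℝ}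
    (h : ∀ᵐ x, x ∈ cell a b j → f x = g x) : cellIntegral a b j f = cellIntegral a b j g := by
  rw [cellIntegral_eq hab, cellIntegral_eq hab]
  exact setIntegral_congr_ae measurableSet_Ioo h

theorem intervalIntegrable_cell [NeZero M] (hab : a < b) (j : Fin M) {f : ℝ → ℝ}
    (hf : IntegrableOn f (Ioo a b)) :
    IntervalIntegrable f volume (node a b M j) (node a b M ((j : ℕ) + 1)) :=
  (intervalIntegrable_iff_integrableOn_Ioo_of_le (node_lt hab _).le).2
    (hf.mono_set (cell_subset hab j))

theorem sum_cellIntegral [NeZero M] (hab : a < b) {f : ℝ → ℝ} (hf : IntegrableOn f (Ioo a b)) :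
    ∑ j : Fin M, cellIntegral a b j f = ∫ x in Ioo a b, f x := by
  simp only [cellIntegral]
  rw [Fin.sum_univ_eq_sum_range (fun i => ∫ x in node a b M i..node a b M (i + 1), f x),
    intervalIntegral.sum_integral_adjacent_intervals, node_zero, node_last,
    intervalIntegral_eq_Ioo hab.le]
  intro i hi
  exact intervalIntegrable_cell hab ⟨i, hi⟩ hf

theorem cell_disjoint [NeZero M] (hab : a < b) {i j : Fin M} (hij : i ≠ j) {x : ℝ}
    (hi : x ∈ cell a b i) : x ∉ cell a b j := by
  intro hj
  rcases lt_or_gt_of_ne hij with h | h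
  · have := node_mono (M := M) hab (Nat.succ_le_of_lt (Fin.lt_def.1 h))
    exact absurd (hi.2.trans_le this) (not_lt.2 hj.1.le)
  · have := node_mono (M := M) hab (Nat.succ_le_of_lt (Fin.lt_def.1 h))
    exact absurd (hj.2.trans_le this) (not_lt.2 hi.1.le)

/-- A piecewise polynomial as a function. -/
def DG.glue (a b : ℝ) (v : DG k M) (x : ℝ) : ℝ := ∑ j, (cell a b j).indicator (v.val j) x

theorem DG.continuous_val (v : DG k M) (j : Fin M) : Continuous (v.val j) :=
  (v j : ℝ[X]).continuous

theorem DG.memLp_glue (v : DG k M) : MemLp (v.glue a b) 2 (volume.restrict (Ioo a b)) :=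
  memLp_finsetSum _ fun j _ => memLp_indicator (v.continuous_val j) measurableSet_Ioo

theorem DG.glue_eq [NeZero M] (hab : a < b) (v : DG k M) {j : Fin M} {x : ℝ}
    (hx : x ∈ cell a b j) : v.glue a b x = v.val j x := by
  rw [DG.glue, Finset.sum_eq_single j, indicator_of_mem hx]
  · exact fun i _ hij => indicator_of_notMem (cell_disjoint hab hij.symm hx) _
  · exact fun h => absurd (Finset.mem_univ _) h

@[simp] theorem DG.val_add (v w : DG k M) (j : Fin M) (x : ℝ) :
    (v + w).val j x = v.val j x + w.val j x := by simp [DG.val]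

@[simp] theorem DG.val_sub (v w : DG k M) (j : Fin M) (x : ℝ) :
    (v - w).val j x = v.val j x - w.val j x := by simp [DG.val]

@[simp] theorem DG.val_smul (c : ℝ) (v : DG k M) (j : Fin M) (x : ℝ) :
    (c • v).val j x = c * v.val j x := by simp [DG.val]

/-- The embedding of `V_h` into `L²(Ω)`. -/
def DG.toL2 (a b : ℝ) (k M : ℕ) : DG k M →ₗ[ℝ] L2 a b where
  toFun v := v.memLp_glue.toLp (v.glue a b)
  map_add' v w := by
    rw [← MemLp.toLp_add]
    refine (MemLp.toLp_eq_toLp_iff _ _).2 (Filter.Eventually.of_forall fun x => ?_)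
    simp only [DG.glue, Pi.add_apply, ← Finset.sum_add_distrib]
    refine Finset.sum_congr rfl fun j _ => ?_
    by_cases hx : x ∈ cell a b j <;> simp [hx]
  map_smul' c v := by
    rw [RingHom.id_apply, ← MemLp.toLp_const_smul]
    refine (MemLp.toLp_eq_toLp_iff _ _).2 (Filter.Eventually.of_forall fun x => ?_)
    simp only [DG.glue, Pi.smul_apply, smul_eq_mul, Finset.mul_sum]
    refine Finset.sum_congr rfl fun j _ => ?_
    by_cases hx : x ∈ cell a b j <;> simp [hx]

theorem DG.toL2_ae [NeZero M] (hab : a < b) (v : DG k M) (j : Fin M) :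
    ∀ᵐ x, x ∈ cell a b j → DG.toL2 a b k M v x = v.val j x := by
  have h : DG.toL2 a b k M v =ᵐ[volume.restrict (Ioo a b)] v.glue a b := v.memLp_glue.coeFn_toLp
  rw [Filter.EventuallyEq, ae_restrict_iff' measurableSet_Ioo] at h
  filter_upwards [h] with x hx hm
  rw [hx (cell_subset hab j hm), v.glue_eq hab hm]

theorem L2.inner_eq_integral (u w : L2 a b) :
    inner ℝ u w = ∫ x in Ioo a b, u x * w x := by
  rw [L2.inner_def]
  congr 1; funext x
  exact mul_comm _ _

theorem L2.integrableOn_mul (u w : L2 a b) : IntegrableOn (fun x => u x * w x) (Ioo a b) :=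
  (Lp.memLp u).integrable_mul (Lp.memLp w)

theorem inner_toL2 [NeZero M] (hab : a < b) (u : L2 a b) (v : DG k M) :
    inner ℝ u (DG.toL2 a b k M v) = ∑ j, cellIntegral a b j fun x => u x * v.val j x := by
  rw [L2.inner_eq_integral, ← sum_cellIntegral (M := M) hab (u.integrableOn_mul _)]
  refine Finset.sum_congr rfl fun j _ => cellIntegral_congr_ae hab j ?_
  filter_upwards [v.toL2_ae hab j] with x hx hm
  rw [hx hm]

theorem inner_toL2_toL2 [NeZero M] (hab : a < b) (w v : DG k M) :
    inner ℝ (DG.toL2 a b k M w) (DG.toL2 a b k M v)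
      = ∑ j, cellIntegral a b j fun x => w.val j x * v.val j x := by
  rw [inner_toL2 hab]
  refine Finset.sum_congr rfl fun j _ => cellIntegral_congr_ae hab j ?_
  filter_upwards [w.toL2_ae hab j] with x hx hm
  rw [hx hm]

theorem errSq_eq [NeZero M] (hab : a < b) (u : L2 a b) (v : DG k M) :
    errSq u v = ‖u - DG.toL2 a b k M v‖ ^ 2 := by
  rw [← real_inner_self_eq_norm_sq, L2.inner_eq_integral,
    ← sum_cellIntegral (M := M) hab (L2.integrableOn_mul _ _), errSq]
  refine Finset.sum_congr rfl fun j _ => cellIntegral_congr_ae hab j ?_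
  have h : _ =ᵐ[volume.restrict (Ioo a b)] _ := Lp.coeFn_sub u (DG.toL2 a b k M v)
  rw [Filter.EventuallyEq, ae_restrict_iff' measurableSet_Ioo] at h
  filter_upwards [v.toL2_ae hab j, h] with x hx h' hm
  rw [h' (cell_subset hab j hm), Pi.sub_apply, hx hm]
  ring

end Mesh

/-! ### Gauss-Radau projections of Sobolev functions -/

section RadauOp

variable {a b : ℝ} {k m M : ℕ}

theorem radau_point (j : Fin M) (e : Fin 2) :
    node a b M ((j : ℕ) + e) = node a b M j ∨
      node a b M ((j : ℕ) + e) = node a b M ((j : ℕ) + 1) := by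
  fin_cases e
  · exact Or.inl rfl
  · exact Or.inr rfl

variable [NeZero M]

theorem radau_point_mem (hab : a < b) (j : Fin M) (e : Fin 2) :
    node a b M ((j : ℕ) + e) ∈ Icc a b :=
  node_mem hab (by omega)

/-- The moments on the cell `j` and the value at its left (`e = 0`) or right (`e = 1`) end. -/
def cellData (k : ℕ) (j : Fin M) (e : Fin 2) :
    Sobolev (m + 1) a b →L[ℝ] (Fin k → ℝ) × ℝ :=
  (ContinuousLinearMap.pi fun i : Fin k =>
    (pairing (memLp_indicator (φ := fun x => (Polynomial.X ^ (i : ℕ) : ℝ[X]).eval x)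
      (Polynomial.continuous _) (measurableSet_Ioo (a := node a b M j)
        (b := node a b M ((j : ℕ) + 1))))).comp (sobolevProj 0)).prod
    (traceCLM (node a b M ((j : ℕ) + e)))

/-- The piecewise polynomial with given Gauss-Radau data. -/
def radauSolve (hab : a < b) (k : ℕ) (e : Fin 2) : (Fin M → (Fin k → ℝ) × ℝ) →ₗ[ℝ] DG k M :=
  LinearMap.pi fun j => ((radauEquiv (node_lt hab j) (radau_point j e) k).symm.toLinearMap).comp
    (LinearMap.proj j)

/-- The Gauss-Radau projection: `𝒫⁺` for `e = 0`, `𝒫⁻` for `e = 1`. -/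
def radauOp (hab : a < b) (k : ℕ) (e : Fin 2) : Sobolev (m + 1) a b →ₗ[ℝ] DG k M :=
  (radauSolve hab k e).comp (ContinuousLinearMap.pi fun j : Fin M => cellData k j e).toLinearMap

/-- The Gauss-Radau projection as a bounded operator into `L²(Ω)`. -/
def radauCLM (M : ℕ) [NeZero M] (hab : a < b) (k : ℕ) (e : Fin 2) :
    Sobolev (m + 1) a b →L[ℝ] L2 a b :=
  -- The solution map starts from a finite-dimensional space and is therefore continuous.
  -- Boundedness is what lets the projection commute with the time derivative of `E` and `H`.
  (LinearMap.toContinuousLinearMap ((DG.toL2 a b k M).comp (radauSolve hab k e))).comp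
    (ContinuousLinearMap.pi fun j : Fin M => cellData k j e)

theorem radauCLM_apply (hab : a < b) (e : Fin 2) (u : Sobolev (m + 1) a b) :
    radauCLM M hab k e u = DG.toL2 a b k M (radauOp hab k e u) := rfl

theorem radauData_radauOp (hab : a < b) (e : Fin 2) (u : Sobolev (m + 1) a b) (j : Fin M) :
    radauData (node a b M j) (node a b M ((j : ℕ) + 1)) (node a b M ((j : ℕ) + e)) k
      (radauOp hab k e u j) = cellData k j e u :=
  (radauEquiv (node_lt hab j) (radau_point j e) k).apply_symm_apply _

theorem cellIntegral_trace (hab : a < b) (u : Sobolev (m + 1) a b) (j : Fin M) (g : ℝ → ℝ) :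
    cellIntegral a b j (fun x => traceCLM x u * g x) = cellIntegral a b j fun x => fn u x * g x := by
  refine cellIntegral_congr_ae hab j ?_
  have h := (isContinuousRep_trace hab u).2
  rw [Filter.EventuallyEq, ae_restrict_iff' measurableSet_Ioo] at h
  filter_upwards [h] with x hx hm
  rw [hx (cell_subset hab j hm)]

theorem continuousOn_trace_cell (hab : a < b) (u : Sobolev (m + 1) a b) (j : Fin M) :
    ContinuousOn (fun x => traceCLM x u) (uIcc (node a b M j) (node a b M ((j : ℕ) + 1))) :=
  (continuousOn_trace hab.le u).mono
    (uIcc_subset_Icc (node_left_mem hab j) (node_right_mem hab j))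

theorem radauOp_trace (hab : a < b) (e : Fin 2) (u : Sobolev (m + 1) a b) (j : Fin M) :
    (radauOp hab k e u).val j (node a b M ((j : ℕ) + e))
      = traceCLM (node a b M ((j : ℕ) + e)) u :=
  congrArg Prod.snd (radauData_radauOp (k := k) hab e u j)

theorem radauOp_moment (hab : a < b) (e : Fin 2) (u : Sobolev (m + 1) a b) (j : Fin M) {v : ℝ[X]}
    (hv : v ∈ Polynomial.degreeLT ℝ k) :
    cellIntegral a b j (fun x => ((radauOp hab k e u).val j x - traceCLM x u) * v.eval x) = 0 := by
  have hc := continuousOn_trace_cell hab u j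
  refine integral_mul_eq_zero_of_monomials
    (g := fun x => (radauOp hab k e u).val j x - traceCLM x u)
    (((radauOp hab k e u).continuous_val j).continuousOn.sub hc) (fun i => ?_) hv
  have h : cellIntegral a b j (fun x => (radauOp hab k e u).val j x
        * (Polynomial.X ^ (i : ℕ) : ℝ[X]).eval x) = _ :=
    congrFun (congrArg Prod.fst (radauData_radauOp (k := k) hab e u j)) i
  have h' : (cellData k j e u).1 i = cellIntegral a b j
      (fun x => fn u x * (Polynomial.X ^ (i : ℕ) : ℝ[X]).eval x) :=
    pairing_indicator (φ := fun x => (Polynomial.X ^ (i : ℕ) : ℝ[X]).eval x)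
      (Polynomial.continuous _) (node_lt hab j).le (node_left_mem hab j).1
      (node_right_mem hab j).2 (fn u)
  rw [h', ← cellIntegral_trace hab] at h
  have hsplit : (fun x => ((radauOp hab k e u).val j x - traceCLM x u)
        * (Polynomial.X ^ (i : ℕ) : ℝ[X]).eval x)
      = fun x => (radauOp hab k e u).val j x * (Polynomial.X ^ (i : ℕ) : ℝ[X]).eval x
        - traceCLM x u * (Polynomial.X ^ (i : ℕ) : ℝ[X]).eval x := by
    funext x; ring
  have hi1 : IntervalIntegrable (fun x => (radauOp hab k e u).val j x
      * (Polynomial.X ^ (i : ℕ) : ℝ[X]).eval x) volume (node a b M j) (node a b M ((j : ℕ) + 1)) :=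
    (((radauOp hab k e u).continuous_val j).mul (Polynomial.continuous _)).intervalIntegrable _ _
  have hi2 : IntervalIntegrable (fun x => traceCLM x u * (Polynomial.X ^ (i : ℕ) : ℝ[X]).eval x)
      volume (node a b M j) (node a b M ((j : ℕ) + 1)) :=
    (hc.mul (Polynomial.continuous _).continuousOn).intervalIntegrable
  rw [hsplit, intervalIntegral.integral_sub hi1 hi2]
  exact sub_eq_zero.2 h

/-- Used to identify the prescribed initial data, given through continuous representatives, with the
operator `radauOp`. -/
theorem radauOp_unique (hab : a < b) (e : Fin 2) (u : Sobolev (m + 1) a b) {φ : ℝ → ℝ}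
    (hφ : ∀ x ∈ Icc a b, φ x = traceCLM x u) {w : DG k M}
    (h1 : ∀ j : Fin M, ∀ v ∈ Polynomial.degreeLT ℝ k,
      cellIntegral a b j (fun x => (w.val j x - φ x) * v.eval x) = 0)
    (h2 : ∀ j : Fin M, w.val j (node a b M ((j : ℕ) + e)) = φ (node a b M ((j : ℕ) + e))) :
    w = radauOp hab k e u := by
  funext j
  have hc := continuousOn_trace_cell hab u j
  have hsub : uIcc (node a b M j) (node a b M ((j : ℕ) + 1)) ⊆ Icc a b :=
    uIcc_subset_Icc (node_left_mem hab j) (node_right_mem hab j)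
  rw [← sub_eq_zero]
  refine Subtype.ext ?_
  refine radau_unique (node_lt hab j) (radau_point j e) (Subtype.property _) (fun v hv => ?_) ?_
  · have e1 := h1 j v hv
    have e2 := radauOp_moment hab e u j hv
    have e3 : cellIntegral a b j (fun x => (w.val j x - φ x) * v.eval x)
        = cellIntegral a b j (fun x => (w.val j x - traceCLM x u) * v.eval x) :=
      intervalIntegral.integral_congr fun x hx => by simp only [hφ x (hsub hx)]
    rw [e3] at e1
    have i1 : IntervalIntegrable (fun x => (w.val j x - traceCLM x u) * v.eval x) volume
        (node a b M j) (node a b M ((j : ℕ) + 1)) :=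
      (((w.continuous_val j).continuousOn.sub hc).mul v.continuous.continuousOn).intervalIntegrable
    have i2 : IntervalIntegrable (fun x => ((radauOp hab k e u).val j x - traceCLM x u) * v.eval x)
        volume (node a b M j) (node a b M ((j : ℕ) + 1)) :=
      ((((radauOp hab k e u).continuous_val j).continuousOn.sub hc).mul
        v.continuous.continuousOn).intervalIntegrable
    have := intervalIntegral.integral_sub i1 i2
    rw [show (∫ x in node a b M j..node a b M ((j : ℕ) + 1),
      (w.val j x - traceCLM x u) * v.eval x) = 0 from e1,
      show (∫ x in node a b M j..node a b M ((j : ℕ) + 1),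
      ((radauOp hab k e u).val j x - traceCLM x u) * v.eval x) = 0 from e2, sub_zero] at this
    rw [← this]
    congr 1; funext x
    simp only [DG.val, Submodule.coe_sub, Polynomial.eval_sub]
    ring
  · have e1 := h2 j
    rw [hφ _ (radau_point_mem hab j e), ← radauOp_trace (k := k) hab e u j] at e1
    simp only [DG.val] at e1
    simp only [Submodule.coe_sub, Polynomial.eval_sub, e1, sub_self]

/-- The squared cell errors add up to the squared norm of the top derivative, because the constant
of `radau_error` is the same for every cell. -/
theorem radauOp_error (k : ℕ) : ∃ C : ℝ, 0 < C ∧ ∀ (a b : ℝ) (hab : a < b) (M : ℕ) [NeZero M]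
    (e : Fin 2) (u : Sobolev (k + 1) a b),
    ‖fn u - radauCLM M hab k e u‖ ≤ C * meshSize a b M ^ (k + 1) * ‖u‖ := by
  obtain ⟨C, hC, h⟩ := radau_error k
  refine ⟨√C, Real.sqrt_pos.2 hC, ?_⟩
  intro a b hab M _ e u
  have hh := (meshSize_pos (M := M) hab).le
  refine le_of_sq_le_sq ?_ (by positivity)
  rw [radauCLM_apply, ← errSq_eq hab, errSq]
  have hcell : ∀ j : Fin M, cellIntegral a b j
      (fun x => (fn u x - (radauOp hab k e u).val j x) ^ 2)
      ≤ C * meshSize a b M ^ (2 * k + 2) * cellIntegral a b j fun x => topDeriv u x ^ 2 := by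
    intro j
    have h1 : cellIntegral a b j (fun x => (fn u x - (radauOp hab k e u).val j x) ^ 2)
        = cellIntegral a b j (fun x => (traceCLM x u - (radauOp hab k e u).val j x) ^ 2) := by
      refine cellIntegral_congr_ae hab j ?_
      have h := (isContinuousRep_trace hab u).2
      rw [Filter.EventuallyEq, ae_restrict_iff' measurableSet_Ioo] at h
      filter_upwards [h] with x hx hm
      rw [hx (cell_subset hab j hm)]
    have h2 := h a b hab u _ _ _ (node_left_mem hab j) (node_right_mem hab j) (node_lt hab j)
      (radau_point j e) (radauOp hab k e u j : ℝ[X]) (radauOp hab k e u j).2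
      (fun v hv => radauOp_moment hab e u j hv) (radauOp_trace hab e u j)
    rw [node_succ, add_sub_cancel_left] at h2
    rw [h1, cellIntegral, cellIntegral, node_succ]
    exact h2
  calc ∑ j : Fin M, cellIntegral a b j (fun x => (fn u x - (radauOp hab k e u).val j x) ^ 2)
      ≤ ∑ j : Fin M, C * meshSize a b M ^ (2 * k + 2)
        * cellIntegral a b j fun x => topDeriv u x ^ 2 := Finset.sum_le_sum fun j _ => hcell j
    _ = C * meshSize a b M ^ (2 * k + 2) * ‖topDeriv u‖ ^ 2 := by
        rw [← Finset.mul_sum, sum_cellIntegral hab (topDeriv u).integrableOn_sq,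
          ← real_inner_self_eq_norm_sq, L2.inner_eq_integral]
        simp only [sq]
    _ ≤ C * meshSize a b M ^ (2 * k + 2) * ‖u‖ ^ 2 := by
        have := norm_sobolev_apply_le u (Fin.last (k + 1))
        gcongr
        exact this
    _ = _ := by
        rw [mul_pow, mul_pow, Real.sq_sqrt hC.le]; ring

end RadauOp

/-! ### The spatial discretization -/

section Discretization

variable {a b : ℝ} {k m M : ℕ} [NeZero M]

/-- The index `j + 1` is cyclic: at the last cell it points to the node `a` instead of `b`, where
periodicity identifies the traces. -/
theorem trace_node_succ (u : Sobolev (m + 1) a b) (hu : traceCLM a u = traceCLM b u)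
    (j : Fin M) : traceCLM (node a b M ((j + 1 : Fin M) : ℕ)) u
      = traceCLM (node a b M ((j : ℕ) + 1)) u := by
  obtain ⟨n, rfl⟩ : ∃ n, M = n + 1 := ⟨M - 1, by have := NeZero.pos M; omega⟩
  by_cases hj : j = Fin.last n
  · subst hj
    have h0 : ((Fin.last n + 1 : Fin (n + 1)) : ℕ) = 0 := by simp
    rw [h0, node_zero, Fin.val_last, node_last, hu]
  · rw [Fin.val_add_one_of_lt (Fin.lt_last_iff_ne_last.2 hj)]

/-- The semi-discrete form of `-∂ₓ`. -/
def weakForm (a b : ℝ) (w : DG k M) (F : Fin M → ℝ) (v : DG k M) : ℝ :=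
  ∑ j : Fin M, (cellIntegral a b j (fun x => w.val j x * (v j : ℝ[X]).derivative.eval x)
    - F j * v.val j (node a b M ((j : ℕ) + 1)) + F (j - 1) * v.val j (node a b M j))

/-- Summation by parts: a cyclic shift of the index collects both contributions of a flux at its
node, which turns them into a jump of the test function. -/
theorem weakForm_eq (w : DG k M) (F : Fin M → ℝ) (v : DG k M) :
    weakForm a b w F v = ∑ j : Fin M,
      (cellIntegral a b j (fun x => w.val j x * (v j : ℝ[X]).derivative.eval x)
        + F j * jump a b v j) := by
  have h : ∑ j : Fin M, F (j - 1) * v.val j (node a b M j) = ∑ j : Fin M, F j * trPlus a b v j := by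
    rw [← Equiv.sum_comp (Equiv.addRight (1 : Fin M)) fun j => F (j - 1) * v.val j (node a b M j)]
    simp [trPlus]
  rw [weakForm, Finset.sum_add_distrib, h, ← Finset.sum_add_distrib]
  refine Finset.sum_congr rfl fun j _ => ?_
  rw [jump, trMinus]; ring

theorem weakForm_sub (w w' : DG k M) (F F' : Fin M → ℝ) (v : DG k M) :
    weakForm a b (w - w') (F - F') v = weakForm a b w F v - weakForm a b w' F' v := by
  simp only [weakForm]
  rw [← Finset.sum_sub_distrib]
  refine Finset.sum_congr rfl fun j _ => ?_
  have : cellIntegral a b j (fun x => (w - w').val j x * (v j : ℝ[X]).derivative.eval x)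
      = cellIntegral a b j (fun x => w.val j x * (v j : ℝ[X]).derivative.eval x)
        - cellIntegral a b j (fun x => w'.val j x * (v j : ℝ[X]).derivative.eval x) := by
    simp only [DG.val_sub, sub_mul]
    exact intervalIntegral.integral_sub
      (((w.continuous_val j).mul (Polynomial.continuous _)).intervalIntegrable _ _)
      (((w'.continuous_val j).mul (Polynomial.continuous _)).intervalIntegrable _ _)
  rw [this]
  simp only [Pi.sub_apply]
  ring

theorem fluxE_sub (c : Medium) (E E' H H' : DG k M) :
    fluxE c a b (E - E') (H - H') = fluxE c a b E H - fluxE c a b E' H' := by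
  funext j
  simp only [fluxE, avg, jump, trPlus, trMinus, DG.val_sub, Pi.sub_apply]
  ring

theorem fluxH_sub (c : Medium) (E E' H H' : DG k M) :
    fluxH c a b (E - E') (H - H') = fluxH c a b E H - fluxH c a b E' H' := by
  funext j
  simp only [fluxH, avg, jump, trPlus, trMinus, DG.val_sub, Pi.sub_apply]
  ring

/-- The upwind flux dissipates energy. -/
theorem upwind_nonneg (c : Medium) (E H : DG k M) :
    0 ≤ weakForm a b E (fluxE c a b E H) H + weakForm a b H (fluxH c a b E H) E := by
  have hcell : ∀ j : Fin M, cellIntegral a b j (fun x => E.val j x * (H j : ℝ[X]).derivative.eval x)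
      + cellIntegral a b j (fun x => H.val j x * (E j : ℝ[X]).derivative.eval x)
      = trMinus a b E j * trMinus a b H j
        - E.val j (node a b M j) * H.val j (node a b M j) := by
    intro j
    have hi1 : IntervalIntegrable (fun x => E.val j x * (H j : ℝ[X]).derivative.eval x) volume
        (node a b M j) (node a b M ((j : ℕ) + 1)) :=
      ((E.continuous_val j).mul (Polynomial.continuous _)).intervalIntegrable _ _
    have hi2 : IntervalIntegrable (fun x => H.val j x * (E j : ℝ[X]).derivative.eval x) volume
        (node a b M j) (node a b M ((j : ℕ) + 1)) :=
      ((H.continuous_val j).mul (Polynomial.continuous _)).intervalIntegrable _ _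
    rw [cellIntegral, cellIntegral, ← intervalIntegral.integral_add hi1 hi2]
    have := intervalIntegral.integral_eq_sub_of_hasDerivAt
      (f := fun x => E.val j x * H.val j x) (a := node a b M j) (b := node a b M ((j : ℕ) + 1))
      (fun x _ => ((E j : ℝ[X]).hasDerivAt x).mul ((H j : ℝ[X]).hasDerivAt x))
      ((((Polynomial.continuous _).mul (H.continuous_val j)).add
        ((E.continuous_val j).mul (Polynomial.continuous _))).intervalIntegrable _ _)
    rw [trMinus, trMinus, ← this]
    congr 1; funext x
    simp only [DG.val]; ring
  have hshift : ∑ j : Fin M, E.val j (node a b M j) * H.val j (node a b M j)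
      = ∑ j : Fin M, trPlus a b E j * trPlus a b H j := by
    rw [← Equiv.sum_comp (Equiv.addRight (1 : Fin M)) fun j =>
      E.val j (node a b M j) * H.val j (node a b M j)]
    simp [trPlus]
  -- The cell integrals add up to minus the jumps of the product `E H`, and `[E H] = {E}[H] +
  -- {H}[E]` cancels the averages in the fluxes. Only the squared jumps of the upwind terms remain.
  have hsum : weakForm a b E (fluxE c a b E H) H + weakForm a b H (fluxH c a b E H) E
      = ∑ j : Fin M, (1 / 2 * √(c.μ₀ / (c.ε₀ * c.εinf)) * jump a b H j ^ 2
        + 1 / 2 * √(c.ε₀ * c.εinf / c.μ₀) * jump a b E j ^ 2) := by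
    rw [weakForm_eq, weakForm_eq, ← Finset.sum_add_distrib]
    calc _ = ∑ j : Fin M, ((trMinus a b E j * trMinus a b H j
            + fluxE c a b E H j * jump a b H j + fluxH c a b E H j * jump a b E j)
            - E.val j (node a b M j) * H.val j (node a b M j)) := by
          refine Finset.sum_congr rfl fun j _ => ?_
          linarith [hcell j]
      _ = _ := by
          rw [Finset.sum_sub_distrib, hshift, ← Finset.sum_sub_distrib]
          refine Finset.sum_congr rfl fun j _ => ?_
          simp only [fluxE, fluxH, avg, jump]
          ring
  rw [hsum]
  exact Finset.sum_nonneg fun j _ => by positivity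

theorem derivative_mem_degreeLT {v : ℝ[X]} (hv : v ∈ Polynomial.degreeLE ℝ (k : WithBot ℕ)) :
    v.derivative ∈ Polynomial.degreeLT ℝ k := by
  rw [Polynomial.mem_degreeLT]
  by_cases h0 : v = 0
  · subst h0; simp
  · exact (Polynomial.degree_derivative_lt h0).trans_le (Polynomial.mem_degreeLE.1 hv)

/-- Consistency of the semi-discrete form with `-∂ₓ`. -/
theorem weakForm_consistent (hab : a < b) (u : Sobolev (m + 1) a b)
    (hu : traceCLM a u = traceCLM b u) {w : DG k M} {F : Fin M → ℝ}
    (hw : ∀ j : Fin M, ∀ v ∈ Polynomial.degreeLT ℝ k,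
      cellIntegral a b j (fun x => w.val j x * v.eval x)
        = cellIntegral a b j (fun x => traceCLM x u * v.eval x))
    (hF : ∀ j, F j = traceCLM (node a b M ((j : ℕ) + 1)) u) (v : DG k M) :
    weakForm a b w F v = -inner ℝ (dx u) (DG.toL2 a b k M v) := by
  rw [inner_toL2 hab, weakForm, ← Finset.sum_neg_distrib]
  refine Finset.sum_congr rfl fun j _ => ?_
  have hF' : F (j - 1) = traceCLM (node a b M j) u := by
    rw [hF, ← trace_node_succ u hu, sub_add_cancel]
  -- The derivative of the test function has degree less than `k`, so the Gauss-Radau moments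
  -- suffice to replace `w` by the exact function.
  rw [hF, hF', hw j _ (derivative_mem_degreeLT (v j).2)]
  set p := node a b M j with hp
  set q := node a b M ((j : ℕ) + 1) with hq
  have hpm : p ∈ Icc a b := node_left_mem hab j
  have hqm : q ∈ Icc a b := node_right_mem hab j
  have hG : AbsolutelyContinuousOnInterval (fun x => ∫ s in p..x, dx u s) p q :=
    ((dx u).intervalIntegrable_sub hpm hqm).absolutelyContinuousOnInterval_intervalIntegral
      left_mem_uIcc
  have hv : AbsolutelyContinuousOnInterval (fun x => (v j : ℝ[X]).eval x) p q :=
    ContDiffOn.absolutelyContinuousOnInterval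
      (by simpa using ((v j : ℝ[X]).contDiff_aeval (𝕜 := ℝ) 1).contDiffOn)
  have hparts := hG.integral_mul_deriv_eq_deriv_mul hv
  have hcongr : ∫ x in p..q, deriv (fun x => ∫ s in p..x, dx u s) x * (v j : ℝ[X]).eval x
      = cellIntegral a b j (fun x => dx u x * v.val j x) := by
    rw [cellIntegral]
    refine intervalIntegral.integral_congr_ae ?_
    filter_upwards [((dx u).intervalIntegrable_sub hpm hqm).ae_hasDerivAt_integral] with x hx hm
    rw [(hx (uIoc_subset_uIcc hm) p left_mem_uIcc).deriv]
    rfl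
  have htr : cellIntegral a b j (fun x => traceCLM x u * (v j : ℝ[X]).derivative.eval x)
      = traceCLM p u * (∫ x in p..q, (v j : ℝ[X]).derivative.eval x)
        + ∫ x in p..q, (∫ s in p..x, dx u s) * (v j : ℝ[X]).derivative.eval x := by
    have hi1 : IntervalIntegrable (fun x => traceCLM p u * (v j : ℝ[X]).derivative.eval x)
        volume p q := (continuous_const.mul (Polynomial.continuous _)).intervalIntegrable _ _
    have hi2 : IntervalIntegrable
        (fun x => (∫ s in p..x, dx u s) * (v j : ℝ[X]).derivative.eval x) volume p q :=
      (hG.continuousOn.mul (Polynomial.continuous _).continuousOn).intervalIntegrable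
    rw [← intervalIntegral.integral_const_mul, ← intervalIntegral.integral_add hi1 hi2]
    refine intervalIntegral.integral_congr fun x hx => ?_
    have hxm : x ∈ Icc a b := uIcc_subset_Icc hpm hqm hx
    simp only [traceCLM_sub u hpm hxm]
    ring
  have hder : ∫ x in p..q, (v j : ℝ[X]).derivative.eval x
      = (v j : ℝ[X]).eval q - (v j : ℝ[X]).eval p :=
    intervalIntegral.integral_eq_sub_of_hasDerivAt (f := fun x => (v j : ℝ[X]).eval x)
      (fun x _ => (v j : ℝ[X]).hasDerivAt x) ((Polynomial.continuous _).intervalIntegrable _ _)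
  have hd : ∀ x, deriv (fun x => (v j : ℝ[X]).eval x) x = (v j : ℝ[X]).derivative.eval x :=
    fun x => (v j : ℝ[X]).deriv
  simp only [hd] at hparts
  rw [hcongr] at hparts
  rw [htr, hparts, hder, traceCLM_sub u hpm hqm]
  simp only [intervalIntegral.integral_same, DG.val]
  ring

end Discretization

/-! ### The projections of the fields -/

section FieldProjection

variable {a b : ℝ} {k m M : ℕ} [NeZero M]

/-- The impedance `√(μ₀/(ε₀ε∞))`. -/
def Medium.imp (c : Medium) : ℝ := √(c.μ₀ / (c.ε₀ * c.εinf))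

theorem Medium.imp_pos (c : Medium) : 0 < c.imp :=
  Real.sqrt_pos.2 (div_pos c.μ₀_pos (mul_pos c.ε₀_pos c.εinf_pos))

theorem Medium.sqrt_inv (c : Medium) : √(c.ε₀ * c.εinf / c.μ₀) = c.imp⁻¹ := by
  rw [Medium.imp, ← Real.sqrt_inv, inv_div]

/-- The projection of the electric field. -/
def projE (c : Medium) (hab : a < b) (u w : Sobolev (m + 1) a b) : DG k M :=
  (1 / 2 : ℝ) • radauOp hab k 0 (u + c.imp • w) + (1 / 2 : ℝ) • radauOp hab k 1 (u - c.imp • w)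

/-- The projection of the magnetic field. -/
def projH (c : Medium) (hab : a < b) (u w : Sobolev (m + 1) a b) : DG k M :=
  -- Half the difference of the characteristic variables is `c.imp • w`. Both fields are recovered
  -- from the same two projected variables, so their traces fit together in the fluxes.
  (c.imp⁻¹ / 2) • radauOp hab k 0 (u + c.imp • w) - (c.imp⁻¹ / 2) • radauOp hab k 1 (u - c.imp • w)

theorem eq_projE (c : Medium) (hab : a < b) (u w : Sobolev (m + 1) a b) {E₀ H₀ : ℝ → ℝ}
    (hE : IsContinuousRep (fn u) E₀) (hH : IsContinuousRep (fn w) H₀) {v : DG k M}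
    (hv : IsProjE c a b E₀ H₀ v) : v = projE c hab u w := by
  obtain ⟨p, q, hp, hq, rfl⟩ := hv
  have hE' := fun x hx => hE.eqOn hab (isContinuousRep_trace hab u) (x := x) hx
  have hH' := fun x hx => hH.eqOn hab (isContinuousRep_trace hab w) (x := x) hx
  have e1 : p = radauOp hab k 0 (u + c.imp • w) :=
    radauOp_unique hab 0 _ (fun x hx => by
      simp only [map_add, map_smul, smul_eq_mul, hE' x hx, hH' x hx, Medium.imp])
      (fun j => (hp j).1) (fun j => (hp j).2)
  have e2 : q = radauOp hab k 1 (u - c.imp • w) :=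
    radauOp_unique hab 1 _ (fun x hx => by
      simp only [map_sub, map_smul, smul_eq_mul, hE' x hx, hH' x hx, Medium.imp])
      (fun j => (hq j).1) (fun j => (hq j).2)
  rw [e1, e2, projE]

/-- `H ± Z⁻¹ E` equals `± Z⁻¹ (E ± Z H)` with `Z = c.imp`, so linearity reduces the definition in
the statement to the characteristic variables of `projE`. -/
theorem eq_projH (c : Medium) (hab : a < b) (u w : Sobolev (m + 1) a b) {E₀ H₀ : ℝ → ℝ}
    (hE : IsContinuousRep (fn u) E₀) (hH : IsContinuousRep (fn w) H₀) {v : DG k M}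
    (hv : IsProjH c a b E₀ H₀ v) : v = projH c hab u w := by
  obtain ⟨p, q, hp, hq, rfl⟩ := hv
  have hE' := fun x hx => hE.eqOn hab (isContinuousRep_trace hab u) (x := x) hx
  have hH' := fun x hx => hH.eqOn hab (isContinuousRep_trace hab w) (x := x) hx
  have hi := c.imp_pos.ne'
  have e1 : p = radauOp hab k 0 (c.imp⁻¹ • (u + c.imp • w)) :=
    radauOp_unique hab 0 _ (fun x hx => by
      simp only [map_add, map_smul, smul_eq_mul, hE' x hx, hH' x hx, c.sqrt_inv]
      field_simp
      ring)
      (fun j => (hp j).1) (fun j => (hp j).2)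
  have e2 : q = radauOp hab k 1 (-(c.imp⁻¹ • (u - c.imp • w))) :=
    radauOp_unique hab 1 _ (fun x hx => by
      simp only [map_sub, map_neg, map_smul, smul_eq_mul, hE' x hx, hH' x hx, c.sqrt_inv]
      field_simp
      ring)
      (fun j => (hq j).1) (fun j => (hq j).2)
  rw [e1, e2, projH, map_neg, map_smul, map_smul]
  module

theorem projE_moment (c : Medium) (hab : a < b) (u w : Sobolev (m + 1) a b) (j : Fin M) {v : ℝ[X]}
    (hv : v ∈ Polynomial.degreeLT ℝ k) :
    cellIntegral a b j (fun x => (projE c hab u w : DG k M).val j x * v.eval x)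
      = cellIntegral a b j (fun x => traceCLM x u * v.eval x) := by
  have h0 := radauOp_moment hab 0 (u + c.imp • w) j hv
  have h1 := radauOp_moment hab 1 (u - c.imp • w) j hv
  have hi : ∀ (e : Fin 2) (y : Sobolev (m + 1) a b), IntervalIntegrable
      (fun x => ((radauOp hab k e y).val j x - traceCLM x y) * v.eval x) volume
      (node a b M j) (node a b M ((j : ℕ) + 1)) := fun e y =>
    (((DG.continuous_val _ j).continuousOn.sub (continuousOn_trace_cell hab y j)).mul
      v.continuous.continuousOn).intervalIntegrable
  rw [cellIntegral] at h0 h1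
  have hi1 : IntervalIntegrable (fun x => traceCLM x u * v.eval x) volume
      (node a b M j) (node a b M ((j : ℕ) + 1)) :=
    ((continuousOn_trace_cell hab u j).mul v.continuous.continuousOn).intervalIntegrable
  have hi2 : IntervalIntegrable (fun x => (projE c hab u w : DG k M).val j x * v.eval x) volume
      (node a b M j) (node a b M ((j : ℕ) + 1)) :=
    ((DG.continuous_val _ j).mul v.continuous).intervalIntegrable _ _
  rw [← sub_eq_zero, cellIntegral, cellIntegral, ← intervalIntegral.integral_sub hi2 hi1]
  have := congrArg₂ (fun r s : ℝ => 1 / 2 * r + 1 / 2 * s) h0 h1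
  simp only [mul_zero, add_zero] at this
  rw [← intervalIntegral.integral_const_mul, ← intervalIntegral.integral_const_mul,
    ← intervalIntegral.integral_add ((hi _ _).const_mul _) ((hi _ _).const_mul _)] at this
  rw [← this]
  congr 1; funext x
  simp only [projE, DG.val_add, DG.val_smul, map_add, map_sub, map_smul, smul_eq_mul]
  ring

theorem projH_moment (c : Medium) (hab : a < b) (u w : Sobolev (m + 1) a b) (j : Fin M) {v : ℝ[X]}
    (hv : v ∈ Polynomial.degreeLT ℝ k) :
    cellIntegral a b j (fun x => (projH c hab u w : DG k M).val j x * v.eval x)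
      = cellIntegral a b j (fun x => traceCLM x w * v.eval x) := by
  have h0 := radauOp_moment hab 0 (u + c.imp • w) j hv
  have h1 := radauOp_moment hab 1 (u - c.imp • w) j hv
  have hi : ∀ (e : Fin 2) (y : Sobolev (m + 1) a b), IntervalIntegrable
      (fun x => ((radauOp hab k e y).val j x - traceCLM x y) * v.eval x) volume
      (node a b M j) (node a b M ((j : ℕ) + 1)) := fun e y =>
    (((DG.continuous_val _ j).continuousOn.sub (continuousOn_trace_cell hab y j)).mul
      v.continuous.continuousOn).intervalIntegrable
  rw [cellIntegral] at h0 h1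
  have hi1 : IntervalIntegrable (fun x => traceCLM x w * v.eval x) volume
      (node a b M j) (node a b M ((j : ℕ) + 1)) :=
    ((continuousOn_trace_cell hab w j).mul v.continuous.continuousOn).intervalIntegrable
  have hi2 : IntervalIntegrable (fun x => (projH c hab u w : DG k M).val j x * v.eval x) volume
      (node a b M j) (node a b M ((j : ℕ) + 1)) :=
    ((DG.continuous_val _ j).mul v.continuous).intervalIntegrable _ _
  rw [← sub_eq_zero, cellIntegral, cellIntegral, ← intervalIntegral.integral_sub hi2 hi1]
  have := congrArg₂ (fun r s : ℝ => c.imp⁻¹ / 2 * r - c.imp⁻¹ / 2 * s) h0 h1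
  simp only [mul_zero, sub_zero] at this
  rw [← intervalIntegral.integral_const_mul, ← intervalIntegral.integral_const_mul,
    ← intervalIntegral.integral_sub ((hi _ _).const_mul _) ((hi _ _).const_mul _)] at this
  rw [← this]
  congr 1; funext x
  have hi := c.imp_pos.ne'
  simp only [projH, DG.val_sub, DG.val_smul, map_add, map_sub, map_smul, smul_eq_mul]
  field_simp
  ring

theorem trPlus_radauOp (hab : a < b) (u : Sobolev (m + 1) a b) (hu : traceCLM a u = traceCLM b u)
    (j : Fin M) : trPlus a b (radauOp hab k 0 u) j = traceCLM (node a b M ((j : ℕ) + 1)) u := by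
  rw [← trace_node_succ u hu]
  exact radauOp_trace hab 0 u (j + 1)

theorem trMinus_radauOp (hab : a < b) (u : Sobolev (m + 1) a b) (j : Fin M) :
    trMinus a b (radauOp hab k 1 u) j = traceCLM (node a b M ((j : ℕ) + 1)) u :=
  radauOp_trace hab 1 u j

/-- The upwind flux of `E` is half the sum of `(E + ZH)⁺` and `(E - ZH)⁻`. For the projections these
are the one-sided traces at which `𝒫⁺` and `𝒫⁻` are exact. -/
theorem fluxE_proj (c : Medium) (hab : a < b) (u w : Sobolev (m + 1) a b)
    (hu : traceCLM a u = traceCLM b u) (hw : traceCLM a w = traceCLM b w) (j : Fin M) :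
    fluxE c a b (projE c hab u w : DG k M) (projH c hab u w) j
      = traceCLM (node a b M ((j : ℕ) + 1)) u := by
  have h0 := trPlus_radauOp (k := k) hab (u + c.imp • w)
    (by simp only [map_add, map_smul, hu, hw]) j
  have h1 := trMinus_radauOp (k := k) hab (u - c.imp • w) j
  simp only [map_add, map_sub, map_smul, smul_eq_mul] at h0 h1
  have hi := c.imp_pos.ne'
  rw [fluxE, show √(c.μ₀ / (c.ε₀ * c.εinf)) = c.imp from rfl]
  simp only [avg, jump, trPlus, trMinus, projE, projH, DG.val_add, DG.val_sub, DG.val_smul,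
    map_add, map_sub, map_smul] at h0 h1 ⊢
  field_simp
  linarith

theorem fluxH_proj (c : Medium) (hab : a < b) (u w : Sobolev (m + 1) a b)
    (hu : traceCLM a u = traceCLM b u) (hw : traceCLM a w = traceCLM b w) (j : Fin M) :
    fluxH c a b (projE c hab u w : DG k M) (projH c hab u w) j
      = traceCLM (node a b M ((j : ℕ) + 1)) w := by
  have h0 := trPlus_radauOp (k := k) hab (u + c.imp • w)
    (by simp only [map_add, map_smul, hu, hw]) j
  have h1 := trMinus_radauOp (k := k) hab (u - c.imp • w) j
  simp only [map_add, map_sub, map_smul, smul_eq_mul] at h0 h1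
  have hi := c.imp_pos.ne'
  rw [fluxH, c.sqrt_inv]
  simp only [avg, jump, trPlus, trMinus, projE, projH, DG.val_add, DG.val_sub, DG.val_smul,
    map_add, map_sub, map_smul] at h0 h1 ⊢
  field_simp
  linarith

/-- The projections commute with the discretization of `∂ₓ`: no projection error enters. -/
theorem weakForm_projE (c : Medium) (hab : a < b) (u w : Sobolev (m + 1) a b)
    (hu : traceCLM a u = traceCLM b u) (hw : traceCLM a w = traceCLM b w) (v : DG k M) :
    weakForm a b (projE c hab u w) (fluxE c a b (projE c hab u w : DG k M) (projH c hab u w)) v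
      = -inner ℝ (dx u) (DG.toL2 a b k M v) :=
  weakForm_consistent hab u hu (fun j _ hv => projE_moment c hab u w j hv)
    (fluxE_proj c hab u w hu hw) v

theorem weakForm_projH (c : Medium) (hab : a < b) (u w : Sobolev (m + 1) a b)
    (hu : traceCLM a u = traceCLM b u) (hw : traceCLM a w = traceCLM b w) (v : DG k M) :
    weakForm a b (projH c hab u w) (fluxH c a b (projE c hab u w : DG k M) (projH c hab u w)) v
      = -inner ℝ (dx w) (DG.toL2 a b k M v) :=
  weakForm_consistent hab w hw (fun j _ hv => projH_moment c hab u w j hv)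
    (fluxH_proj c hab u w hu hw) v

/-- `projE` as a bounded operator into `L²(Ω)`. -/
def projECLM (M : ℕ) [NeZero M] (c : Medium) (hab : a < b) (k : ℕ) :
    Sobolev (m + 1) a b × Sobolev (m + 1) a b →L[ℝ] L2 a b :=
  (1 / 2 : ℝ) • ((radauCLM M hab k 0).comp
      (ContinuousLinearMap.fst ℝ _ _ + c.imp • ContinuousLinearMap.snd ℝ _ _)
    + (radauCLM M hab k 1).comp
      (ContinuousLinearMap.fst ℝ _ _ - c.imp • ContinuousLinearMap.snd ℝ _ _))

/-- `projH` as a bounded operator into `L²(Ω)`. -/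
def projHCLM (M : ℕ) [NeZero M] (c : Medium) (hab : a < b) (k : ℕ) :
    Sobolev (m + 1) a b × Sobolev (m + 1) a b →L[ℝ] L2 a b :=
  (c.imp⁻¹ / 2) • ((radauCLM M hab k 0).comp
      (ContinuousLinearMap.fst ℝ _ _ + c.imp • ContinuousLinearMap.snd ℝ _ _)
    - (radauCLM M hab k 1).comp
      (ContinuousLinearMap.fst ℝ _ _ - c.imp • ContinuousLinearMap.snd ℝ _ _))

theorem projECLM_def (c : Medium) (hab : a < b) (u w : Sobolev (m + 1) a b) :
    projECLM M c hab k (u, w) = (1 / 2 : ℝ) • (radauCLM M hab k 0 (u + c.imp • w)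
      + radauCLM M hab k 1 (u - c.imp • w)) := rfl

theorem projHCLM_def (c : Medium) (hab : a < b) (u w : Sobolev (m + 1) a b) :
    projHCLM M c hab k (u, w) = (c.imp⁻¹ / 2) • (radauCLM M hab k 0 (u + c.imp • w)
      - radauCLM M hab k 1 (u - c.imp • w)) := rfl

theorem projECLM_apply (c : Medium) (hab : a < b) (u w : Sobolev (m + 1) a b) :
    projECLM M c hab k (u, w) = DG.toL2 a b k M (projE c hab u w) := by
  rw [projECLM_def, projE, (DG.toL2 a b k M).map_add, (DG.toL2 a b k M).map_smul,
    (DG.toL2 a b k M).map_smul, smul_add]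
  rfl

theorem projHCLM_apply (c : Medium) (hab : a < b) (u w : Sobolev (m + 1) a b) :
    projHCLM M c hab k (u, w) = DG.toL2 a b k M (projH c hab u w) := by
  rw [projHCLM_def, projH, (DG.toL2 a b k M).map_sub, (DG.toL2 a b k M).map_smul,
    (DG.toL2 a b k M).map_smul, smul_sub]
  rfl

theorem fn_add (u w : Sobolev m a b) : fn (u + w) = fn u + fn w := rfl
theorem fn_sub (u w : Sobolev m a b) : fn (u - w) = fn u - fn w := rfl
theorem fn_smul (r : ℝ) (u : Sobolev m a b) : fn (r • u) = r • fn u := rfl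

theorem proj_error (c : Medium) (k : ℕ) : ∃ C : ℝ, 0 < C ∧ ∀ (a b : ℝ) (hab : a < b) (M : ℕ)
    [NeZero M] (u w : Sobolev (k + 1) a b),
    ‖fn u - projECLM M c hab k (u, w)‖ ≤ C * meshSize a b M ^ (k + 1) * (‖u‖ + ‖w‖) ∧
    ‖fn w - projHCLM M c hab k (u, w)‖ ≤ C * meshSize a b M ^ (k + 1) * (‖u‖ + ‖w‖) := by
  obtain ⟨C, hC, h⟩ := radauOp_error k
  have hi := c.imp_pos
  set s := c.imp with hs
  refine ⟨C * (1 + s) + s⁻¹ * (C * (1 + s)), by positivity, ?_⟩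
  intro a b hab M _ u w
  have hh := (meshSize_pos (M := M) hab).le
  set η := meshSize a b M ^ (k + 1) with hη
  have hη0 : 0 ≤ η := by positivity
  set N := ‖u‖ + ‖w‖ with hN
  have hN0 : 0 ≤ N := by positivity
  have hsw : ‖s • w‖ = s * ‖w‖ := by rw [norm_smul, Real.norm_of_nonneg hi.le]
  have b0 : ‖fn (u + s • w) - radauCLM M hab k 0 (u + s • w)‖ ≤ C * η * ((1 + s) * N) := by
    refine (h a b hab M 0 _).trans (mul_le_mul_of_nonneg_left ?_ (by positivity))
    refine (norm_add_le _ _).trans ?_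
    rw [hsw]; nlinarith [norm_nonneg u, norm_nonneg w]
  have b1 : ‖fn (u - s • w) - radauCLM M hab k 1 (u - s • w)‖ ≤ C * η * ((1 + s) * N) := by
    refine (h a b hab M 1 _).trans (mul_le_mul_of_nonneg_left ?_ (by positivity))
    refine (norm_sub_le _ _).trans ?_
    rw [hsw]; nlinarith [norm_nonneg u, norm_nonneg w]
  set X := fn (u + s • w) - radauCLM M hab k 0 (u + s • w) with hX
  set Y := fn (u - s • w) - radauCLM M hab k 1 (u - s • w) with hY
  have eE : fn u - projECLM M c hab k (u, w) = (1 / 2 : ℝ) • (X + Y) := by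
    rw [projECLM_def, hX, hY, fn_add, fn_sub, fn_smul]
    module
  have eH : fn w - projHCLM M c hab k (u, w) = (s⁻¹ / 2) • (X - Y) := by
    have : fn w = (s⁻¹ / 2 * (2 * s)) • fn w := by
      rw [show s⁻¹ / 2 * (2 * s) = 1 by field_simp, one_smul]
    rw [projHCLM_def, hX, hY, fn_add, fn_sub, fn_smul]
    nth_rewrite 1 [this]
    module
  have hK : 0 ≤ C * η * ((1 + s) * N) := by positivity
  have hsi : 0 < s⁻¹ := inv_pos.2 hi
  constructor
  · rw [eE, norm_smul, Real.norm_of_nonneg (by norm_num)]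
    have h1 := norm_add_le X Y
    calc 1 / 2 * ‖X + Y‖ ≤ C * η * ((1 + s) * N) := by linarith
      _ ≤ C * η * ((1 + s) * N) + s⁻¹ * (C * η * ((1 + s) * N)) :=
          le_add_of_nonneg_right (mul_nonneg hsi.le hK)
      _ = _ := by ring
  · rw [eH, norm_smul, Real.norm_of_nonneg (by positivity)]
    have h1 := norm_sub_le X Y
    calc s⁻¹ / 2 * ‖X - Y‖ ≤ s⁻¹ / 2 * (2 * (C * η * ((1 + s) * N))) := by gcongr; linarith
      _ = s⁻¹ * (C * η * ((1 + s) * N)) := by ring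
      _ ≤ C * η * ((1 + s) * N) + s⁻¹ * (C * η * ((1 + s) * N)) := le_add_of_nonneg_left hK
      _ = _ := by ring

end FieldProjection

/-! ### Absolutely continuous curves of piecewise polynomials -/

section Curves

variable {k M : ℕ}

theorem absolutelyContinuous_sum {ι : Type*} (s : Finset ι) {f : ι → ℝ → ℝ} {a b : ℝ}
    (hf : ∀ i ∈ s, AbsolutelyContinuousOnInterval (f i) a b) :
    AbsolutelyContinuousOnInterval (fun t => ∑ i ∈ s, f i t) a b := by
  classical
  induction s using Finset.induction_on with
  | empty =>
    simp only [Finset.sum_empty]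
    exact (contDiff_const.contDiffOn).absolutelyContinuousOnInterval
  | insert i s hi ih =>
    simp only [Finset.sum_insert hi]
    exact (hf i (Finset.mem_insert_self i s)).fun_add
      (ih fun j hj => hf j (Finset.mem_insert_of_mem hj))

/-- Piecewise polynomials with given coefficients. -/
def DG.ofCoeff (k M : ℕ) : (Fin M → Fin (k + 1) → ℝ) ≃ₗ[ℝ] DG k M :=
  LinearEquiv.piCongrRight fun _ => (degreeLECoeff k).symm

theorem degreeLTEquiv_apply (n : ℕ) (w : Polynomial.degreeLT ℝ n) (i : Fin n) :
    Polynomial.degreeLTEquiv ℝ n w i = (w : ℝ[X]).coeff i := rfl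

theorem degreeLECoeff_apply (w : Polynomial.degreeLE ℝ (k : WithBot ℕ)) (i : Fin (k + 1)) :
    degreeLECoeff k w i = (w : ℝ[X]).coeff i := by
  rw [degreeLECoeff, LinearEquiv.trans_apply, degreeLTEquiv_apply, LinearEquiv.coe_ofEq_apply]

theorem DG.ofCoeff_apply (c : Fin M → Fin (k + 1) → ℝ) (j : Fin M) :
    DG.ofCoeff k M c j = (degreeLECoeff k).symm (c j) := by
  rw [DG.ofCoeff, LinearEquiv.piCongrRight_apply]

theorem DG.ofCoeff_coeff (v : DG k M) :
    DG.ofCoeff k M (fun j i => (v j : ℝ[X]).coeff i) = v := by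
  funext j
  rw [DG.ofCoeff_apply, LinearEquiv.symm_apply_eq]
  exact funext fun i => (degreeLECoeff_apply (v j) i).symm

/-- A linear functional in terms of the coefficients. -/
theorem linear_ofCoeff (L : DG k M →ₗ[ℝ] ℝ) (c : Fin M → Fin (k + 1) → ℝ) :
    L (DG.ofCoeff k M c)
      = ∑ j, ∑ i, c j i * L (DG.ofCoeff k M (Pi.single j (Pi.single i 1))) := by
  have hc : c = ∑ j, ∑ i, c j i • (Pi.single j (Pi.single i 1) : Fin M → Fin (k + 1) → ℝ) := by
    funext j i
    simp [Finset.sum_apply, Pi.single_apply, Finset.sum_ite_eq, ite_apply,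
      apply_ite]
  conv_lhs => rw [hc]
  simp only [map_sum, map_smul, smul_eq_mul]

theorem linear_eq_sum (L : DG k M →ₗ[ℝ] ℝ) (v : DG k M) :
    L v = ∑ j, ∑ i : Fin (k + 1), (v j : ℝ[X]).coeff i
      * L (DG.ofCoeff k M (Pi.single j (Pi.single i 1))) := by
  conv_lhs => rw [← DG.ofCoeff_coeff v]
  exact linear_ofCoeff L _

/-- Evaluation at the point `x` of the cell `j`. -/
def DG.evalL (k : ℕ) {M : ℕ} (j : Fin M) (x : ℝ) : DG k M →ₗ[ℝ] ℝ :=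
  (Polynomial.leval x).comp ((Submodule.subtype _).comp (LinearMap.proj j))

theorem DG.evalL_apply (j : Fin M) (x : ℝ) (v : DG k M) : DG.evalL k j x v = v.val j x := rfl

/-- The time derivative of a curve of piecewise polynomials. -/
def dot (u : ℝ → DG k M) (t : ℝ) : DG k M :=
  DG.ofCoeff k M fun j i => deriv (fun s => (u s j : ℝ[X]).coeff i) t

variable {T : ℝ} {u : ℝ → DG k M}

theorem IsAC.linear (hu : IsAC T u) (L : DG k M →ₗ[ℝ] ℝ) :
    AbsolutelyContinuousOnInterval (fun t => L (u t)) 0 T := by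
  have : (fun t => L (u t)) = fun t => ∑ j, ∑ i : Fin (k + 1), (u t j : ℝ[X]).coeff i
      * L (DG.ofCoeff k M (Pi.single j (Pi.single i 1))) := funext fun t => linear_eq_sum L (u t)
  rw [this]
  refine absolutelyContinuous_sum _ fun j _ => absolutelyContinuous_sum _ fun i _ => ?_
  have := (hu j i).const_mul (L (DG.ofCoeff k M (Pi.single j (Pi.single i 1))))
  simpa only [mul_comm] using this

/-- Only finitely many coefficients have to be differentiable, so one null set of times serves for
all functionals. -/
theorem IsAC.hasDerivAt (hT : 0 < T) (hu : IsAC T u) :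
    ∀ᵐ t, t ∈ Ioo 0 T → ∀ L : DG k M →ₗ[ℝ] ℝ, HasDerivAt (fun s => L (u s)) (L (dot u t)) t := by
  have h : ∀ᵐ t, ∀ (j : Fin M) (i : Fin (k + 1)), t ∈ uIcc 0 T →
      DifferentiableAt ℝ (fun s => (u s j : ℝ[X]).coeff i) t :=
    ae_all_iff.2 fun j => ae_all_iff.2 fun i => (hu j i).ae_differentiableAt
  filter_upwards [h] with t ht hm L
  have hm' : t ∈ uIcc 0 T := by rw [uIcc_of_le hT.le]; exact Ioo_subset_Icc_self hm
  rw [dot, linear_ofCoeff]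
  have : (fun t => L (u t)) = fun t => ∑ j, ∑ i : Fin (k + 1), (u t j : ℝ[X]).coeff i
      * L (DG.ofCoeff k M (Pi.single j (Pi.single i 1))) := funext fun t => linear_eq_sum L (u t)
  rw [this]
  exact HasDerivAt.fun_sum fun j _ => HasDerivAt.fun_sum fun i _ =>
    ((ht j i hm').hasDerivAt).mul_const _

theorem dtVal_eq {t : ℝ}
    (h : ∀ L : DG k M →ₗ[ℝ] ℝ, HasDerivAt (fun s => L (u s)) (L (dot u t)) t) (j : Fin M) (x : ℝ) :
    dtVal u t j x = (dot u t).val j x :=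
  (h (DG.evalL k j x)).deriv

/-- A family of piecewise polynomials that is integrable at every point has an integral. -/
theorem exists_integral {Ψ : ℝ → DG k M}
    (h : ∀ (j : Fin M) (x : ℝ), IntegrableOn (fun l => (Ψ l).val j x) (Ioi 0)) :
    ∃ v : DG k M, ∀ L : DG k M →ₗ[ℝ] ℝ, ∫ l in Ioi 0, L (Ψ l) = L v := by
  have hcoeff : ∀ (j : Fin M) (i : Fin (k + 1)),
      IntegrableOn (fun l => (Ψ l j : ℝ[X]).coeff i) (Ioi 0) := by
    intro j i
    have hinj : InjOn (fun n : ℕ => (n : ℝ)) (Finset.range (k + 1)) :=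
      fun _ _ _ _ h => Nat.cast_injective h
    have hdeg : ∀ l, (Ψ l j : ℝ[X]).degree < (Finset.range (k + 1)).card := fun l => by
      rw [Finset.card_range]
      exact Polynomial.mem_degreeLT.1
        (by rw [Polynomial.degreeLT_succ_eq_degreeLE]; exact (Ψ l j).2)
    -- Lagrange interpolation at `0, …, k` writes each coefficient as a fixed combination of point
    -- values, which are integrable by assumption.
    have heq : (fun l => (Ψ l j : ℝ[X]).coeff i) = fun l => ∑ n ∈ Finset.range (k + 1),
        (Ψ l).val j n * (Lagrange.basis (Finset.range (k + 1)) (fun n : ℕ => (n : ℝ)) n).coeff i := by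
      funext l
      conv_lhs => rw [Lagrange.eq_interpolate hinj (hdeg l), Lagrange.interpolate_apply]
      simp only [Polynomial.finsetSum_coeff, Polynomial.coeff_C_mul]
      rfl
    rw [heq]
    exact integrable_finsetSum _ fun n _ => (h j n).mul_const _
  refine ⟨DG.ofCoeff k M fun j i => ∫ l in Ioi 0, (Ψ l j : ℝ[X]).coeff i, fun L => ?_⟩
  rw [linear_ofCoeff]
  simp only [fun l => linear_eq_sum L (Ψ l)]
  rw [integral_finsetSum _ fun j _ => integrable_finsetSum _ fun i _ => (hcoeff j i).mul_const _]
  refine Finset.sum_congr rfl fun j _ => ?_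
  rw [integral_finsetSum _ fun i _ => (hcoeff j i).mul_const _]
  exact Finset.sum_congr rfl fun i _ => integral_mul_const _ _

end Curves

/-! ### The scheme tested on the whole mesh -/

section Scheme

variable {a b T : ℝ} {k M : ℕ} {c : Medium} {F₁ F₂ F₃ : ℝ → L2 a b}
  {Hh Eh Ph : ℝ → DG k M} {ψh : ℝ → ℝ → DG k M}

/-- The inner product with an element of `L²(Ω)`, on `V_h`. -/
def innerDG (k M : ℕ) (q : L2 a b) : DG k M →ₗ[ℝ] ℝ :=
  (innerSL ℝ q).toLinearMap.comp (DG.toL2 a b k M)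

theorem innerDG_apply (q : L2 a b) (v : DG k M) :
    innerDG k M q v = inner ℝ q (DG.toL2 a b k M v) := rfl

theorem cellIntegral_const_mul (j : Fin M) (r : ℝ) (f : ℝ → ℝ) :
    cellIntegral a b j (fun x => r * f x) = r * cellIntegral a b j f :=
  intervalIntegral.integral_const_mul _ _

variable [NeZero M]

theorem sum_cellIntegral_smul (hab : a < b) (r : ℝ) (w v : DG k M) :
    ∑ j, cellIntegral a b j (fun x => r * w.val j x * (v j : ℝ[X]).eval x)
      = r * inner ℝ (DG.toL2 a b k M w) (DG.toL2 a b k M v) := by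
  rw [inner_toL2_toL2 hab, Finset.mul_sum]
  refine Finset.sum_congr rfl fun j _ => ?_
  rw [← cellIntegral_const_mul]
  simp only [mul_assoc]
  rfl

theorem scheme_H (hab : a < b) (hT : 0 < T) (h : IsDGSolution c T F₁ F₂ F₃ Hh Eh Ph ψh) :
    ∀ᵐ t, t ∈ Ioo 0 T → ∀ v : DG k M,
      c.μ₀ * inner ℝ (DG.toL2 a b k M (dot Hh t)) (DG.toL2 a b k M v)
        + weakForm a b (Eh t) (fluxE c a b (Eh t) (Hh t)) v
      = inner ℝ (F₁ t) (DG.toL2 a b k M v) := by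
  filter_upwards [h.eq_H, h.ac_H.hasDerivAt hT] with t h1 h2 ht v
  have e := Finset.sum_congr rfl fun j (_ : j ∈ Finset.univ) => h1 ht j (v j) (v j).2
  simp only [dtVal_eq (h2 ht)] at e
  rw [inner_toL2 hab (F₁ t) v]
  refine Eq.trans ?_ e
  rw [weakForm, ← sum_cellIntegral_smul hab, ← Finset.sum_add_distrib]
  refine Finset.sum_congr rfl fun j _ => ?_
  simp only [DG.val]
  ring

theorem scheme_E (hab : a < b) (hT : 0 < T) (h : IsDGSolution c T F₁ F₂ F₃ Hh Eh Ph ψh) :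
    ∀ᵐ t, t ∈ Ioo 0 T → ∀ v : DG k M,
      c.ε₀ * c.εinf * inner ℝ (DG.toL2 a b k M (dot Eh t)) (DG.toL2 a b k M v)
        + inner ℝ (DG.toL2 a b k M (dot Ph t)) (DG.toL2 a b k M v)
        + weakForm a b (Hh t) (fluxH c a b (Eh t) (Hh t)) v
      = inner ℝ (F₂ t) (DG.toL2 a b k M v) := by
  filter_upwards [h.eq_E, h.ac_E.hasDerivAt hT, h.ac_P.hasDerivAt hT] with t h1 h2 h3 ht v
  have e := Finset.sum_congr rfl fun j (_ : j ∈ Finset.univ) => h1 ht j (v j) (v j).2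
  simp only [dtVal_eq (h2 ht), dtVal_eq (h3 ht)] at e
  rw [inner_toL2 hab (F₂ t) v]
  refine Eq.trans ?_ e
  rw [weakForm, ← sum_cellIntegral_smul hab, inner_toL2_toL2 hab, ← Finset.sum_add_distrib,
    ← Finset.sum_add_distrib]
  refine Finset.sum_congr rfl fun j _ => ?_
  simp only [DG.val]
  ring

/-- The coefficient `κ = 1/(ε₀(ε_s - ε_∞))`. -/
def Medium.kap (c : Medium) : ℝ := 1 / (c.ε₀ * (c.εs - c.εinf))

theorem Medium.kap_pos (c : Medium) : 0 < c.kap :=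
  one_div_pos.2 (mul_pos c.ε₀_pos (sub_pos.2 c.εinf_lt_εs))

/-- The coefficient `τ₀^α κ`. -/
def Medium.theta (c : Medium) : ℝ := c.τ₀ ^ c.α / (c.ε₀ * (c.εs - c.εinf))

theorem Medium.theta_eq (c : Medium) : c.theta = c.τ₀ ^ c.α * c.kap := by
  rw [Medium.theta, Medium.kap, mul_one_div]

theorem Medium.theta_pos (c : Medium) : 0 < c.theta := by
  rw [c.theta_eq]; exact mul_pos (Real.rpow_pos_of_pos c.τ₀_pos _) c.kap_pos

/-- The scalar Caputo derivative in terms of the time derivative. -/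
def caputoR (α : ℝ) (u : ℝ → ℝ) (t : ℝ) : ℝ :=
  1 / Real.Gamma (1 - α) * ∫ s in (0 : ℝ)..t, u s * (t - s) ^ (-α)

/-- Pairing with a fixed `v` turns the auxiliary equations into scalar ones, to which
`integral_auxiliary` applies. The null set obtained there depends on `v`, hence the order of
quantifiers. -/
theorem scheme_P (hab : a < b) (hT : 0 < T) (h : IsDGSolution c T F₁ F₂ F₃ Hh Eh Ph ψh)
    (h0 : ∀ l > 0, ψh l 0 = 0) (v : DG k M) :
    ∀ᵐ t, t ∈ Ioo 0 T →
      c.theta * caputoR c.α (deriv fun s => innerDG k M (DG.toL2 a b k M v) (Ph s)) t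
        + c.kap * innerDG k M (DG.toL2 a b k M v) (Ph t)
        - innerDG k M (DG.toL2 a b k M v) (Eh t)
      = c.kap * inner ℝ (F₃ t) (DG.toL2 a b k M v) := by
  set L := innerDG k M (DG.toL2 a b k M v) with hL
  have hLs : ∀ w, L w = inner ℝ (DG.toL2 a b k M w) (DG.toL2 a b k M v) := fun w =>
    real_inner_comm (DG.toL2 a b k M w) (DG.toL2 a b k M v)
  -- The exceptional times may vary with `l`; this is harmless, because Duhamel's formula is
  -- integrated for each `l` separately.
  have hode : ∀ l > 0, ∀ᵐ t, t ∈ Ioo 0 T → deriv (fun s => L (ψh l s)) t + l * L (ψh l t)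
      = Real.sin (Real.pi * c.α) / Real.pi * l ^ (c.α - 1) * deriv (fun s => L (Ph s)) t := by
    intro l hl
    filter_upwards [h.eq_ψ l hl, (h.ac_ψ l hl).hasDerivAt hT, h.ac_P.hasDerivAt hT]
      with t h1 h2 h3 ht
    have e := Finset.sum_congr rfl fun j (_ : j ∈ Finset.univ) => h1 ht j (v j) (v j).2
    simp only [dtVal_eq (h2 ht), dtVal_eq (h3 ht)] at e
    rw [(h2 ht L).deriv, (h3 ht L).deriv, hLs, hLs, hLs]
    rw [Finset.sum_sub_distrib, Finset.sum_add_distrib, ← Finset.mul_sum, ← Finset.mul_sum] at e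
    have e1 := sum_cellIntegral_smul hab c.theta (dot (ψh l) t) v
    have e2 := sum_cellIntegral_smul hab c.theta (ψh l t) v
    have e3 := sum_cellIntegral_smul hab c.theta (dot Ph t) v
    simp only [Medium.theta] at e1 e2 e3
    simp only [DG.val] at e e1 e2 e3
    rw [e1, e2, e3, Finset.sum_const_zero] at e
    have hθ := c.theta_pos.ne'
    refine mul_left_cancel₀ hθ ?_
    simp only [Medium.theta]
    linarith
  have haux := integral_auxiliary c.α_pos c.α_lt_one hT (h.ac_P.linear L).intervalIntegrable_deriv
    (ψ := fun l t => L (ψh l t)) (fun l hl => (h.ac_ψ l hl).linear L)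
    (fun l hl => by rw [h0 l hl, map_zero]) hode
  filter_upwards [haux, h.eq_P, h.integrable_ψ] with t h1 h2 h3 ht
  obtain ⟨Ψ, hΨ⟩ := exists_integral (h3 ht)
  have e := Finset.sum_congr rfl fun j (_ : j ∈ Finset.univ) => h2 ht j (v j) (v j).2
  have e1 : ∀ j : Fin M, cellIntegral a b j (fun x => ∫ l in Ioi 0,
        c.τ₀ ^ c.α / (c.ε₀ * (c.εs - c.εinf)) * (ψh l t).val j x * (v j : ℝ[X]).eval x)
      = cellIntegral a b j fun x => c.theta * Ψ.val j x * (v j : ℝ[X]).eval x := by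
    intro j
    congr 1; funext x
    have := hΨ (DG.evalL k j x)
    simp only [DG.evalL_apply] at this
    rw [integral_mul_const, integral_const_mul, this]
    rfl
  have e2 : ∀ j : Fin M, cellIntegral a b j
        (fun x => (Ph t).val j x / (c.ε₀ * (c.εs - c.εinf)) * (v j : ℝ[X]).eval x)
      = cellIntegral a b j fun x => c.kap * (Ph t).val j x * (v j : ℝ[X]).eval x := by
    intro j
    congr 1; funext x
    rw [Medium.kap]; ring
  have e3 : ∀ j : Fin M, cellIntegral a b j
        (fun x => F₃ t x / (c.ε₀ * (c.εs - c.εinf)) * (v j : ℝ[X]).eval x)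
      = c.kap * cellIntegral a b j fun x => F₃ t x * v.val j x := by
    intro j
    rw [← cellIntegral_const_mul]
    congr 1; funext x
    rw [Medium.kap, DG.val]; ring
  simp only [e1, e2, e3] at e
  rw [Finset.sum_sub_distrib, Finset.sum_add_distrib, sum_cellIntegral_smul hab,
    sum_cellIntegral_smul hab, ← Finset.mul_sum, ← inner_toL2 hab, ← hLs, ← hLs, ← hΨ L,
    (h1 ht).2] at e
  have e4 : ∑ j, cellIntegral a b j (fun x => (Eh t).val j x * (v j : ℝ[X]).eval x)
      = L (Eh t) := by
    rw [hLs, inner_toL2_toL2 hab]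
    rfl
  rw [e4] at e
  exact e

end Scheme

/-! ### Curves in time -/

section TimeCurves

theorem absolutelyContinuous_clm_comp {V : Type*} [NormedAddCommGroup V]
    [NormedSpace ℝ V] {T : ℝ} (hT : 0 < T) {W : ℝ → V} (hW : ContDiffOn ℝ 1 W (Icc 0 T))
    (Λ : V →L[ℝ] ℝ) : AbsolutelyContinuousOnInterval (fun t => Λ (W t)) 0 T := by
  refine ContDiffOn.absolutelyContinuousOnInterval ?_
  rw [uIcc_of_le hT.le]
  exact hW.continuousLinearMap_comp Λ

theorem hasDerivAt_of_contDiffOn {V : Type*} [NormedAddCommGroup V]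
    [NormedSpace ℝ V] {T : ℝ} {W : ℝ → V} (hW : ContDiffOn ℝ 1 W (Icc 0 T)) {t : ℝ}
    (ht : t ∈ Ioo 0 T) : HasDerivAt W (derivWithin W (Icc 0 T) t) t :=
  ((hW.differentiableOn one_ne_zero t (Ioo_subset_Icc_self ht)).hasDerivWithinAt).hasDerivAt
    (Icc_mem_nhds ht.1 ht.2)

theorem exists_bound_of_contDiffOn {V : Type*} [NormedAddCommGroup V]
    [NormedSpace ℝ V] {T : ℝ} (hT : 0 < T) {W : ℝ → V} (hW : ContDiffOn ℝ 1 W (Icc 0 T)) :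
    ∃ R : ℝ, ∀ t ∈ Icc 0 T, ‖W t‖ ≤ R ∧ ‖derivWithin W (Icc 0 T) t‖ ≤ R := by
  obtain ⟨R₁, h1⟩ := isCompact_Icc.exists_bound_of_continuousOn hW.continuousOn
  obtain ⟨R₂, h2⟩ := isCompact_Icc.exists_bound_of_continuousOn
    (hW.continuousOn_derivWithin (uniqueDiffOn_Icc hT) le_rfl)
  exact ⟨max R₁ R₂, fun t ht => ⟨(h1 t ht).trans (le_max_left _ _),
    (h2 t ht).trans (le_max_right _ _)⟩⟩

variable {a b T : ℝ} {u u' : ℝ → L2 a b}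

theorem IsH1InTime.intervalIntegrable (hT : 0 ≤ T) (h : IsH1InTime T u u') :
    IntervalIntegrable u' volume 0 T := by
  rw [intervalIntegrable_iff_integrableOn_Ioc_of_le hT]
  exact h.memLp.integrable (by norm_num)

theorem IsH1InTime.intervalIntegrable_inner (hT : 0 ≤ T) (h : IsH1InTime T u u') (q : L2 a b) :
    IntervalIntegrable (fun t => inner ℝ q (u' t)) volume 0 T := by
  have := h.intervalIntegrable hT
  exact ⟨(innerSL ℝ q).integrable_comp this.1, (innerSL ℝ q).integrable_comp this.2⟩

theorem IsH1InTime.inner_eq (h : IsH1InTime T u u') (h0 : u 0 = 0) (q : L2 a b) {t : ℝ}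
    (ht : t ∈ Icc 0 T) : inner ℝ q (u t) = ∫ s in (0 : ℝ)..t, inner ℝ q (u' s) := by
  have hi : IntervalIntegrable u' volume 0 t :=
    (h.intervalIntegrable (ht.1.trans ht.2)).mono_set (by
      rw [uIcc_of_le ht.1, uIcc_of_le (ht.1.trans ht.2)]; exact Icc_subset_Icc_right ht.2)
  rw [h.eq_integral t ht, h0, zero_add]
  exact ((innerSL ℝ q).intervalIntegral_comp_comm hi).symm

/-- Linearity holds only at times where both Abel integrals converge, that is almost everywhere. -/
theorem caputoR_sub {α : ℝ} (h1 : α < 1) (hT : 0 ≤ T) {f g w : ℝ → ℝ}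
    (hf : IntervalIntegrable f volume 0 T) (hg : IntervalIntegrable g volume 0 T)
    (hw : ∀ᵐ t, t ∈ Ioo 0 T → w t = f t - g t) :
    ∀ᵐ t, t ∈ Ioo 0 T → caputoR α w t = caputoR α f t - caputoR α g t := by
  have hk : IntervalIntegrable (fun x : ℝ => x ^ (-α)) volume 0 T :=
    intervalIntegral.intervalIntegrable_rpow' (by linarith)
  filter_upwards [ae_intervalIntegrable_conv hT hf hk, ae_intervalIntegrable_conv hT hg hk]
    with t hft hgt ht
  rw [caputoR, caputoR, caputoR, ← mul_sub, ← intervalIntegral.integral_sub (hft ht) (hgt ht)]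
  congr 1
  refine intervalIntegral.integral_congr_ae ?_
  have hne : ∀ᵐ s : ℝ, s ≠ T := by simp [ae_iff, measure_singleton]
  filter_upwards [hw, hne] with s hs hsT hm
  rw [uIoc_of_le ht.1.le] at hm
  rw [hs ⟨hm.1, lt_of_le_of_ne (hm.2.trans ht.2.le) hsT⟩, sub_mul]

/-- The Abel integral of `‖u'‖` converges for almost every time. There the Bochner integral exists
and commutes with every functional, so the null set does not depend on `q`. -/
theorem IsH1InTime.inner_caputo {α : ℝ} (h1 : α < 1) (hT : 0 ≤ T) (h : IsH1InTime T u u') :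
    ∀ᵐ t, t ∈ Ioo 0 T → ∀ q : L2 a b,
      inner ℝ q (caputo α u' t) = caputoR α (fun s => inner ℝ q (u' s)) t := by
  have hk : IntervalIntegrable (fun x : ℝ => x ^ (-α)) volume 0 T :=
    intervalIntegral.intervalIntegrable_rpow' (by linarith)
  have hu := h.intervalIntegrable hT
  filter_upwards [ae_intervalIntegrable_conv hT hu.norm hk] with t hc ht q
  have hut : IntervalIntegrable u' volume 0 t := hu.mono_set (by
      rw [uIcc_of_le ht.1.le, uIcc_of_le hT]; exact Icc_subset_Icc_right ht.2.le)
  have hi : IntervalIntegrable (fun s => ((t - s) ^ (-α)) • u' s) volume 0 t := by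
    have hm : Measurable fun s : ℝ => (t - s) ^ (-α) := by fun_prop
    refine (hc ht).mono_fun' (hm.aestronglyMeasurable.smul ?_) ?_
    · exact hut.aestronglyMeasurable_restrict_uIoc
    · rw [Filter.EventuallyLE, ae_restrict_iff' measurableSet_uIoc]
      refine Filter.Eventually.of_forall fun s hs => ?_
      rw [uIoc_of_le ht.1.le] at hs
      rw [norm_smul, Real.norm_of_nonneg (Real.rpow_nonneg (sub_nonneg.2 hs.2) _), mul_comm]
  rw [caputo, caputoR, real_inner_smul_right]
  congr 1
  refine ((innerSL ℝ q).intervalIntegral_comp_comm hi).symm.trans ?_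
  congr 1; funext s
  rw [innerSL_apply_apply, real_inner_smul_right, mul_comm]

end TimeCurves

/-! ### Coordinates in `V_h` -/

section Coordinates

variable {a b : ℝ} {k M : ℕ}

/-- `V_h` has a basis that is orthonormal in `L²(Ω)`. -/
theorem exists_orthonormal (a b : ℝ) (k M : ℕ) : ∃ (n : ℕ) (w : Fin n → DG k M),
    (∀ (v : DG k M) (g : L2 a b), ∑ i, inner ℝ (DG.toL2 a b k M (w i)) (DG.toL2 a b k M v)
      * inner ℝ (DG.toL2 a b k M (w i)) g = inner ℝ (DG.toL2 a b k M v) g) ∧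
    ∀ g : L2 a b, ∑ i, inner ℝ (DG.toL2 a b k M (w i)) g ^ 2 ≤ ‖g‖ ^ 2 := by
  set S := LinearMap.range (DG.toL2 a b k M) with hS
  set q := stdOrthonormalBasis ℝ S with hq
  choose w hw using fun i => LinearMap.mem_range.1 (q i).2
  refine ⟨Module.finrank ℝ S, w, fun v g => ?_, fun g => ?_⟩
  · set s : S := ⟨DG.toL2 a b k M v, LinearMap.mem_range_self _ v⟩ with hs
    have e : DG.toL2 a b k M v = ∑ i, (inner ℝ (q i) s : ℝ) • ((q i : S) : L2 a b) := by
      have := congrArg (Subtype.val) (q.sum_repr' s)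
      rw [← Submodule.subtype_apply, map_sum] at this
      simpa using this.symm
    nth_rewrite 2 [e]
    rw [sum_inner]
    refine Finset.sum_congr rfl fun i _ => ?_
    rw [real_inner_smul_left, hw i]
    rfl
  · have hon : Orthonormal ℝ fun i => ((q i : S) : L2 a b) :=
      q.orthonormal.comp_linearIsometry S.subtypeₗᵢ
    have := hon.sum_inner_products_le g (s := Finset.univ)
    simpa only [hw, Real.norm_eq_abs, sq_abs] using this

end Coordinates

/-! ### Error equations -/

section ErrorEquations

variable {a b T : ℝ} {k M : ℕ} [NeZero M] {c : Medium} {F₁ F₂ F₃ : ℝ → L2 a b} {E₀ H₀ : ℝ → ℝ}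
  {H E P : ℝ → Sobolev (k + 1) a b} {P' : ℝ → L2 a b}
  {Hh Eh Ph : ℝ → DG k M} {ψh : ℝ → ℝ → DG k M}

/-- The exact equations and the scheme are tested with the discrete errors and subtracted. Since the
projections are consistent without error, the spatial terms form the upwind form of the discrete
error, which is nonnegative. -/
theorem field_error (hab : a < b) (hT : 0 < T)
    (hsol : IsSolution c T F₁ F₂ F₃ E₀ H₀ H E P P')
    (h : IsDGSolution c T F₁ F₂ F₃ Hh Eh Ph ψh) :
    ∀ᵐ t, t ∈ Ioo 0 T →
      c.μ₀ * inner ℝ (DG.toL2 a b k M (dot Hh t) - dt T H t)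
          (DG.toL2 a b k M (Hh t - projH c hab (E t) (H t)))
        + c.ε₀ * c.εinf * inner ℝ (DG.toL2 a b k M (dot Eh t) - dt T E t)
          (DG.toL2 a b k M (Eh t - projE c hab (E t) (H t)))
        + inner ℝ (DG.toL2 a b k M (dot Ph t) - P' t)
          (DG.toL2 a b k M (Eh t - projE c hab (E t) (H t))) ≤ 0 := by
  filter_upwards [scheme_H hab hT h, scheme_E hab hT h, hsol.eq_H, hsol.eq_E]
    with t s1 s2 x1 x2 ht
  have ht' := Ioo_subset_Icc_self ht
  have hu := trace_periodic hab (E t) (hsol.periodic_E t ht')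
  have hw := trace_periodic hab (H t) (hsol.periodic_H t ht')
  set pE : DG k M := projE c hab (E t) (H t) with hpE
  set pH : DG k M := projH c hab (E t) (H t) with hpH
  have k1 := s1 ht (Hh t - pH)
  have k2 := s2 ht (Eh t - pE)
  have y1 := congrArg (fun z => inner ℝ z (DG.toL2 a b k M (Hh t - pH))) (x1 ht)
  have y2 := congrArg (fun z => inner ℝ z (DG.toL2 a b k M (Eh t - pE))) (x2 ht)
  simp only [inner_add_left, inner_sub_left, real_inner_smul_left] at y1 y2
  have z1 := weakForm_projE c hab (E t) (H t) hu hw (Hh t - pH)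
  have z2 := weakForm_projH c hab (E t) (H t) hu hw (Eh t - pE)
  have hup := upwind_nonneg (a := a) (b := b) c (Eh t - pE) (Hh t - pH)
  rw [fluxE_sub, fluxH_sub, weakForm_sub, weakForm_sub] at hup
  rw [← hpE, ← hpH] at z1 z2
  simp only [inner_sub_left]
  linarith

/-- The source cancels in the difference of the two polarization laws. Representing `P` by the
integral of `P'` makes the derivative of `p` available almost everywhere. -/
theorem polarization_error (hab : a < b) (hT : 0 < T)
    (hsol : IsSolution c T F₁ F₂ F₃ E₀ H₀ H E P P')
    (h : IsDGSolution c T F₁ F₂ F₃ Hh Eh Ph ψh) (h0 : ∀ l > 0, ψh l 0 = 0) (v : DG k M)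
    {p : ℝ → ℝ} (hp : p = fun t => innerDG k M (DG.toL2 a b k M v) (Ph t)
      - ∫ s in (0 : ℝ)..t, inner ℝ (DG.toL2 a b k M v) (P' s)) :
    ∀ᵐ t, t ∈ Ioo 0 T → c.theta * caputoR c.α (deriv p) t + c.kap * p t
      = inner ℝ (DG.toL2 a b k M v) (DG.toL2 a b k M (Eh t) - fn (E t)) := by
  set q := DG.toL2 a b k M v with hq
  have hint := hsol.time_deriv_P.intervalIntegrable_inner hT.le q
  have hder : ∀ᵐ t, t ∈ Ioo 0 T →
      deriv p t = deriv (fun s => innerDG k M q (Ph s)) t - inner ℝ q (P' t) := by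
    filter_upwards [h.ac_P.hasDerivAt hT, hint.ae_hasDerivAt_integral] with t h1 h2 ht
    have ht' : t ∈ uIcc 0 T := by rw [uIcc_of_le hT.le]; exact Ioo_subset_Icc_self ht
    rw [hp, ((h1 ht (innerDG k M q)).fun_sub (h2 ht' 0 left_mem_uIcc)).deriv,
      (h1 ht (innerDG k M q)).deriv]
  filter_upwards [scheme_P hab hT h h0 v, hsol.eq_P,
    hsol.time_deriv_P.inner_caputo c.α_lt_one hT.le,
    caputoR_sub c.α_lt_one hT.le (h.ac_P.linear (innerDG k M q)).intervalIntegrable_deriv hint hder]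
    with t s1 s2 s3 s4 ht
  have e1 := s1 ht
  have e2 := congrArg (fun z => c.kap * inner ℝ q z) (s2 ht)
  simp only [inner_add_right, real_inner_smul_right, s3 ht q] at e2
  rw [hsol.time_deriv_P.inner_eq hsol.init_P q (Ioo_subset_Icc_self ht)] at e2
  rw [s4 ht, congrFun hp t, inner_sub_right]
  rw [← hq, innerDG_apply q (Eh t), real_inner_comm q (F₃ t)] at e1
  have hk : c.kap * (c.ε₀ * (c.εs - c.εinf)) = 1 := by
    rw [Medium.kap, one_div, inv_mul_cancel₀]
    exact (mul_pos c.ε₀_pos (sub_pos.2 c.εinf_lt_εs)).ne'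
  rw [c.theta_eq] at e1 ⊢
  have e3 : c.kap * (c.ε₀ * (c.εs - c.εinf) * inner ℝ q (fn (E t))) = inner ℝ q (fn (E t)) := by
    rw [← mul_assoc, hk, one_mul]
  linarith

end ErrorEquations

/-! ### Convergence -/

section Convergence

variable {a b T : ℝ} {k M : ℕ}

theorem sq_norm_sub_le {V : Type*} [SeminormedAddCommGroup V] (u v s : V) :
    ‖u - v‖ ^ 2 ≤ 2 * ‖u - s‖ ^ 2 + 2 * ‖s - v‖ ^ 2 := by
  have h := norm_sub_le_norm_sub_add_norm_sub u s v
  nlinarith [norm_nonneg (u - v), sq_nonneg (‖u - s‖ - ‖s - v‖)]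

/-- Passes from the exact time derivatives `x₁`, `y₁` to the projected ones `x₂`, `y₂`, which are
those of the discrete error, at the cost of the projection error `B`. -/
theorem inner_error_bound {V : Type*} [NormedAddCommGroup V] [InnerProductSpace ℝ V]
    {μ ε B : ℝ} (hμ : 0 ≤ μ) (hε : 0 ≤ ε) (hB : 0 ≤ B) {x x₁ x₂ y y₁ y₂ z eH eE : V}
    (h : μ * inner ℝ (x - x₁) eH + ε * inner ℝ (y - y₁) eE + inner ℝ z eE ≤ 0)
    (hx : ‖x₁ - x₂‖ ≤ B) (hy : ‖y₁ - y₂‖ ≤ B) :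
    μ * inner ℝ eH (x - x₂) + ε * inner ℝ eE (y - y₂) + inner ℝ eE z
      ≤ (μ + ε + 1) * B * (‖eH‖ + ‖eE‖) := by
  have b1 : inner ℝ eH (x₁ - x₂) ≤ ‖eH‖ * B :=
    (real_inner_le_norm _ _).trans (mul_le_mul_of_nonneg_left hx (norm_nonneg _))
  have b2 : inner ℝ eE (y₁ - y₂) ≤ ‖eE‖ * B :=
    (real_inner_le_norm _ _).trans (mul_le_mul_of_nonneg_left hy (norm_nonneg _))
  rw [real_inner_comm eH, real_inner_comm eE, real_inner_comm eE] at h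
  simp only [inner_sub_right] at h b1 b2 ⊢
  have c1 := mul_le_mul_of_nonneg_left b1 hμ
  have c2 := mul_le_mul_of_nonneg_left b2 hε
  have g1 : 0 ≤ ‖eH‖ * B := by positivity
  have g2 : 0 ≤ ‖eE‖ * B := by positivity
  have g3 : 0 ≤ ε * (‖eH‖ * B) := by positivity
  have g4 : 0 ≤ μ * (‖eE‖ * B) := by positivity
  linarith

/-- Coordinates with respect to an `L²(Ω)`-orthonormal basis of `V_h`. -/
structure IsOrthonormalBasis (a b : ℝ) {k M n : ℕ} (w : Fin n → DG k M) : Prop where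
  parseval : ∀ (v : DG k M) (g : L2 a b),
    ∑ i, inner ℝ (DG.toL2 a b k M (w i)) (DG.toL2 a b k M v)
      * inner ℝ (DG.toL2 a b k M (w i)) g = inner ℝ (DG.toL2 a b k M v) g
  bessel : ∀ g : L2 a b, ∑ i, inner ℝ (DG.toL2 a b k M (w i)) g ^ 2 ≤ ‖g‖ ^ 2

variable {n : ℕ} {w : Fin n → DG k M}

theorem IsOrthonormalBasis.sum_sq (hw : IsOrthonormalBasis a b w) (v : DG k M) :
    ∑ i, inner ℝ (DG.toL2 a b k M (w i)) (DG.toL2 a b k M v) ^ 2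
      = ‖DG.toL2 a b k M v‖ ^ 2 := by
  rw [← real_inner_self_eq_norm_sq, ← hw.parseval]
  simp only [sq]

/-- Any `s` in `V_h` may serve for comparison. The coordinates of `s - v` are split at `u`, so
Bessel's inequality for `u - s` contributes `2 * 2` to the factor `6`, and the factor `4` is
likewise `2 * 2`. -/
theorem IsOrthonormalBasis.sq_norm_sub_le (hw : IsOrthonormalBasis a b w) (u : L2 a b)
    (v s : DG k M) :
    ‖u - DG.toL2 a b k M v‖ ^ 2 ≤ 6 * ‖u - DG.toL2 a b k M s‖ ^ 2
      + 4 * ∑ i, inner ℝ (DG.toL2 a b k M (w i)) (DG.toL2 a b k M v - u) ^ 2 := by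
  have h1 := ColeCole.sq_norm_sub_le u (DG.toL2 a b k M v) (DG.toL2 a b k M s)
  have h2 := hw.sum_sq (s - v)
  have h3 := hw.bessel (u - DG.toL2 a b k M s)
  rw [map_sub] at h2
  have h4 : ∑ i, inner ℝ (DG.toL2 a b k M (w i)) (DG.toL2 a b k M s - DG.toL2 a b k M v) ^ 2
      ≤ ∑ i, (2 * inner ℝ (DG.toL2 a b k M (w i)) (u - DG.toL2 a b k M s) ^ 2
        + 2 * inner ℝ (DG.toL2 a b k M (w i)) (DG.toL2 a b k M v - u) ^ 2) := by
    refine Finset.sum_le_sum fun i _ => ?_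
    simp only [inner_sub_right]
    nlinarith [sq_nonneg ((inner ℝ (DG.toL2 a b k M (w i)) u
      - inner ℝ (DG.toL2 a b k M (w i)) (DG.toL2 a b k M s))
      - (inner ℝ (DG.toL2 a b k M (w i)) (DG.toL2 a b k M v)
      - inner ℝ (DG.toL2 a b k M (w i)) u))]
  rw [Finset.sum_add_distrib, ← Finset.mul_sum, ← Finset.mul_sum] at h4
  linarith

variable [NeZero M]

theorem IsL2Proj.inner_eq_zero (hab : a < b) {u : L2 a b} {v : DG k M} (h : IsL2Proj a b u v)
    (s : DG k M) : inner ℝ (DG.toL2 a b k M s) (DG.toL2 a b k M v - u) = 0 := by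
  rw [real_inner_comm, inner_toL2 hab]
  refine Finset.sum_eq_zero fun j _ => ?_
  refine Eq.trans ?_ (h j (s j) (s j).2)
  refine cellIntegral_congr_ae hab j ?_
  have e1 := DG.toL2_ae hab v j
  have e2 := Lp.coeFn_sub (DG.toL2 a b k M v) u
  rw [Filter.EventuallyEq, ae_restrict_iff' measurableSet_Ioo] at e2
  filter_upwards [e1, e2] with z z1 z2 hz
  rw [z2 (cell_subset hab j hz), Pi.sub_apply, z1 hz]
  rfl

variable {c : Medium} {F₁ F₂ F₃ : ℝ → L2 a b} {E₀ H₀ : ℝ → ℝ}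
  {H E P : ℝ → Sobolev (k + 1) a b} {P' : ℝ → L2 a b}
  {Hh Eh Ph : ℝ → DG k M} {ψh : ℝ → ℝ → DG k M}

/-- The energy estimate for the part of the error that lies in `V_h`. -/
theorem discrete_error (hab : a < b) (hT : 0 < T)
    (hsol : IsSolution c T F₁ F₂ F₃ E₀ H₀ H E P P')
    (hE : ContDiffOn ℝ 1 E (Icc 0 T)) (hH : ContDiffOn ℝ 1 H (Icc 0 T))
    (h : IsDGSolution c T F₁ F₂ F₃ Hh Eh Ph ψh) (h0 : ∀ l > 0, ψh l 0 = 0)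
    (hP0 : IsL2Proj a b (fn (P 0)) (Ph 0)) (hE0 : IsProjE c a b E₀ H₀ (Eh 0))
    (hH0 : IsProjH c a b E₀ H₀ (Hh 0)) {B : ℝ} (hB : 0 ≤ B)
    (hbE : ∀ t ∈ Icc 0 T, ‖fn (E t) - projECLM M c hab k (E t, H t)‖ ≤ B)
    (hbE' : ∀ t ∈ Icc 0 T, ‖dt T E t - projECLM M c hab k
      (derivWithin E (Icc 0 T) t, derivWithin H (Icc 0 T) t)‖ ≤ B)
    (hbH' : ∀ t ∈ Icc 0 T, ‖dt T H t - projHCLM M c hab k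
      (derivWithin E (Icc 0 T) t, derivWithin H (Icc 0 T) t)‖ ≤ B)
    (hw : IsOrthonormalBasis a b w) {K : ℝ}
    (hK : ∀ (x y p d : Fin n → ℝ → ℝ) (δ : ℝ), 0 ≤ δ →
      (∀ i, AbsolutelyContinuousOnInterval (x i) 0 T) →
      (∀ i, AbsolutelyContinuousOnInterval (y i) 0 T) →
      (∀ i, AbsolutelyContinuousOnInterval (p i) 0 T) →
      (∀ i, AbsolutelyContinuousOnInterval (d i) 0 T) →
      (∀ i, x i 0 = 0) → (∀ i, y i 0 = 0) → (∀ i, p i 0 = 0) →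
      (∀ᵐ t, t ∈ Ioo 0 T →
        ∑ i, (c.μ₀ * (x i t * deriv (x i) t) + c.ε₀ * c.εinf * (y i t * deriv (y i) t)
            + y i t * deriv (p i) t)
          ≤ δ * (√(∑ i, x i t ^ 2) + √(∑ i, y i t ^ 2))) →
      (∀ᵐ t, t ∈ Ioo 0 T → ∀ i,
        c.theta * caputoR c.α (deriv (p i)) t + c.kap * p i t = y i t + d i t) →
      (∀ t ∈ Icc 0 T, ∑ i, d i t ^ 2 ≤ δ ^ 2) →
      (∀ᵐ t, t ∈ Ioo 0 T → ∑ i, deriv (d i) t ^ 2 ≤ δ ^ 2) →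
      ∀ t ∈ Icc 0 T, ∑ i, (x i t ^ 2 + y i t ^ 2 + p i t ^ 2) ≤ K * δ ^ 2)
    {t : ℝ} (ht : t ∈ Icc 0 T) :
    ‖DG.toL2 a b k M (Hh t - projH c hab (E t) (H t))‖ ^ 2
      + ‖DG.toL2 a b k M (Eh t - projE c hab (E t) (H t))‖ ^ 2
      + ∑ i, inner ℝ (DG.toL2 a b k M (w i)) (DG.toL2 a b k M (Ph t) - fn (P t)) ^ 2
      ≤ K * ((c.μ₀ + c.ε₀ * c.εinf + 1) * B) ^ 2 := by
  have hμ := c.μ₀_pos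
  have hε : 0 < c.ε₀ * c.εinf := mul_pos c.ε₀_pos c.εinf_pos
  -- The summand `1` gives `B ≤ δ`, so the same `δ` also bounds the coordinates of the projection
  -- error of `E` and of its time derivative.
  set δ := (c.μ₀ + c.ε₀ * c.εinf + 1) * B with hδ
  have hδ0 : 0 ≤ δ := by positivity
  have hBδ : B ≤ δ := by rw [hδ]; nlinarith
  set q : Fin n → L2 a b := fun i => DG.toL2 a b k M (w i) with hq
  have hW : ContDiffOn ℝ 1 (fun t => (E t, H t)) (Icc 0 T) := hE.prodMk hH
  have hWd : ∀ t ∈ Ioo 0 T, HasDerivAt (fun t => (E t, H t))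
      (derivWithin E (Icc 0 T) t, derivWithin H (Icc 0 T) t) t := fun t ht =>
    (hasDerivAt_of_contDiffOn hE ht).prodMk (hasDerivAt_of_contDiffOn hH ht)
  set ΛE : Fin n → Sobolev (k + 1) a b × Sobolev (k + 1) a b →L[ℝ] ℝ :=
    fun i => (innerSL ℝ (q i)).comp (projECLM M c hab k) with hΛE
  set ΛH : Fin n → Sobolev (k + 1) a b × Sobolev (k + 1) a b →L[ℝ] ℝ :=
    fun i => (innerSL ℝ (q i)).comp (projHCLM M c hab k) with hΛH
  set ΛF : Fin n → Sobolev (k + 1) a b × Sobolev (k + 1) a b →L[ℝ] ℝ :=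
    fun i => (innerSL ℝ (q i)).comp ((sobolevProj 0).comp
      (ContinuousLinearMap.fst ℝ _ _) - projECLM M c hab k) with hΛF
  have hΛF_apply : ∀ i u v, ΛF i (u, v) = inner ℝ (q i) (fn u - projECLM M c hab k (u, v)) :=
    fun _ _ _ => rfl
  set x : Fin n → ℝ → ℝ := fun i t => innerDG k M (q i) (Hh t) - ΛH i (E t, H t) with hx
  set y : Fin n → ℝ → ℝ := fun i t => innerDG k M (q i) (Eh t) - ΛE i (E t, H t) with hy
  set p : Fin n → ℝ → ℝ := fun i t => innerDG k M (q i) (Ph t)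
    - ∫ s in (0 : ℝ)..t, inner ℝ (q i) (P' s) with hp
  set d : Fin n → ℝ → ℝ := fun i t => -ΛF i (E t, H t) with hd
  have hxv : ∀ i t, x i t = inner ℝ (q i) (DG.toL2 a b k M (Hh t - projH c hab (E t) (H t))) := by
    intro i t
    rw [map_sub, ← projHCLM_apply, inner_sub_right]; rfl
  have hyv : ∀ i t, y i t = inner ℝ (q i) (DG.toL2 a b k M (Eh t - projE c hab (E t) (H t))) := by
    intro i t
    rw [map_sub, ← projECLM_apply, inner_sub_right]; rfl
  have hpv : ∀ i, ∀ t ∈ Icc 0 T, p i t = inner ℝ (q i) (DG.toL2 a b k M (Ph t) - fn (P t)) := by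
    intro i t ht
    rw [inner_sub_right, hsol.time_deriv_P.inner_eq hsol.init_P (q i) ht]; rfl
  have hint := hsol.time_deriv_P.intervalIntegrable_inner hT.le
  have hx0 : ∀ i, x i 0 = 0 := fun i => by
    rw [hxv, eq_projH c hab (E 0) (H 0) hsol.init_E hsol.init_H hH0, sub_self, map_zero,
      inner_zero_right]
  have hy0 : ∀ i, y i 0 = 0 := fun i => by
    rw [hyv, eq_projE c hab (E 0) (H 0) hsol.init_E hsol.init_H hE0, sub_self, map_zero,
      inner_zero_right]
  have hp0 : ∀ i, p i 0 = 0 := fun i => by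
    rw [hpv i 0 ⟨le_rfl, hT.le⟩, hP0.inner_eq_zero hab]
  have hAEp : ∀ᵐ t, ∀ i, t ∈ uIcc 0 T → ∀ r ∈ uIcc 0 T,
      HasDerivAt (fun s => ∫ s in r..s, inner ℝ (q i) (P' s)) (inner ℝ (q i) (P' t)) t :=
    ae_all_iff.2 fun i => (hint (q i)).ae_hasDerivAt_integral
  have henergy : ∀ᵐ t, t ∈ Ioo 0 T →
      ∑ i, (c.μ₀ * (x i t * deriv (x i) t) + c.ε₀ * c.εinf * (y i t * deriv (y i) t)
          + y i t * deriv (p i) t)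
        ≤ δ * (√(∑ i, x i t ^ 2) + √(∑ i, y i t ^ 2)) := by
    filter_upwards [field_error hab hT hsol h, h.ac_H.hasDerivAt hT, h.ac_E.hasDerivAt hT,
      h.ac_P.hasDerivAt hT, hAEp] with t hf dH dE dP dP' ht
    have ht' := Ioo_subset_Icc_self ht
    have htu : t ∈ uIcc 0 T := by rwa [uIcc_of_le hT.le]
    set W' := (derivWithin E (Icc 0 T) t, derivWithin H (Icc 0 T) t) with hW'
    have hx' : ∀ i, deriv (x i) t
        = inner ℝ (q i) (DG.toL2 a b k M (dot Hh t) - projHCLM M c hab k W') := fun i => by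
      rw [inner_sub_right]
      exact ((dH ht (innerDG k M (q i))).fun_sub
        ((ΛH i).hasFDerivAt.comp_hasDerivAt t (hWd t ht))).deriv
    have hy' : ∀ i, deriv (y i) t
        = inner ℝ (q i) (DG.toL2 a b k M (dot Eh t) - projECLM M c hab k W') := fun i => by
      rw [inner_sub_right]
      exact ((dE ht (innerDG k M (q i))).fun_sub
        ((ΛE i).hasFDerivAt.comp_hasDerivAt t (hWd t ht))).deriv
    have hp' : ∀ i, deriv (p i) t = inner ℝ (q i) (DG.toL2 a b k M (dot Ph t) - P' t) :=
      fun i => by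
      rw [inner_sub_right]
      exact ((dP ht (innerDG k M (q i))).fun_sub (dP' i htu 0 left_mem_uIcc)).deriv
    set eH := DG.toL2 a b k M (Hh t - projH c hab (E t) (H t)) with heH
    set eE := DG.toL2 a b k M (Eh t - projE c hab (E t) (H t)) with heE
    have s1 : √(∑ i, x i t ^ 2) = ‖eH‖ := by
      simp only [hxv]
      rw [hw.sum_sq, Real.sqrt_sq (norm_nonneg _)]
    have s2 : √(∑ i, y i t ^ 2) = ‖eE‖ := by
      simp only [hyv]
      rw [hw.sum_sq, Real.sqrt_sq (norm_nonneg _)]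
    rw [s1, s2, Finset.sum_add_distrib, Finset.sum_add_distrib, ← Finset.mul_sum,
      ← Finset.mul_sum]
    simp only [hx', hy', hp', hxv, hyv]
    rw [hw.parseval, hw.parseval, hw.parseval]
    have f := hf ht
    exact inner_error_bound hμ.le hε.le hB f (hbH' t ht') (hbE' t ht')
  have hcap : ∀ᵐ t, t ∈ Ioo 0 T → ∀ i,
      c.theta * caputoR c.α (deriv (p i)) t + c.kap * p i t = y i t + d i t := by
    -- There are finitely many coordinates, so the null sets combine. The right side `E_h - E` is
    -- then split at the projection of `E` into `y` and `d`.
    have := ae_all_iff.2 fun i => polarization_error hab hT hsol h h0 (w i) (p := p i) rfl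
    filter_upwards [this] with t h1 ht i
    rw [h1 i ht, hyv, hd]
    simp only [hΛF_apply]
    rw [map_sub, ← projECLM_apply]
    simp only [inner_sub_right, hq]
    ring
  have hdb : ∀ t ∈ Icc 0 T, ∑ i, d i t ^ 2 ≤ δ ^ 2 := by
    intro t ht
    simp only [hd, neg_sq, hΛF_apply]
    refine (hw.bessel _).trans ?_
    exact pow_le_pow_left₀ (norm_nonneg _) ((hbE t ht).trans hBδ) 2
  have hdb' : ∀ᵐ t, t ∈ Ioo 0 T → ∑ i, deriv (d i) t ^ 2 ≤ δ ^ 2 := by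
    refine Filter.Eventually.of_forall fun t ht => ?_
    have hd' : ∀ i, deriv (d i) t = -inner ℝ (q i) (dt T E t - projECLM M c hab k
        (derivWithin E (Icc 0 T) t, derivWithin H (Icc 0 T) t)) := fun i =>
      ((ΛF i).hasFDerivAt.comp_hasDerivAt t (hWd t ht)).fun_neg.deriv
    simp only [hd', neg_sq]
    refine (hw.bessel _).trans ?_
    exact pow_le_pow_left₀ (norm_nonneg _) ((hbE' t (Ioo_subset_Icc_self ht)).trans hBδ) 2
  have key := hK x y p d δ hδ0
    (fun i => (h.ac_H.linear _).fun_sub (absolutelyContinuous_clm_comp hT hW _))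
    (fun i => (h.ac_E.linear _).fun_sub (absolutelyContinuous_clm_comp hT hW _))
    (fun i => (h.ac_P.linear _).fun_sub
      ((hint (q i)).absolutelyContinuousOnInterval_intervalIntegral left_mem_uIcc))
    (fun i => (absolutelyContinuous_clm_comp hT hW _).fun_neg)
    hx0 hy0 hp0 henergy hcap hdb hdb' t ht
  rw [Finset.sum_add_distrib, Finset.sum_add_distrib] at key
  simp only [hxv, hyv, fun i => hpv i t ht] at key
  rw [hw.sum_sq, hw.sum_sq] at key
  exact key

theorem convergence {c : Medium} {k : ℕ} {a b T : ℝ} (hab : a < b)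
    (hT : 0 < T) {F₁ F₂ F₃ : ℝ → L2 a b} {E₀ H₀ : ℝ → ℝ}
    {H E P : ℝ → Sobolev (k + 1) a b} {P' : ℝ → L2 a b}
    (hsol : IsSolution c T F₁ F₂ F₃ E₀ H₀ H E P P')
    (hE : ContDiffOn ℝ 1 E (Icc 0 T)) (hH : ContDiffOn ℝ 1 H (Icc 0 T))
    (hP : ∃ R : ℝ, ∀ t ∈ Icc 0 T, ‖P t‖ ≤ R) :
    ∃ C : ℝ, 0 < C ∧ ∀ (M : ℕ) [NeZero M] (Hh Eh Ph : ℝ → DG k M) (ψh : ℝ → ℝ → DG k M),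
      IsDGSolution c T F₁ F₂ F₃ Hh Eh Ph ψh →
      (∀ l > 0, ψh l 0 = 0) →
      IsL2Proj a b (fn (P 0)) (Ph 0) →
      IsProjE c a b E₀ H₀ (Eh 0) →
      IsProjH c a b E₀ H₀ (Hh 0) →
      ∀ t ∈ Icc 0 T,
        errSq (fn (E t)) (Eh t) + errSq (fn (H t)) (Hh t) + errSq (fn (P t)) (Ph t)
          ≤ C * meshSize a b M ^ (2 * k + 2) := by
  have hμ := c.μ₀_pos
  have hε : 0 < c.ε₀ * c.εinf := mul_pos c.ε₀_pos c.εinf_pos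
  obtain ⟨K, hK, henergy⟩ := energy_estimate c.α_pos c.α_lt_one hT hμ hε c.kap_pos c.theta_pos
  obtain ⟨C₁, hC₁, hproj⟩ := proj_error c k
  obtain ⟨C₂, hC₂, hrad⟩ := radauOp_error k
  obtain ⟨RE, hRE⟩ := exists_bound_of_contDiffOn hT hE
  obtain ⟨RH, hRH⟩ := exists_bound_of_contDiffOn hT hH
  obtain ⟨RP, hRP⟩ := hP
  have h0T : (0 : ℝ) ∈ Icc 0 T := ⟨le_rfl, hT.le⟩
  have hRE0 : 0 ≤ RE := (norm_nonneg _).trans (hRE 0 h0T).1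
  have hRH0 : 0 ≤ RH := (norm_nonneg _).trans (hRH 0 h0T).1
  have hRP0 : 0 ≤ RP := (norm_nonneg _).trans (hRP 0 h0T)
  set A := C₁ * (RE + RH) with hA
  set S := c.μ₀ + c.ε₀ * c.εinf + 1 with hS
  -- `E` and `H` contribute `2 A²` each, `P` contributes the term with `6`, all discrete errors
  -- enter with a factor at most `4`, and `1` makes the constant positive.
  refine ⟨4 * A ^ 2 + 6 * (C₂ * RP) ^ 2 + 4 * K * (S * A) ^ 2 + 1, by positivity, ?_⟩
  intro M _ Hh Eh Ph ψh h h0 hP0 hE0 hH0 t ht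
  have hh := (meshSize_pos (M := M) hab).le
  obtain ⟨n, w, hw1, hw2⟩ := exists_orthonormal a b k M
  have hw : IsOrthonormalBasis a b w := ⟨hw1, hw2⟩
  set η := meshSize a b M ^ (k + 1) with hη
  have hη0 : 0 ≤ η := by positivity
  have hmono : ∀ r s : ℝ, r ≤ RE → s ≤ RH → C₁ * η * (r + s) ≤ A * η := fun r s hr hs =>
    (mul_le_mul_of_nonneg_left (add_le_add hr hs) (by positivity)).trans_eq (by rw [hA]; ring)
  have hbE : ∀ t ∈ Icc 0 T, ‖fn (E t) - projECLM M c hab k (E t, H t)‖ ≤ A * η := fun t ht =>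
    (hproj a b hab M (E t) (H t)).1.trans (hmono _ _ (hRE t ht).1 (hRH t ht).1)
  have hbH : ∀ t ∈ Icc 0 T, ‖fn (H t) - projHCLM M c hab k (E t, H t)‖ ≤ A * η := fun t ht =>
    (hproj a b hab M (E t) (H t)).2.trans (hmono _ _ (hRE t ht).1 (hRH t ht).1)
  have key := discrete_error hab hT hsol hE hH h h0 hP0 hE0 hH0 (B := A * η) (by positivity) hbE
    (fun t ht => (hproj a b hab M _ _).1.trans (hmono _ _ (hRE t ht).2 (hRH t ht).2))
    (fun t ht => (hproj a b hab M _ _).2.trans (hmono _ _ (hRE t ht).2 (hRH t ht).2))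
    hw (K := K) (henergy n) ht
  have e1 := sq_norm_sub_le (fn (E t)) (DG.toL2 a b k M (Eh t)) (projECLM M c hab k (E t, H t))
  have e2 := sq_norm_sub_le (fn (H t)) (DG.toL2 a b k M (Hh t)) (projHCLM M c hab k (E t, H t))
  -- For `P` the comparison is made at a fixed time, so a uniform bound of its Sobolev norm suffices
  -- and no time derivative of its projection is needed.
  have e3 := hw.sq_norm_sub_le (fn (P t)) (Ph t) (radauOp hab k 0 (P t))
  have f1 := pow_le_pow_left₀ (norm_nonneg _) (hbE t ht) 2
  have f2 := pow_le_pow_left₀ (norm_nonneg _) (hbH t ht) 2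
  have f3 := pow_le_pow_left₀ (norm_nonneg _) ((hrad a b hab M 0 (P t)).trans
    (mul_le_mul_of_nonneg_left (hRP t ht) (by positivity))) 2
  rw [radauCLM_apply] at f3
  rw [norm_sub_rev (projECLM M c hab k (E t, H t)), projECLM_apply, ← map_sub,
    ← projECLM_apply] at e1
  rw [norm_sub_rev (projHCLM M c hab k (E t, H t)), projHCLM_apply, ← map_sub,
    ← projHCLM_apply] at e2
  rw [errSq_eq hab, errSq_eq hab, errSq_eq hab,
    show meshSize a b M ^ (2 * k + 2) = η ^ 2 by rw [hη, ← pow_mul]; congr 1; ring]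
  have g0 : 0 ≤ ∑ i, inner ℝ (DG.toL2 a b k M (w i)) (DG.toL2 a b k M (Ph t) - fn (P t)) ^ 2 :=
    Finset.sum_nonneg fun i _ => sq_nonneg _
  have g1 := sq_nonneg ‖DG.toL2 a b k M (Hh t - projH c hab (E t) (H t))‖
  have g2 := sq_nonneg ‖DG.toL2 a b k M (Eh t - projE c hab (E t) (H t))‖
  have g3 := sq_nonneg η
  have hfin : (4 * A ^ 2 + 6 * (C₂ * RP) ^ 2 + 4 * K * (S * A) ^ 2 + 1) * η ^ 2
      = 4 * (A * η) ^ 2 + 6 * (C₂ * η * RP) ^ 2 + 4 * (K * (S * (A * η)) ^ 2) + η ^ 2 := by ring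
  rw [hfin]
  linarith

end Convergence

end ColeCole

end

theorem mainTheorem3 (c : ColeCole.Medium) (k : ℕ) (hk : 1 ≤ k) (a b T : ℝ) (hab : a < b)
    (hT : 0 < T) (F₁ F₂ F₃ : ℝ → ColeCole.L2 a b) (E₀ H₀ : ℝ → ℝ)
    (H E P : ℝ → ColeCole.Sobolev (k + 1) a b) (P' : ℝ → ColeCole.L2 a b)
    (hsol : ColeCole.IsSolution c T F₁ F₂ F₃ E₀ H₀ H E P P')
    (hE : ContDiffOn ℝ 1 E (Set.Icc 0 T)) (hH : ContDiffOn ℝ 1 H (Set.Icc 0 T))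
    (hP : ∃ R : ℝ, ∀ t ∈ Set.Icc 0 T, ‖P t‖ ≤ R) :
    ∃ C : ℝ, 0 < C ∧ ∀ (M : ℕ) [NeZero M] (Hh Eh Ph : ℝ → ColeCole.DG k M)
      (ψh : ℝ → ℝ → ColeCole.DG k M),
      ColeCole.IsDGSolution c T F₁ F₂ F₃ Hh Eh Ph ψh →
      (∀ l > 0, ψh l 0 = 0) →
      ColeCole.IsL2Proj a b (ColeCole.fn (P 0)) (Ph 0) →
      ColeCole.IsProjE c a b E₀ H₀ (Eh 0) →
      ColeCole.IsProjH c a b E₀ H₀ (Hh 0) →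
      ∀ t ∈ Set.Icc 0 T,
        ColeCole.errSq (ColeCole.fn (E t)) (Eh t) + ColeCole.errSq (ColeCole.fn (H t)) (Hh t)
            + ColeCole.errSq (ColeCole.fn (P t)) (Ph t)
          ≤ C * ColeCole.meshSize a b M ^ (2 * k + 2) := by
  exact ColeCole.convergence hab hT hsol hE hH hP
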